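/- Model the hyperbolic plane $\mathbb{H}^2$ (curvature $-1$) as the Poincaré disk with metric $g=\frac{4|dp|^2}{(1-|p|^2)^2}$, and let $D_R$ be the open geodesic disk of radius $R$ about its center. Periodic Amsler surfaces. For $n\ge 2$ let $\varphi_n$ be the solution on $[0,\infty)$ of the Painlevé III equation $\varphi''(z)+\frac1z\varphi'(z)-\sin\varphi(z)=0$ $(z>0)$ with $\varphi_n(0)=\pi/n$, $\varphi_n'(0)=0$, and let $\varphi_n^{-1}(\pi)$ denote the first point at which it takes the value $\pi$. Put $Q_n=\{(u,v): u,v\ge 0,\ 2\sqrt{uv}<\varphi_n^{-1}(\pi)\}$. Let $r:Q_n\to\mathbb{R}^3$ be the smooth parametrized surface with first fundamental form $du^2+2\cos\phi\,du\,dv+dv^2$ and second fundamental form $2\sin\phi\,du\,dv$, where $\phi(u,v)=\varphi_n(2\sqrt{uv})$, normalized so that the $u$- and $v$-axes are mapped to straight lines: $r(u,0)=u\,(1,0,0)$ and $r(0,v)=v\,(\cos\frac{\pi}{n},\sin\frac{\pi}{n},0)$. The $n$-periodic Amsler surface $S_n$ is the odd periodic extension of $r(Q_n)$ across these asymptotic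 lines: the union of the images of $r(Q_n)$ and of its image under the half-turn $(x_1,x_2,x_3)\mapsto(x_1,-x_2,-x_3)$ under the $n$ rotations about the $x_3$-axis by the angles $2\pi k/n$, $0\le k<n$. Proposition. For every $R>0$ there is an $N$ such that for every $n\ge N$ the $n$-periodic Amsler surface $S_n$ exists and there is a $C^1$ isometric immersion $\mathbf{x}:D_R\to\mathbb{R}^3$ (that is, $D\mathbf{x}^T D\mathbf{x}=g$ at every point of $D_R$) of class $W^{2,2}(D_R,\mathbb{R}^3)$ with $\mathbf{x}(0)=0$ and $\mathbf{x}(D_R)\subseteq S_n$, which is piecewise smooth: it is $C^\infty$ on $D_R\cap\Sigma_k$ (up to the bounding rays) for each of the $2n$ closed sectors $\Sigma_k=\{k\pi/n\le\theta\le(k+1)\pi/n\}$, $0\le k<2n$, of the polar angle $\theta$. -/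

import Mathlib

open Set MeasureTheory
open scoped ContDiff

noncomputable section

/-- The Euclidean plane. -/
abbrev E2 : Type := EuclideanSpace ℝ (Fin 2)

/-- Euclidean three-space. -/
abbrev E3 : Type := EuclideanSpace ℝ (Fin 3)

/-! ### The hyperbolic plane (Poincaré disk model, curvature `-1`) -/

/-- Hyperbolic distance between two points of the open unit disk. -/
def hypDist (p q : E2) : ℝ :=
  Real.arcosh (1 + 2 * ‖p - q‖ ^ 2 / ((1 - ‖p‖ ^ 2) * (1 - ‖q‖ ^ 2)))

/-- The open geodesic disk of hyperbolic radius `R` about the origin of the Poincaré disk. -/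
def hypDisk (R : ℝ) : Set E2 := {p | ‖p‖ < 1 ∧ hypDist 0 p < R}

/-- The Riemannian metric of the Poincaré disk, at the point `p`. -/
def hypMetric (p X Y : E2) : ℝ := 4 / (1 - ‖p‖ ^ 2) ^ 2 * inner ℝ X Y

/-- `x` is a `C¹` isometric immersion of the open set `D` of the hyperbolic plane into `ℝ³`:
`Dxᵀ · Dx = g` at every point of `D`. -/
def IsIsometricImmersionOn (D : Set E2) (x : E2 → E3) : Prop :=
  ContDiffOn ℝ 1 x D ∧
    ∀ p ∈ D, ∀ X Y : E2, inner ℝ (fderiv ℝ x p X) (fderiv ℝ x p Y) = hypMetric p X Y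

/-! ### The Sobolev space `W^{2,2}` -/

/-- `g` is the weak partial derivative of `f` in the direction `e` on the open set `Ω`. -/
def IsWeakPartial (Ω : Set E2) (e : E2) (f g : E2 → E3) : Prop :=
  ∀ ψ : E2 → ℝ, ContDiff ℝ ∞ ψ → HasCompactSupport ψ → tsupport ψ ⊆ Ω →
    ∫ p in Ω, fderiv ℝ ψ p e • f p = - ∫ p in Ω, ψ p • g p

/-- `f ∈ W^{2,2}(Ω, ℝ³)`: `f` and its weak partial derivatives of orders one and two
are square integrable on `Ω`. -/
def MemW22 (Ω : Set E2) (f : E2 → E3) : Prop :=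
  MemLp f 2 (volume.restrict Ω) ∧
    ∃ (g : Fin 2 → E2 → E3) (h : Fin 2 → Fin 2 → E2 → E3),
      (∀ i, MemLp (g i) 2 (volume.restrict Ω) ∧
        IsWeakPartial Ω (EuclideanSpace.single i 1) f (g i)) ∧
      ∀ i j, MemLp (h i j) 2 (volume.restrict Ω) ∧
        IsWeakPartial Ω (EuclideanSpace.single j 1) (g i) (h i j)

/-! ### Periodic Amsler surfaces -/

/-- `φ`, considered on `[0, ∞)`, is the Painlevé III solution `φ_n`:
`φ'' + φ' / z - sin φ = 0` for `z > 0`, with `φ(0) = π / n` and `φ'(0) = 0`. -/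
structure IsPainleveSolution (n : ℕ) (φ : ℝ → ℝ) : Prop where
  init : φ 0 = Real.pi / n
  deriv_init : HasDerivWithinAt φ 0 (Ici 0) 0
  contDiffOn : ContDiffOn ℝ 2 φ (Ioi 0)
  ode : ∀ z > 0, deriv (deriv φ) z + 1 / z * deriv φ z - Real.sin (φ z) = 0

/-- The part of the closed first quadrant of the `u`-`v` plane that lies before the singular
curve, i.e. `2 √(u v)` is smaller than the first point at which `φ` reaches `π`. -/
def amslerDomain (φ : ℝ → ℝ) : Set (ℝ × ℝ) :=
  {p | 0 ≤ p.1 ∧ 0 ≤ p.2 ∧ ∀ z ∈ Icc 0 (2 * √(p.1 * p.2)), φ z < Real.pi}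

/-- The generating angle `φ(2 √(u v))`. -/
def genAngle (φ : ℝ → ℝ) (p : ℝ × ℝ) : ℝ := φ (2 * √(p.1 * p.2))

/-- `∂r/∂u` on `Q` (one-sided where `p` is a boundary point of `Q`). -/
def partialU (Q : Set (ℝ × ℝ)) (r : ℝ × ℝ → E3) (p : ℝ × ℝ) : E3 :=
  fderivWithin ℝ r Q p (1, 0)

/-- `∂r/∂v` on `Q` (one-sided where `p` is a boundary point of `Q`). -/
def partialV (Q : Set (ℝ × ℝ)) (r : ℝ × ℝ → E3) (p : ℝ × ℝ) : E3 :=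
  fderivWithin ℝ r Q p (0, 1)

/-- The unit normal `r_u × r_v / ‖r_u × r_v‖`. -/
def unitNormal (Q : Set (ℝ × ℝ)) (r : ℝ × ℝ → E3) (p : ℝ × ℝ) : E3 :=
  let c : E3 := WithLp.toLp 2 (crossProduct (partialU Q r p).ofLp (partialV Q r p).ofLp)
  ‖c‖⁻¹ • c

/-- `r` parametrizes, over `amslerDomain φ`, the piece between two straight asymptotic lines of
the Amsler surface with generating angle `φ(2 √(u v))`: it is smooth, the `u`- and `v`-axis go to
the two rays from the origin in the directions `(1, 0, 0)` and `(cos (π/n), sin (π/n), 0)`, the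
first fundamental form is `du² + 2 cos φ du dv + dv²`, and the second is `2 sin φ du dv`
(so the coordinate lines are asymptotic lines, and `r` is a Chebyshev net). -/
structure IsAmslerSector (n : ℕ) (φ : ℝ → ℝ) (r : ℝ × ℝ → E3) : Prop where
  smooth : ContDiffOn ℝ ∞ r (amslerDomain φ)
  uAxis : ∀ u : ℝ, 0 ≤ u → r (u, 0) = u • !₂[1, 0, 0]
  vAxis : ∀ v : ℝ, 0 ≤ v → r (0, v) = v • !₂[Real.cos (Real.pi / n), Real.sin (Real.pi / n), 0]
  g11 : ∀ p ∈ amslerDomain φ,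
    inner ℝ (partialU (amslerDomain φ) r p) (partialU (amslerDomain φ) r p) = 1
  g12 : ∀ p ∈ amslerDomain φ,
    inner ℝ (partialU (amslerDomain φ) r p) (partialV (amslerDomain φ) r p)
      = Real.cos (genAngle φ p)
  g22 : ∀ p ∈ amslerDomain φ,
    inner ℝ (partialV (amslerDomain φ) r p) (partialV (amslerDomain φ) r p) = 1
  h11 : ∀ p ∈ amslerDomain φ,
    inner ℝ (partialU (amslerDomain φ) (partialU (amslerDomain φ) r) p)
      (unitNormal (amslerDomain φ) r p) = 0
  h12 : ∀ p ∈ amslerDomain φ,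
    inner ℝ (partialU (amslerDomain φ) (partialV (amslerDomain φ) r) p)
      (unitNormal (amslerDomain φ) r p) = Real.sin (genAngle φ p)
  h22 : ∀ p ∈ amslerDomain φ,
    inner ℝ (partialV (amslerDomain φ) (partialV (amslerDomain φ) r) p)
      (unitNormal (amslerDomain φ) r p) = 0

/-- Rotation of `ℝ³` by the angle `θ` about the third axis. -/
def rotZ (θ : ℝ) (p : E3) : E3 :=
  !₂[Real.cos θ * p 0 - Real.sin θ * p 1, Real.sin θ * p 0 + Real.cos θ * p 1, p 2]

/-- The half-turn about the first axis; in cylindrical coordinates `(ϱ, θ, z) ↦ (ϱ, -θ, -z)`. -/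
def halfTurnX (p : E3) : E3 := !₂[p 0, -p 1, -p 2]

/-- The odd periodic extension of a piece `P` that is bounded by the rays of polar angle `0` and
`π / n` in the horizontal plane: `P` is extended oddly across the first ray by the half-turn about
it, and then with period `2π / n` in the polar angle. (The half-turn about the second ray is
`rotZ (2 * π / n) ∘ halfTurnX`, so this extends oddly across each of the `2n` rays.) -/
def oddPeriodicExtension (n : ℕ) (P : Set E3) : Set E3 :=
  ⋃ k : Fin n, rotZ (2 * Real.pi * (k : ℕ) / n) '' (P ∪ halfTurnX '' P)

/-- `S` is the periodic Amsler surface with `n ≥ 2` waves, with its vertex at the origin and its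
asymptotic rays in the horizontal plane. -/
def IsPeriodicAmslerSurface (n : ℕ) (S : Set E3) : Prop :=
  2 ≤ n ∧ ∃ (φ : ℝ → ℝ) (r : ℝ × ℝ → E3), IsPainleveSolution n φ ∧ IsAmslerSector n φ r ∧
    S = oddPeriodicExtension n (r '' amslerDomain φ)

/-- The closed sector of the plane between the polar angles `k π / n` and `(k + 1) π / n`. -/
def planeSector (n k : ℕ) : Set E2 :=
  {p | ∃ ρ θ : ℝ, 0 ≤ ρ ∧ k * Real.pi / n ≤ θ ∧ θ ≤ (k + 1) * Real.pi / n ∧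
    p = !₂[ρ * Real.cos θ, ρ * Real.sin θ]}

end

/-!
The surface and the hyperbolic disk are both described by one and the same Chebyshev net.

In the variable `t = u v` the Painlevé III equation for the generating angle becomes
`(t f')' = sin f`, `f(0) = c = π / n`, which has a smooth solution `f` on the whole line
(`exists_isAmslerProfile`). It satisfies `|f(t)| ≤ 2 c exp(2 |t|)`, so that on any given square
`0 ≤ u, v ≤ M` the angle `f(u v)` is small as soon as `n` is large; this is where `n ≥ N` is needed.
The equation for `f` is the sine-Gordon equation for `f(u v)`, that is the compatibility condition
of two linear systems: the Gauss-Weingarten equations of a surface in `ℝ³` with first and second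
fundamental forms `du² + 2 cos f du dv + dv²` and `2 sin f du dv`, whose solution is the Amsler
surface `r` (`exists_isAmslerFrame`), and the structure equations of the hyperboloid in Minkowski
space, whose solution is a map `X` of the `u`-`v` plane into the hyperbolic plane that pulls the
hyperbolic metric back to the same first fundamental form (`exists_isDevelopingFrame`). Thus
`r ∘ X⁻¹` is an isometric immersion wherever `X` can be inverted.

The map `X` sends the two axes to geodesic rays that make the angle `c`. For small `f(u v)`, `X₀`
increases in `u` and in `v`, and the polar angle decreases in `u` and increases in `v`; by
monotonicity `X` is injective on the square (`IsDevelopingFrame.injOn_X`), and by connectedness of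
an interval its image contains the sector of angle `c` of a disk whose radius grows with `M`
(`IsDevelopingFrame.exists_X_eq`). The inverse is smooth up to the boundary of the sector, because
`X` is an immersion beyond the square as well. This gives the immersion of one sector
(`exists_isSectorImmersion`).

It maps the bounding rays to straight rays, so its differential there is compatible with the
reflections of the disk and the half-turns of space about these rays. Hence the `2n` images of the
sector under these symmetries fit together to a `C¹` isometric immersion of the disk that is smooth
on each sector (`IsSectorImmersion.exists_isometricImmersion`). Its differential is Lipschitz on
each sector of a smaller disk, hence on the smaller disk, and Lipschitz functions have bounded weak
derivatives (`memW22_of_piecewise_smooth`).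
-/

/-! ### Calculus of two real variables and of parametric integrals -/

open Filter Topology in
/-- Differentiation under the integral sign over a compact interval, for an integrand with
jointly continuous derivative. -/
theorem hasDerivAt_intervalIntegral_of_continuous {E : Type*} [NormedAddCommGroup E]
    [NormedSpace ℝ E] {F F' : ℝ → ℝ → E} (hF : Continuous (Function.uncurry F))
    (hF' : Continuous (Function.uncurry F')) (hd : ∀ x t, HasDerivAt (fun x => F x t) (F' x t) x)
    (a b x₀ : ℝ) :
    HasDerivAt (fun x => ∫ t in a..b, F x t) (∫ t in a..b, F' x₀ t) x₀ := by
  have hK : IsCompact (Metric.closedBall x₀ 1 ×ˢ uIcc a b) :=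
    (isCompact_closedBall x₀ 1).prod isCompact_uIcc
  obtain ⟨C, hC⟩ := hK.exists_bound_of_continuousOn hF'.continuousOn
  have c1 : ∀ x, Continuous (F x) := fun x => hF.comp (by fun_prop : Continuous fun t => (x, t))
  have c2 : ∀ x, Continuous (F' x) := fun x => hF'.comp (by fun_prop : Continuous fun t => (x, t))
  refine (intervalIntegral.hasDerivAt_integral_of_dominated_loc_of_deriv_le
    (bound := fun _ => C) (Metric.closedBall_mem_nhds x₀ one_pos)
    (Eventually.of_forall fun x => (c1 x).aestronglyMeasurable)
    ((c1 x₀).intervalIntegrable _ _) (c2 x₀).aestronglyMeasurable ?_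
    intervalIntegrable_const ?_).2
  · exact Eventually.of_forall fun t ht x hx => hC (x, t) ⟨hx, uIoc_subset_uIcc ht⟩
  · exact Eventually.of_forall fun t _ x _ => hd x t

/-- A function on the plane with continuous partial derivatives is differentiable. -/
theorem hasFDerivAt_of_partial {E : Type*} [NormedAddCommGroup E] [NormedSpace ℝ E]
    {y yu yv : ℝ × ℝ → E} (cu : Continuous yu) (cv : Continuous yv)
    (hu : ∀ u v, HasDerivAt (fun u => y (u, v)) (yu (u, v)) u)
    (hv : ∀ u v, HasDerivAt (fun v => y (u, v)) (yv (u, v)) v) (p : ℝ × ℝ) :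
    HasFDerivAt y ((ContinuousLinearMap.fst ℝ ℝ ℝ).smulRight (yu p) +
      (ContinuousLinearMap.snd ℝ ℝ ℝ).smulRight (yv p)) p := by
  have h := hasStrictFDerivAt_uncurry_coprod (𝕜 := ℝ) (u := p) (f := fun u v => y (u, v))
    (f₁ := fun u v => ContinuousLinearMap.toSpanSingleton ℝ (yu (u, v)))
    (f₂ := fun u v => ContinuousLinearMap.toSpanSingleton ℝ (yv (u, v)))
    (.of_forall fun q => (hu q.1 q.2).hasFDerivAt) (.of_forall fun q => (hv q.1 q.2).hasFDerivAt)
    (((ContinuousLinearMap.toSpanSingletonCLE (𝕜 := ℝ) (E := E)).continuous.comp cu).continuousAt)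
    (((ContinuousLinearMap.toSpanSingletonCLE (𝕜 := ℝ) (E := E)).continuous.comp cv).continuousAt)
  refine h.hasFDerivAt.congr_fderiv ?_
  ext <;> simp [Function.HasUncurry.uncurry]

/-- Averaging a `C^n` function over `[0, t]` with a polynomial weight gives a `C^n` function. -/
theorem contDiff_weighted_average {g : ℝ → ℝ} (n : ℕ) (hg : ContDiff ℝ n g) (j : ℕ) :
    ContDiff ℝ n (fun t => ∫ s in (0 : ℝ)..1, s ^ j * g (t * s)) := by
  induction n generalizing g j with
  | zero =>
    have := hg.continuous
    refine contDiff_zero.2 ?_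
    exact intervalIntegral.continuous_parametric_intervalIntegral_of_continuous' (by fun_prop) _ _
  | succ n ih =>
    have hd : ∀ t, HasDerivAt (fun t => ∫ s in (0 : ℝ)..1, s ^ j * g (t * s))
        (∫ s in (0 : ℝ)..1, s ^ (j + 1) * deriv g (t * s)) t := by
      intro t
      have h1 : ContDiff ℝ 1 g := hg.of_le (by norm_cast; omega)
      have := hg.continuous
      have hg' := h1.continuous_deriv le_rfl
      refine hasDerivAt_intervalIntegral_of_continuous
        (F := fun t s => s ^ j * g (t * s)) (F' := fun t s => s ^ (j + 1) * deriv g (t * s))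
        (by fun_prop) (by fun_prop) (fun t s => ?_) 0 1 t
      have h2 : HasDerivAt g (deriv g (t * s)) (t * s) :=
        (h1.differentiable one_ne_zero _).hasDerivAt
      have h3 := (h2.comp t ((hasDerivAt_id t).mul_const s)).const_mul (s ^ j)
      refine h3.congr_deriv ?_
      ring
    push_cast
    rw [contDiff_succ_iff_deriv]
    refine ⟨fun t => (hd t).differentiableAt, by simp, ?_⟩
    rw [show deriv (fun t => ∫ s in (0 : ℝ)..1, s ^ j * g (t * s)) =
      fun t => ∫ s in (0 : ℝ)..1, s ^ (j + 1) * deriv g (t * s) from funext fun t => (hd t).deriv]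
    refine ih ?_ _
    push_cast at hg
    exact (contDiff_succ_iff_deriv.1 hg).2.2

/-! ### The Painlevé III transcendents -/

open BoundedContinuousFunction in
/-- In the variable `t = z² / 4` the equation `φ'' + φ' / z = sin φ` reads `(t f')' = sin f`; it is
equivalent to the Volterra equation `f(t) = c + t ∫₀¹ ∫₀¹ sin f(t s σ) dσ ds`, which is a
contraction in the norm with weight `exp (2 |t|)`. -/
theorem exists_painleve_volterra (c : ℝ) (hc : 0 ≤ c) :
    ∃ f : ℝ → ℝ, Continuous f ∧ (∀ t, |f t| ≤ 2 * c * Real.exp (2 * |t|)) ∧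
      ∀ t, f t = c + t * ∫ s in (0 : ℝ)..1, ∫ σ in (0 : ℝ)..1, Real.sin (f (t * s * σ)) := by
  set w : ℝ → ℝ := fun t => Real.exp (2 * |t|) with hw
  have hwc : Continuous w := by fun_prop
  have hw1 : ∀ t, 1 ≤ w t := fun t => Real.one_le_exp (by positivity)
  have hw0 : ∀ t, 0 < w t := fun t => Real.exp_pos _
  have hwi : ∀ t, |t| * ∫ s in (0 : ℝ)..1, w (t * s) ≤ w t / 2 := by
    intro t
    have : |t| * ∫ s in (0 : ℝ)..1, w (t * s) = ∫ s in (0 : ℝ)..|t|, Real.exp (2 * s) := by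
      rw [← smul_eq_mul, show (∫ s in (0 : ℝ)..1, w (t * s)) =
        ∫ s in (0 : ℝ)..1, Real.exp (2 * (|t| * s)) from ?_]
      · rw [intervalIntegral.smul_integral_comp_mul_left (f := fun s => Real.exp (2 * s))]
        simp
      · refine intervalIntegral.integral_congr fun s hs => ?_
        rw [uIcc_of_le zero_le_one] at hs
        simp only [hw, abs_mul, abs_of_nonneg hs.1]
    rw [this, intervalIntegral.integral_comp_mul_left (fun s => Real.exp s) two_ne_zero,
      integral_exp]
    simp only [hw, smul_eq_mul, mul_zero, Real.exp_zero]
    linarith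
  let I : (ℝ → ℝ) → ℝ → ℝ := fun F t =>
    ∫ s in (0 : ℝ)..1, ∫ σ in (0 : ℝ)..1, Real.sin (F (t * s * σ))
  have hIc : ∀ F : ℝ → ℝ, Continuous F → Continuous fun x : ℝ × ℝ =>
      ∫ σ in (0 : ℝ)..1, Real.sin (F (x.1 * x.2 * σ)) := fun F hF =>
    intervalIntegral.continuous_parametric_intervalIntegral_of_continuous' (by fun_prop) _ _
  have hIc' : ∀ F : ℝ → ℝ, Continuous F → Continuous (I F) := fun F hF =>
    intervalIntegral.continuous_parametric_intervalIntegral_of_continuous' (hIc F hF) _ _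
  -- the contraction estimate
  have key : ∀ F G : ℝ → ℝ, Continuous F → Continuous G → ∀ B : ℝ, 0 ≤ B →
      (∀ t, |F t - G t| ≤ B * w t) → ∀ t, |t * I F t - t * I G t| ≤ B / 2 * w t := by
    intro F G hF hG B hB hFG t
    have e1 : I F t - I G t = ∫ s in (0 : ℝ)..1,
        ((∫ σ in (0 : ℝ)..1, Real.sin (F (t * s * σ))) -
          ∫ σ in (0 : ℝ)..1, Real.sin (G (t * s * σ))) := by
      rw [intervalIntegral.integral_sub]
      · exact ((hIc F hF).comp (by fun_prop : Continuous fun s => (t, s))).intervalIntegrable _ _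
      · exact ((hIc G hG).comp (by fun_prop : Continuous fun s => (t, s))).intervalIntegrable _ _
    have e2 : ∀ s ∈ Icc (0 : ℝ) 1, |(∫ σ in (0 : ℝ)..1, Real.sin (F (t * s * σ))) -
          ∫ σ in (0 : ℝ)..1, Real.sin (G (t * s * σ))| ≤ B * w (t * s) := by
      intro s hs
      rw [← intervalIntegral.integral_sub
        ((by fun_prop : Continuous fun σ => Real.sin (F (t * s * σ))).intervalIntegrable _ _)
        ((by fun_prop : Continuous fun σ => Real.sin (G (t * s * σ))).intervalIntegrable _ _)]
      have h := intervalIntegral.norm_integral_le_of_norm_le_const (a := 0) (b := 1)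
        (C := B * w (t * s))
        (f := fun σ => Real.sin (F (t * s * σ)) - Real.sin (G (t * s * σ))) ?_
      · simpa using h
      · intro σ hσ
        rw [uIoc_of_le zero_le_one] at hσ
        have h1 : |Real.sin (F (t * s * σ)) - Real.sin (G (t * s * σ))| ≤
            |F (t * s * σ) - G (t * s * σ)| := by
          simpa [Real.dist_eq] using Real.lipschitzWith_sin.dist_le_mul _ _
        refine h1.trans ((hFG _).trans ?_)
        gcongr
        refine Real.exp_le_exp.2 ?_
        rw [abs_mul (t * s)]
        have : |σ| ≤ 1 := abs_le.2 ⟨by linarith [hσ.1], hσ.2⟩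
        nlinarith [abs_nonneg (t * s)]
    have e3 : |I F t - I G t| ≤ ∫ s in (0 : ℝ)..1, B * w (t * s) := by
      rw [e1]
      refine intervalIntegral.norm_integral_le_of_norm_le zero_le_one
        (.of_forall fun s hs => (Real.norm_eq_abs _).trans_le (e2 s ⟨hs.1.le, hs.2⟩)) ?_
      exact (by fun_prop : Continuous fun s => B * w (t * s)).intervalIntegrable _ _
    rw [← mul_sub, abs_mul]
    rw [intervalIntegral.integral_const_mul] at e3
    calc |t| * |I F t - I G t| ≤ |t| * (B * ∫ s in (0 : ℝ)..1, w (t * s)) := by gcongr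
      _ = B * (|t| * ∫ s in (0 : ℝ)..1, w (t * s)) := by ring
      _ ≤ B * (w t / 2) := by gcongr; exact hwi t
      _ = B / 2 * w t := by ring
  have hI0 : ∀ t, I 0 t = 0 := fun t => by simp [I]
  have bnd : ∀ g : BoundedContinuousFunction ℝ ℝ, ∀ t,
      |c + t * I (fun t => w t * g t) t| ≤ (c + ‖g‖ / 2) * w t := by
    intro g t
    have h := key (fun t => w t * g t) 0 (by fun_prop) continuous_const ‖g‖ (norm_nonneg _)
      (fun t => by
        simp only [Pi.zero_apply, sub_zero, abs_mul, abs_of_pos (hw0 t)]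
        rw [mul_comm]
        gcongr
        exact g.norm_coe_le_norm t) t
    rw [hI0, mul_zero, sub_zero] at h
    calc _ ≤ |c| + _ := abs_add_le _ _
      _ ≤ c * w t + ‖g‖ / 2 * w t := by
        rw [abs_of_nonneg hc]; gcongr; exact le_mul_of_one_le_right hc (hw1 t)
      _ = _ := by ring
  let Φ : BoundedContinuousFunction ℝ ℝ → BoundedContinuousFunction ℝ ℝ := fun g =>
    BoundedContinuousFunction.ofNormedAddCommGroup
      (fun t => (w t)⁻¹ * (c + t * I (fun t => w t * g t) t))
      (by
        have := hIc' (fun t => w t * g t) (by fun_prop)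
        exact (hwc.inv₀ fun t => (hw0 t).ne').mul
          (continuous_const.add (continuous_id.mul this))) (c + ‖g‖ / 2)
      (fun t => by
        rw [norm_mul, norm_inv, Real.norm_of_nonneg (hw0 t).le, inv_mul_le_iff₀ (hw0 t),
          mul_comm (w t)]
        exact bnd g t)
  have hΦ : ContractingWith (1 / 2) Φ := by
    refine ⟨by norm_num, LipschitzWith.of_dist_le_mul fun g₁ g₂ => ?_⟩
    refine (BoundedContinuousFunction.dist_le (by positivity)).2 fun t => ?_
    have h := key (fun t => w t * g₁ t) (fun t => w t * g₂ t) (by fun_prop) (by fun_prop)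
      (dist g₁ g₂) dist_nonneg (fun t => by
        rw [← mul_sub, abs_mul, abs_of_pos (hw0 t), mul_comm]
        gcongr
        exact BoundedContinuousFunction.dist_coe_le_dist (f := g₁) (g := g₂) t) t
    change |(w t)⁻¹ * _ - (w t)⁻¹ * _| ≤ _
    rw [← mul_sub, abs_mul, abs_inv, abs_of_pos (hw0 t), inv_mul_le_iff₀ (hw0 t),
      add_sub_add_left_eq_sub]
    refine h.trans (le_of_eq ?_)
    simp
    ring
  set g := ContractingWith.fixedPoint Φ hΦ with hg
  have hfix : Φ g = g := hΦ.fixedPoint_isFixedPt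
  have hval : ∀ t, w t * g t = c + t * I (fun t => w t * g t) t := by
    intro t
    have : g t = (w t)⁻¹ * (c + t * I (fun t => w t * g t) t) :=
      (congrArg (fun h : BoundedContinuousFunction ℝ ℝ => h t) hfix).symm
    conv_lhs => rw [this]
    rw [mul_inv_cancel_left₀ (hw0 t).ne']
  have hgn : ‖g‖ ≤ 2 * c := by
    have h : ‖g‖ ≤ c + ‖g‖ / 2 := by
      conv_lhs => rw [← hfix]
      exact BoundedContinuousFunction.norm_ofNormedAddCommGroup_le _
        (add_nonneg hc (div_nonneg (norm_nonneg _) two_pos.le)) _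
    linarith
  refine ⟨fun t => w t * g t, by fun_prop, fun t => ?_, hval⟩
  have h := bnd g t
  rw [← hval] at h
  refine h.trans ?_
  have : c + ‖g‖ / 2 ≤ 2 * c := by linarith
  exact mul_le_mul_of_nonneg_right this (hw0 t).le

/-- The profile `f` of the generating angle `φ(u, v) = f(u v)`: the smooth solution of
`(t f')' = sin f`, `f(0) = c`, on the whole line. -/
structure IsAmslerProfile (c : ℝ) (f : ℝ → ℝ) : Prop where
  smooth : ContDiff ℝ ∞ f
  init : f 0 = c
  ode : ∀ t, deriv f t + t * deriv (deriv f) t = Real.sin (f t)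

/-- The Volterra equation gives `f'(t) = ∫₀¹ sin f(t σ) dσ`, which is as smooth as `f`. -/
theorem exists_isAmslerProfile (c : ℝ) (hc : 0 ≤ c) :
    ∃ f : ℝ → ℝ, IsAmslerProfile c f ∧ ∀ t, |f t| ≤ 2 * c * Real.exp (2 * |t|) := by
  obtain ⟨f, hf, hb, he⟩ := exists_painleve_volterra c hc
  set h : ℝ → ℝ := fun t => ∫ σ in (0 : ℝ)..1, Real.sin (f (t * σ)) with hh
  have hhc : Continuous h :=
    intervalIntegral.continuous_parametric_intervalIntegral_of_continuous' (by fun_prop) _ _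
  have hf1 : ∀ t, f t = c + ∫ s in (0 : ℝ)..t, h s := by
    intro t
    have := intervalIntegral.smul_integral_comp_mul_left (a := 0) (b := 1) h t
    rw [he t]
    simp only [smul_eq_mul, mul_zero, mul_one] at this
    rw [← this]
  have hd : ∀ t, HasDerivAt f (h t) t := by
    intro t
    have := (hhc.integral_hasStrictDerivAt 0 t).hasDerivAt.const_add c
    exact this.congr_of_eventuallyEq (.of_forall hf1)
  have hderiv : deriv f = h := funext fun t => (hd t).deriv
  have hsm : ∀ n : ℕ, ContDiff ℝ n f := by
    intro n
    induction n with
    | zero => exact contDiff_zero.2 hf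
    | succ n ih =>
      push_cast
      rw [contDiff_succ_iff_deriv]
      refine ⟨fun t => (hd t).differentiableAt, by simp, ?_⟩
      rw [hderiv]
      simpa using contDiff_weighted_average n (Real.contDiff_sin.comp ih) 0
  refine ⟨f, ⟨contDiff_infty.2 hsm, by simpa using he 0, fun t => ?_⟩, hb⟩
  have hdh : Differentiable ℝ h := by
    have h2 := hsm 2
    rw [show ((2 : ℕ) : WithTop ℕ∞) = 1 + 1 by norm_num, contDiff_succ_iff_deriv, hderiv] at h2
    exact h2.2.2.differentiable one_ne_zero
  have hth : ∀ t, t * h t = ∫ s in (0 : ℝ)..t, Real.sin (f s) := by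
    intro t
    have := intervalIntegral.smul_integral_comp_mul_left (a := 0) (b := 1)
      (fun s => Real.sin (f s)) t
    simpa using this
  have h1 : HasDerivAt (fun t => t * h t) (1 * h t + t * deriv h t) t :=
    (hasDerivAt_id t).mul (hdh t).hasDerivAt
  have h2 : HasDerivAt (fun t => t * h t) (Real.sin (f t)) t := by
    have hs : Continuous fun s => Real.sin (f s) := by fun_prop
    exact (hs.integral_hasStrictDerivAt 0 t).hasDerivAt.congr_of_eventuallyEq (.of_forall hth)
  rw [hderiv, ← h1.unique h2, one_mul]

/-! ### Linear differential equations depending on a parameter -/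

section LinearODE

variable {E : Type*} [NormedAddCommGroup E] [NormedSpace ℝ E]

/-- The terms of the Picard series of the linear equation `∂z/∂v = B(u, v) z`, `z(u, 0) = b(u)`,
with parameter `u`. -/
noncomputable def picardTerm (B : ℝ × ℝ → E →L[ℝ] E) (b : ℝ → E) : ℕ → ℝ × ℝ → E
  | 0 => fun p => b p.1
  | k + 1 => fun p =>
      p.2 • ∫ σ in (0 : ℝ)..1, B (p.1, p.2 * σ) (picardTerm B b k (p.1, p.2 * σ))

theorem continuous_picardTerm {B : ℝ × ℝ → E →L[ℝ] E} {b : ℝ → E} (hB : Continuous B)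
    (hb : Continuous b) (k : ℕ) : Continuous (picardTerm B b k) := by
  induction k with
  | zero => exact hb.comp continuous_fst
  | succ k ih =>
    refine continuous_snd.smul ?_
    refine intervalIntegral.continuous_parametric_intervalIntegral_of_continuous' ?_ _ _
    have h : Continuous fun x : (ℝ × ℝ) × ℝ => (x.1.1, x.1.2 * x.2) := by fun_prop
    exact (hB.comp h).clm_apply (ih.comp h)

theorem picardTerm_succ_eq_integral {B : ℝ × ℝ → E →L[ℝ] E} {b : ℝ → E} (k : ℕ) (u v : ℝ) :
    picardTerm B b (k + 1) (u, v) = ∫ s in (0 : ℝ)..v, B (u, s) (picardTerm B b k (u, s)) := by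
  have := intervalIntegral.smul_integral_comp_mul_left (a := 0) (b := 1)
    (fun s => B (u, s) (picardTerm B b k (u, s))) v
  simpa [picardTerm] using this

theorem hasDerivAt_picardTerm_succ [CompleteSpace E] {B : ℝ × ℝ → E →L[ℝ] E} {b : ℝ → E}
    (hB : Continuous B) (hb : Continuous b) (k : ℕ) (u v : ℝ) :
    HasDerivAt (fun v => picardTerm B b (k + 1) (u, v)) (B (u, v) (picardTerm B b k (u, v))) v := by
  have hc : Continuous fun s => B (u, s) (picardTerm B b k (u, s)) := by
    have h : Continuous fun s : ℝ => (u, s) := by fun_prop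
    exact (hB.comp h).clm_apply ((continuous_picardTerm hB hb k).comp h)
  exact (hc.integral_hasStrictDerivAt 0 v).hasDerivAt.congr_of_eventuallyEq
    (.of_forall fun v => picardTerm_succ_eq_integral k u v)

theorem norm_picardTerm_le {B : ℝ × ℝ → E →L[ℝ] E} {b : ℝ → E} {U V M D : ℝ} (hM : 0 ≤ M)
    (hBM : ∀ u v, |u| ≤ U → |v| ≤ V → ‖B (u, v)‖ ≤ M) (hD : ∀ u, |u| ≤ U → ‖b u‖ ≤ D)
    (k : ℕ) {u v : ℝ} (hu : |u| ≤ U) (hv : |v| ≤ V) :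
    ‖picardTerm B b k (u, v)‖ ≤ D * ((M * |v|) ^ k / k.factorial) := by
  induction k generalizing v with
  | zero => simpa [picardTerm] using hD u hu
  | succ k ih =>
    have hD0 : 0 ≤ D := (norm_nonneg _).trans (hD u hu)
    have h : ‖∫ σ in (0 : ℝ)..1, B (u, v * σ) (picardTerm B b k (u, v * σ))‖ ≤
        ∫ σ in (0 : ℝ)..1, (M * (D * ((M * |v|) ^ k / k.factorial))) * σ ^ k := by
      refine intervalIntegral.norm_integral_le_of_norm_le zero_le_one (.of_forall fun σ hσ => ?_)
        ((by fun_prop : Continuous fun σ : ℝ =>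
          (M * (D * ((M * |v|) ^ k / k.factorial))) * σ ^ k).intervalIntegrable _ _)
      have hs : |v * σ| = |v| * σ := by rw [abs_mul, abs_of_pos hσ.1]
      have hs' : |v * σ| ≤ V := by
        rw [hs]; exact (mul_le_of_le_one_right (abs_nonneg _) hσ.2).trans hv
      calc _ ≤ ‖B (u, v * σ)‖ * ‖picardTerm B b k (u, v * σ)‖ := (B _).le_opNorm _
        _ ≤ M * (D * ((M * |v * σ|) ^ k / k.factorial)) := by
          gcongr
          · exact hBM _ _ hu hs'
          · exact ih hs'
        _ = _ := by rw [hs]; ring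
    rw [intervalIntegral.integral_const_mul, integral_pow] at h
    simp only [picardTerm, norm_smul, Real.norm_eq_abs]
    calc _ ≤ |v| * ((M * (D * ((M * |v|) ^ k / k.factorial))) *
          ((1 ^ (k + 1) - 0 ^ (k + 1)) / (k + 1))) := by gcongr
      _ = _ := by
        rw [Nat.factorial_succ]; push_cast
        field_simp
        simp
        ring

/-- The global solution of a linear equation with parameter. -/
noncomputable def picardSum (B : ℝ × ℝ → E →L[ℝ] E) (b : ℝ → E) (p : ℝ × ℝ) : E :=
  ∑' k, picardTerm B b k p

theorem exists_picardTerm_bound {B : ℝ × ℝ → E →L[ℝ] E} {b : ℝ → E} (hB : Continuous B)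
    (hb : Continuous b) (U V : ℝ) : ∃ M : ℝ, ∃ a : ℕ → ℝ, 0 ≤ M ∧ Summable a ∧ ∀ u v, |u| ≤ U →
      |v| ≤ V → ‖B (u, v)‖ ≤ M ∧ ∀ k, ‖picardTerm B b k (u, v)‖ ≤ a k := by
  obtain ⟨M, hM⟩ := ((isCompact_Icc (a := -U) (b := U)).prod
    (isCompact_Icc (a := -V) (b := V))).exists_bound_of_continuousOn hB.continuousOn
  obtain ⟨D, hD⟩ := (isCompact_Icc (a := -U) (b := U)).exists_bound_of_continuousOn
    hb.continuousOn
  have hM' : ∀ u v, |u| ≤ U → |v| ≤ V → ‖B (u, v)‖ ≤ |M| := fun u v hu hv =>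
    (hM (u, v) ⟨abs_le.1 hu, abs_le.1 hv⟩).trans (le_abs_self _)
  refine ⟨|M|, fun k => D * ((|M| * V) ^ k / k.factorial), abs_nonneg _,
    (Real.summable_pow_div_factorial _).mul_left _, fun u v hu hv => ⟨hM' u v hu hv, fun k => ?_⟩⟩
  have hD0 : 0 ≤ D := (norm_nonneg _).trans (hD u (abs_le.1 hu))
  refine (norm_picardTerm_le (abs_nonneg _) hM' (fun u hu => hD u (abs_le.1 hu)) k hu hv).trans ?_
  dsimp only
  gcongr

theorem summable_picardTerm [CompleteSpace E] {B : ℝ × ℝ → E →L[ℝ] E} {b : ℝ → E}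
    (hB : Continuous B) (hb : Continuous b) (p : ℝ × ℝ) : Summable fun k => picardTerm B b k p := by
  obtain ⟨M, a, -, ha, h⟩ := exists_picardTerm_bound hB hb |p.1| |p.2|
  exact .of_norm_bounded ha fun k => (h p.1 p.2 le_rfl le_rfl).2 k

theorem continuous_picardSum [CompleteSpace E] {B : ℝ × ℝ → E →L[ℝ] E} {b : ℝ → E}
    (hB : Continuous B) (hb : Continuous b) : Continuous (picardSum B b) := by
  refine continuous_iff_continuousAt.2 fun p => ?_
  obtain ⟨M, a, -, ha, h⟩ := exists_picardTerm_bound hB hb (|p.1| + 1) (|p.2| + 1)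
  have hs : IsOpen {q : ℝ × ℝ | |q.1| < |p.1| + 1 ∧ |q.2| < |p.2| + 1} :=
    (isOpen_lt (f := fun q : ℝ × ℝ => |q.1|) (by fun_prop) continuous_const).inter
      (isOpen_lt (f := fun q : ℝ × ℝ => |q.2|) (by fun_prop) continuous_const)
  refine ContinuousOn.continuousAt (s := {q : ℝ × ℝ | |q.1| < |p.1| + 1 ∧ |q.2| < |p.2| + 1})
    (continuousOn_tsum (fun k => (continuous_picardTerm hB hb k).continuousOn) ha
      fun k q hq => (h q.1 q.2 hq.1.le hq.2.le).2 k) (hs.mem_nhds ?_)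
  simp

theorem picardSum_zero {B : ℝ × ℝ → E →L[ℝ] E} {b : ℝ → E} (u : ℝ) :
    picardSum B b (u, 0) = b u := by
  rw [picardSum, tsum_eq_single 0]
  · rfl
  · intro k hk
    obtain ⟨k, rfl⟩ := Nat.exists_eq_succ_of_ne_zero hk
    simp [picardTerm]

theorem hasDerivAt_picardSum [CompleteSpace E] {B : ℝ × ℝ → E →L[ℝ] E} {b : ℝ → E}
    (hB : Continuous B) (hb : Continuous b) (u v : ℝ) :
    HasDerivAt (fun v => picardSum B b (u, v)) (B (u, v) (picardSum B b (u, v))) v := by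
  obtain ⟨M, a, hM, ha, h⟩ := exists_picardTerm_bound hB hb |u| (|v| + 1)
  have e : ∀ v, picardSum B b (u, v) = b u + ∑' k, picardTerm B b (k + 1) (u, v) := fun v =>
    (summable_picardTerm hB hb (u, v)).tsum_eq_zero_add
  have hd := hasDerivAt_tsum_of_isPreconnected (t := Ioo (-(|v| + 1)) (|v| + 1))
    (g := fun k v => picardTerm B b (k + 1) (u, v))
    (g' := fun k v => B (u, v) (picardTerm B b k (u, v))) (u := fun k => M * a k) (y₀ := v) (y := v)
    (ha.mul_left M) isOpen_Ioo isPreconnected_Ioo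
    (fun k v _ => hasDerivAt_picardTerm_succ hB hb k u v)
    (fun k w hw => by
      obtain ⟨h1, h2⟩ := h u w le_rfl (abs_le.2 ⟨hw.1.le, hw.2.le⟩)
      refine ((B _).le_opNorm _).trans ?_
      gcongr
      exact h2 k)
    (abs_lt.1 (by simp)) ((summable_nat_add_iff 1).2 (summable_picardTerm hB hb (u, v)))
    (abs_lt.1 (by simp))
  rw [picardSum, (B (u, v)).map_tsum (summable_picardTerm hB hb _)]
  exact (hd.const_add (b u)).congr_of_eventuallyEq (.of_forall e)

/-- Solutions of a linear equation depend continuously differentiably on the parameter, and the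
derivative `g` solves the equation of variations. The Picard terms of `(y, g)` for the joint
system satisfy `∂y/∂u = g` exactly, and the series converge locally uniformly. -/
theorem exists_linear_ode_parametric [CompleteSpace E] {B Bu : ℝ × ℝ → E →L[ℝ] E} {b b' : ℝ → E}
    (hB : Continuous B) (hBu : Continuous Bu) (hb : Continuous b) (hb' : Continuous b')
    (hBd : ∀ u v, HasDerivAt (fun u => B (u, v)) (Bu (u, v)) u)
    (hbd : ∀ u, HasDerivAt b (b' u) u) :
    ∃ y g : ℝ × ℝ → E, Continuous y ∧ Continuous g ∧ (∀ u, y (u, 0) = b u) ∧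
      (∀ u, g (u, 0) = b' u) ∧
      (∀ u v, HasDerivAt (fun v => y (u, v)) (B (u, v) (y (u, v))) v) ∧
      (∀ u v, HasDerivAt (fun v => g (u, v)) (Bu (u, v) (y (u, v)) + B (u, v) (g (u, v))) v) ∧
      (∀ u v, HasDerivAt (fun u => y (u, v)) (g (u, v)) u) := by
  let pr₁ := ContinuousLinearMap.fst ℝ E E
  let pr₂ := ContinuousLinearMap.snd ℝ E E
  let 𝔅 : ℝ × ℝ → (E × E) →L[ℝ] (E × E) := fun p =>
    ((B p).comp pr₁).prod ((Bu p).comp pr₁ + (B p).comp pr₂)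
  let 𝔟 : ℝ → E × E := fun u => (b u, b' u)
  have h𝔅 : Continuous 𝔅 := by
    have h1 : Continuous fun p => (B p).comp pr₁ := hB.clm_comp continuous_const
    have h2 : Continuous fun p => (Bu p).comp pr₁ + (B p).comp pr₂ :=
      (hBu.clm_comp continuous_const).add (hB.clm_comp continuous_const)
    have h3 : 𝔅 = fun p => (ContinuousLinearMap.inl ℝ E E).comp ((B p).comp pr₁) +
        (ContinuousLinearMap.inr ℝ E E).comp ((Bu p).comp pr₁ + (B p).comp pr₂) := by
      funext p
      ext x <;> simp [𝔅]
    rw [h3]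
    exact (continuous_const.clm_comp h1).add (continuous_const.clm_comp h2)
  have h𝔟 : Continuous 𝔟 := hb.prodMk hb'
  have hcZ := continuous_picardTerm h𝔅 h𝔟
  have hterm : ∀ k u v, HasDerivAt (fun u => (picardTerm 𝔅 𝔟 k (u, v)).1)
      (picardTerm 𝔅 𝔟 k (u, v)).2 u := by
    intro k
    induction k with
    | zero => exact fun u v => hbd u
    | succ k ih =>
      intro u v
      have hc : ∀ u, Continuous fun s => 𝔅 (u, v * s) (picardTerm 𝔅 𝔟 k (u, v * s)) := by
        intro u
        have h : Continuous fun s : ℝ => (u, v * s) := by fun_prop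
        exact (h𝔅.comp h).clm_apply ((hcZ k).comp h)
      have e1 : ∀ u, (picardTerm 𝔅 𝔟 (k + 1) (u, v)).1 =
          v • ∫ s in (0 : ℝ)..1, B (u, v * s) (picardTerm 𝔅 𝔟 k (u, v * s)).1 := by
        intro u
        have := pr₁.intervalIntegral_comp_comm ((hc u).intervalIntegrable (μ := volume) 0 1)
        exact (congrArg (v • ·) this).symm
      have e2 : (picardTerm 𝔅 𝔟 (k + 1) (u, v)).2 =
          v • ∫ s in (0 : ℝ)..1, (Bu (u, v * s) (picardTerm 𝔅 𝔟 k (u, v * s)).1 +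
            B (u, v * s) (picardTerm 𝔅 𝔟 k (u, v * s)).2) := by
        have := pr₂.intervalIntegral_comp_comm ((hc u).intervalIntegrable (μ := volume) 0 1)
        exact (congrArg (v • ·) this).symm
      rw [e2]
      refine HasDerivAt.congr_of_eventuallyEq ?_ (.of_forall e1)
      refine HasDerivAt.const_smul v ?_
      have hq : Continuous fun x : ℝ × ℝ => (x.1, v * x.2) := by fun_prop
      refine hasDerivAt_intervalIntegral_of_continuous
        (F := fun u s => B (u, v * s) (picardTerm 𝔅 𝔟 k (u, v * s)).1)
        (F' := fun u s => Bu (u, v * s) (picardTerm 𝔅 𝔟 k (u, v * s)).1 +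
            B (u, v * s) (picardTerm 𝔅 𝔟 k (u, v * s)).2) ?_ ?_ (fun u s => ?_) 0 1 u
      · exact (hB.comp hq).clm_apply ((hcZ k).fst.comp hq)
      · exact ((hBu.comp hq).clm_apply ((hcZ k).fst.comp hq)).add
          ((hB.comp hq).clm_apply ((hcZ k).snd.comp hq))
      · exact (hBd u (v * s)).clm_apply (ih u (v * s))
  have hz := continuous_picardSum h𝔅 h𝔟
  refine ⟨fun p => (picardSum 𝔅 𝔟 p).1, fun p => (picardSum 𝔅 𝔟 p).2, hz.fst, hz.snd,
    fun u => congrArg Prod.fst (picardSum_zero u),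
    fun u => congrArg Prod.snd (picardSum_zero u), fun u v => ?_, fun u v => ?_,
    fun u v => ?_⟩
  · exact (pr₁.hasFDerivAt.comp_hasDerivAt v (hasDerivAt_picardSum h𝔅 h𝔟 u v))
  · exact (pr₂.hasFDerivAt.comp_hasDerivAt v (hasDerivAt_picardSum h𝔅 h𝔟 u v))
  · obtain ⟨M, a, hM, ha, h⟩ := exists_picardTerm_bound h𝔅 h𝔟 (|u| + 1) |v|
    have hsum := fun p => summable_picardTerm h𝔅 h𝔟 p
    have hd := hasDerivAt_tsum_of_isPreconnected (t := Ioo (-(|u| + 1)) (|u| + 1))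
      (g := fun k u => (picardTerm 𝔅 𝔟 k (u, v)).1)
      (g' := fun k u => (picardTerm 𝔅 𝔟 k (u, v)).2) (u := a) (y₀ := u) (y := u)
      ha isOpen_Ioo isPreconnected_Ioo (fun k u _ => hterm k u v)
      (fun k w hw => (norm_snd_le _).trans ((h w v (abs_le.2 ⟨hw.1.le, hw.2.le⟩) le_rfl).2 k))
      (abs_lt.1 (by simp)) (pr₁.summable (hsum (u, v))) (abs_lt.1 (by simp))
    have e1 : ∀ u, (picardSum 𝔅 𝔟 (u, v)).1 = ∑' k, (picardTerm 𝔅 𝔟 k (u, v)).1 := fun u =>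
      pr₁.map_tsum (hsum (u, v))
    have e2 : (picardSum 𝔅 𝔟 (u, v)).2 = ∑' k, (picardTerm 𝔅 𝔟 k (u, v)).2 :=
      pr₂.map_tsum (hsum (u, v))
    exact (hd.congr_of_eventuallyEq (.of_forall e1)).congr_deriv e2.symm

/-- The Gauss-Weingarten equations of a Chebyshev net with generating angle `f(u v)`, in an
orthonormal frame, are a linear system with coefficient matrices `P + v f' Q` and
`cos f · C + sin f · S`. The four commutator identities reduce its integrability condition to the
sine-Gordon equation for `f(u v)`, that is to `(t f')' = sin f`. -/
theorem exists_solution_gaussWeingarten [CompleteSpace E] {P Q C S : E →L[ℝ] E}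
    (hPC : ∀ y, P (C y) = C (P y)) (hPS : ∀ y, P (S y) - S (P y) = -Q y)
    (hQC : ∀ y, Q (C y) - C (Q y) = S y) (hQS : ∀ y, Q (S y) - S (Q y) = -C y)
    {c : ℝ} {f : ℝ → ℝ} (hf : IsAmslerProfile c f) (y₀ : E) :
    ∃ y : ℝ × ℝ → E, ContDiff ℝ ∞ y ∧ y (0, 0) = y₀ ∧
      (∀ u v, HasDerivAt (fun u => y (u, v))
        (P (y (u, v)) + (v * deriv f (u * v)) • Q (y (u, v))) u) ∧
      (∀ u v, HasDerivAt (fun v => y (u, v))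
        (Real.cos (f (u * v)) • C (y (u, v)) + Real.sin (f (u * v)) • S (y (u, v))) v) := by
  have hfc : Continuous f := hf.smooth.continuous
  have hfd : ∀ t, HasDerivAt f (deriv f t) t := fun t =>
    (hf.smooth.differentiable (by simp) t).hasDerivAt
  have hf1 : ContDiff ℝ ∞ (deriv f) := (contDiff_infty_iff_deriv.1 hf.smooth).2
  have hf1c : Continuous (deriv f) := hf1.continuous
  have hf2d : ∀ t, HasDerivAt (deriv f) (deriv (deriv f) t) t := fun t =>
    (hf1.differentiable (by simp) t).hasDerivAt
  have hfu : ∀ u v : ℝ, HasDerivAt (fun u => f (u * v)) (v * deriv f (u * v)) u := fun u v => by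
    have := (hfd (u * v)).comp u ((hasDerivAt_id u).mul_const v)
    exact this.congr_deriv (by ring)
  let B : ℝ × ℝ → E →L[ℝ] E := fun p => Real.cos (f (p.1 * p.2)) • C + Real.sin (f (p.1 * p.2)) • S
  let Bu : ℝ × ℝ → E →L[ℝ] E := fun p =>
    (-Real.sin (f (p.1 * p.2)) * (p.2 * deriv f (p.1 * p.2))) • C +
      (Real.cos (f (p.1 * p.2)) * (p.2 * deriv f (p.1 * p.2))) • S
  let A : ℝ × ℝ → E →L[ℝ] E := fun p => P + (p.2 * deriv f (p.1 * p.2)) • Q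
  have hB : Continuous B := by fun_prop
  have hBu : Continuous Bu := by fun_prop
  have hBd : ∀ u v, HasDerivAt (fun u => B (u, v)) (Bu (u, v)) u := fun u v =>
    ((hfu u v).cos.smul_const C).add ((hfu u v).sin.smul_const S)
  set b : ℝ → E := fun u => NormedSpace.exp (u • P) y₀ with hbdef
  have hbd : ∀ u, HasDerivAt b (P (b u)) u := fun u => by
    have := (hasDerivAt_exp_smul_const' P u (𝕂 := ℝ)).clm_apply (hasDerivAt_const u y₀)
    simpa using this
  have hbc : Continuous b := continuous_iff_continuousAt.2 fun u => (hbd u).continuousAt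
  obtain ⟨y, g, hy, hg, hy0, hg0, hyv, hgv, hyu⟩ := exists_linear_ode_parametric hB hBu hbc
    (P.continuous.comp hbc) hBd hbd
  -- the defect `g - A y` solves the linear equation with zero initial value
  have hgA : ∀ u v, g (u, v) = A (u, v) (y (u, v)) := by
    intro u
    have hAv : ∀ v, HasDerivAt (fun v => A (u, v))
        ((deriv f (u * v) + (u * v) * deriv (deriv f) (u * v)) • Q) v := by
      intro v
      have h1 := (hf2d (u * v)).comp v ((hasDerivAt_id v).const_mul u)
      have h2 := ((hasDerivAt_id v).mul h1).smul_const Q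
      refine (h2.const_add P).congr_deriv ?_
      simp only [id_eq, Function.comp_apply]
      congr 1
      ring
    have hw : ∀ v, HasDerivAt (fun v => g (u, v) - A (u, v) (y (u, v)))
        (B (u, v) (g (u, v) - A (u, v) (y (u, v)))) v := by
      intro v
      refine ((hgv u v).sub ((hAv v).clm_apply (hyv u v))).congr_deriv ?_
      rw [hf.ode]
      have e1 := hPC (y (u, v))
      have e2 : P (S (y (u, v))) = S (P (y (u, v))) - Q (y (u, v)) := by
        rw [sub_eq_add_neg, ← hPS]; abel
      have e3 : Q (C (y (u, v))) = C (Q (y (u, v))) + S (y (u, v)) := by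
        rw [← hQC]; abel
      have e4 : Q (S (y (u, v))) = S (Q (y (u, v))) - C (y (u, v)) := by
        rw [sub_eq_add_neg, ← hQS]; abel
      simp only [A, B, Bu, add_apply, smul_apply, map_add,
        map_smul, map_sub, e1, e2, e3, e4]
      module
    have hK : ∀ v, LipschitzOnWith (‖C‖₊ + ‖S‖₊) (fun x => B (u, v) x) univ := by
      intro v
      refine ((B (u, v)).lipschitz.weaken ?_).lipschitzOnWith
      refine (nnnorm_add_le _ _).trans (add_le_add ?_ ?_)
      · rw [← NNReal.coe_le_coe, coe_nnnorm, coe_nnnorm, norm_smul]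
        exact mul_le_of_le_one_left (norm_nonneg _) (Real.abs_cos_le_one _)
      · rw [← NNReal.coe_le_coe, coe_nnnorm, coe_nnnorm, norm_smul]
        exact mul_le_of_le_one_left (norm_nonneg _) (Real.abs_sin_le_one _)
    have := ODE_solution_unique_univ (v := fun v x => B (u, v) x) (s := fun _ => univ) (t₀ := 0)
      (f := fun v => g (u, v) - A (u, v) (y (u, v))) (g := fun _ => 0) hK
      (fun v => ⟨hw v, trivial⟩) (fun v => ⟨by simpa using hasDerivAt_const v (0 : E), trivial⟩)
      (by simp [A, hy0, hg0])
    exact fun v => sub_eq_zero.1 (congrFun this v)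
  have hyu' : ∀ u v, HasDerivAt (fun u => y (u, v)) (A (u, v) (y (u, v))) u := fun u v =>
    hgA u v ▸ hyu u v
  -- the equation expresses the derivative of `y` smoothly in terms of `y`
  have hA : ContDiff ℝ ∞ A := by fun_prop
  have hB' : ContDiff ℝ ∞ B := by
    have := hf.smooth
    fun_prop
  have hfd := hasFDerivAt_of_partial (hA.continuous.clm_apply hy) (hB.clm_apply hy) hyu' hyv
  have hsm : ∀ n : ℕ, ContDiff ℝ n y := by
    intro n
    induction n with
    | zero => exact contDiff_zero.2 hy
    | succ n ih =>
      push_cast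
      refine (contDiff_succ_iff_hasFDerivAt).2 ⟨_, ?_, hfd⟩
      exact (contDiff_const.smulRight ((hA.of_le (by exact_mod_cast le_top)).clm_apply ih)).add
        (contDiff_const.smulRight ((hB'.of_le (by exact_mod_cast le_top)).clm_apply ih))
  exact ⟨y, contDiff_infty.2 hsm, by simp [hy0, hbdef], hyu', hyv⟩

end LinearODE

/-! ### Moving frames of the Amsler surface and of its developing map -/

theorem eq_zero_zero_of_hasDerivAt_zero {g : ℝ × ℝ → ℝ}
    (hu : ∀ u v, HasDerivAt (fun u => g (u, v)) 0 u)
    (hv : ∀ u v, HasDerivAt (fun v => g (u, v)) 0 v) (p : ℝ × ℝ) : g p = g (0, 0) := by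
  have h1 := is_const_of_deriv_eq_zero (fun v => (hv p.1 v).differentiableAt)
    (fun v => (hv p.1 v).deriv) p.2 0
  have h2 := is_const_of_deriv_eq_zero (fun u => (hu u 0).differentiableAt)
    (fun u => (hu u 0).deriv) p.1 0
  exact h1.trans h2

/-- The determinant of three vectors of `ℝ³`. -/
def tripleProduct (x y z : E3) : ℝ :=
  x 0 * (y 1 * z 2 - y 2 * z 1) - x 1 * (y 0 * z 2 - y 2 * z 0) + x 2 * (y 0 * z 1 - y 1 * z 0)

theorem HasDerivAt.euclidean_apply {n : ℕ} {x : ℝ → EuclideanSpace ℝ (Fin n)}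
    {x' : EuclideanSpace ℝ (Fin n)} {t : ℝ} (h : HasDerivAt x x' t) (j : Fin n) :
    HasDerivAt (fun t => x t j) (x' j) t :=
  (EuclideanSpace.proj (𝕜 := ℝ) j).hasFDerivAt.comp_hasDerivAt t h

theorem hasDerivAt_tripleProduct {x y z : ℝ → E3} {x' y' z' : E3} {t : ℝ}
    (hx : HasDerivAt x x' t) (hy : HasDerivAt y y' t) (hz : HasDerivAt z z' t) :
    HasDerivAt (fun t => tripleProduct (x t) (y t) (z t))
      (tripleProduct x' (y t) (z t) + tripleProduct (x t) y' (z t) +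
        tripleProduct (x t) (y t) z') t := by
  have a := hx.euclidean_apply
  have b := hy.euclidean_apply
  have c := hz.euclidean_apply
  refine (((a 0).mul (((b 1).mul (c 2)).sub ((b 2).mul (c 1)))).sub
    ((a 1).mul (((b 0).mul (c 2)).sub ((b 2).mul (c 0))))).add
    ((a 2).mul (((b 0).mul (c 1)).sub ((b 1).mul (c 0)))) |>.congr_deriv ?_
  simp only [tripleProduct, Pi.mul_apply, Pi.sub_apply]
  ring

/-- The entry `(j, k)` of `G diag(ε, 1, 1) Gᵀ`, where `G` has the columns `x`, `y`, `z`. -/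
def rowProduct (ε : ℝ) (j k : Fin 3) (x y z : E3) : ℝ := ε * (x j * x k) + y j * y k + z j * z k

theorem hasDerivAt_rowProduct (ε : ℝ) (j k : Fin 3) {x y z : ℝ → E3} {x' y' z' : E3} {t : ℝ}
    (hx : HasDerivAt x x' t) (hy : HasDerivAt y y' t) (hz : HasDerivAt z z' t) :
    HasDerivAt (fun t => rowProduct ε j k (x t) (y t) (z t))
      (ε * (x' j * x t k + x t j * x' k) + (y' j * y t k + y t j * y' k) +
        (z' j * z t k + z t j * z' k)) t := by
  have a := hx.euclidean_apply
  have b := hy.euclidean_apply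
  have c := hz.euclidean_apply
  exact ((((a j).mul (a k)).const_mul ε).add ((b j).mul (b k))).add ((c j).mul (c k))

/-- The matrix with columns `x`, `y`, `z`. -/
def columnMatrix (x y z : E3) : Matrix (Fin 3) (Fin 3) ℝ :=
  !![x 0, y 0, z 0; x 1, y 1, z 1; x 2, y 2, z 2]

theorem det_columnMatrix (x y z : E3) : (columnMatrix x y z).det = tripleProduct x y z := by
  simp [columnMatrix, Matrix.det_fin_three, tripleProduct]
  ring

open Matrix in
/-- A matrix `G` of determinant one with `G J Gᵀ = J`, `J = diag(ε, 1, 1)`, `ε = ±1`, also satisfies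
`Gᵀ J G = J`, and its adjugate is `J Gᵀ J`. -/
theorem transpose_form_of_rowProduct {ε : ℝ} (hε : ε * ε = 1) {x y z : E3}
    (h : ∀ j k, rowProduct ε j k x y z = Matrix.diagonal ![ε, 1, 1] j k)
    (hdet : tripleProduct x y z = 1) :
    (∀ j k, ε * (columnMatrix x y z 0 j * columnMatrix x y z 0 k) +
        columnMatrix x y z 1 j * columnMatrix x y z 1 k +
        columnMatrix x y z 2 j * columnMatrix x y z 2 k = Matrix.diagonal ![ε, 1, 1] j k) ∧
      ∀ j k, (columnMatrix x y z).adjugate j k =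
        ![ε, 1, 1] j * columnMatrix x y z k j * ![ε, 1, 1] k := by
  set G := columnMatrix x y z with hG
  set J : Matrix (Fin 3) (Fin 3) ℝ := Matrix.diagonal ![ε, 1, 1] with hJ
  have hJJ : J * J = 1 := by
    rw [hJ, Matrix.diagonal_mul_diagonal, ← Matrix.diagonal_one]
    congr 1
    funext i
    fin_cases i <;> simp [hε]
  have h1 : G * J * Gᵀ = J := by
    ext j k
    rw [← h j k, Matrix.mul_apply, Fin.sum_univ_three]
    simp only [hJ, Matrix.mul_diagonal]
    fin_cases j <;> fin_cases k <;> simp [hG, columnMatrix, rowProduct] <;> ring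
  have h2 : G * (J * Gᵀ * J) = 1 := by
    rw [← Matrix.mul_assoc, ← Matrix.mul_assoc, h1, hJJ]
  have h3 : (J * Gᵀ * J) * G = 1 := mul_eq_one_comm.1 h2
  have h4 : Gᵀ * J * G = J :=
    calc Gᵀ * J * G = (J * J) * (Gᵀ * J * G) := by rw [hJJ, Matrix.one_mul]
      _ = J * ((J * Gᵀ * J) * G) := by simp only [Matrix.mul_assoc]
      _ = J := by rw [h3, Matrix.mul_one]
  have h5 : G.adjugate = J * Gᵀ * J :=
    calc G.adjugate = G.adjugate * (G * (J * Gᵀ * J)) := by rw [h2, Matrix.mul_one]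
      _ = G.adjugate * G * (J * Gᵀ * J) := by simp only [Matrix.mul_assoc]
      _ = J * Gᵀ * J := by
        rw [Matrix.adjugate_mul, hG, det_columnMatrix, hdet, one_smul, Matrix.one_mul]
  refine ⟨fun j k => ?_, fun j k => ?_⟩
  · rw [← h4, Matrix.mul_apply, Fin.sum_univ_three]
    simp only [hJ, Matrix.mul_diagonal, Matrix.transpose_apply]
    simp
    ring
  · rw [h5]
    simp only [hJ, Matrix.mul_diagonal, Matrix.diagonal_mul, Matrix.transpose_apply]

/-- `r` is the Amsler surface with profile `f`, as a Chebyshev net over the whole plane;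
`e₁ = ∂r/∂u`, `e₂`, `N` is its adapted positive orthonormal frame. The last two fields fix the
position in space: the coordinate axes go to straight lines. -/
structure IsAmslerFrame (c : ℝ) (f : ℝ → ℝ) (r e₁ e₂ N : ℝ × ℝ → E3) : Prop where
  smooth_r : ContDiff ℝ ∞ r
  smooth_e₁ : ContDiff ℝ ∞ e₁
  smooth_e₂ : ContDiff ℝ ∞ e₂
  r_u : ∀ u v, HasDerivAt (fun u => r (u, v)) (e₁ (u, v)) u
  r_v : ∀ u v, HasDerivAt (fun v => r (u, v))
    (Real.cos (f (u * v)) • e₁ (u, v) + Real.sin (f (u * v)) • e₂ (u, v)) v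
  e₁_u : ∀ u v, HasDerivAt (fun u => e₁ (u, v)) (-(v * deriv f (u * v)) • e₂ (u, v)) u
  e₂_u : ∀ u v, HasDerivAt (fun u => e₂ (u, v)) ((v * deriv f (u * v)) • e₁ (u, v) + N (u, v)) u
  e₁_v : ∀ u v, HasDerivAt (fun v => e₁ (u, v)) (Real.sin (f (u * v)) • N (u, v)) v
  e₂_v : ∀ u v, HasDerivAt (fun v => e₂ (u, v)) (-Real.cos (f (u * v)) • N (u, v)) v
  inner_e₁ : ∀ p, inner ℝ (e₁ p) (e₁ p) = 1
  inner_e₂ : ∀ p, inner ℝ (e₂ p) (e₂ p) = 1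
  inner_N : ∀ p, inner ℝ (N p) (N p) = 1
  inner_e₁_e₂ : ∀ p, inner ℝ (e₁ p) (e₂ p) = 0
  inner_e₁_N : ∀ p, inner ℝ (e₁ p) (N p) = 0
  inner_e₂_N : ∀ p, inner ℝ (e₂ p) (N p) = 0
  cross : ∀ p, WithLp.toLp 2 (crossProduct (e₁ p).ofLp (e₂ p).ofLp) = N p
  r_uAxis : ∀ u, r (u, 0) = u • !₂[1, 0, 0]
  r_vAxis : ∀ v, r (0, v) = v • !₂[Real.cos c, Real.sin c, 0]

theorem inner_E3 (x y : E3) : inner ℝ x y = x 0 * y 0 + x 1 * y 1 + x 2 * y 2 := by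
  simp [PiLp.inner_apply, Fin.sum_univ_three, mul_comm]

/-- The frame exists by integrability of the Gauss-Weingarten equations; it stays orthonormal, as
the matrix product `G Gᵀ` of the frame with its transpose is constant along both coordinate lines.
-/
theorem exists_isAmslerFrame {c : ℝ} {f : ℝ → ℝ} (hf : IsAmslerProfile c f) :
    ∃ r e₁ e₂ N : ℝ × ℝ → E3, IsAmslerFrame c f r e₁ e₂ N := by
  -- the system for `(r, e₁, e₂, N)`
  obtain ⟨p₀, hp₀⟩ : ∃ p : E3 × E3 × E3 × E3 →L[ℝ] E3, ∀ y, p y = y.1 :=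
    ⟨.fst ℝ _ _, fun _ => rfl⟩
  obtain ⟨p₁, hp₁⟩ : ∃ p : E3 × E3 × E3 × E3 →L[ℝ] E3, ∀ y, p y = y.2.1 :=
    ⟨(ContinuousLinearMap.fst ℝ _ _).comp (.snd ℝ _ _), fun _ => rfl⟩
  obtain ⟨p₂, hp₂⟩ : ∃ p : E3 × E3 × E3 × E3 →L[ℝ] E3, ∀ y, p y = y.2.2.1 :=
    ⟨(ContinuousLinearMap.fst ℝ _ _).comp ((ContinuousLinearMap.snd ℝ _ _).comp (.snd ℝ _ _)),
      fun _ => rfl⟩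
  obtain ⟨p₃, hp₃⟩ : ∃ p : E3 × E3 × E3 × E3 →L[ℝ] E3, ∀ y, p y = y.2.2.2 :=
    ⟨(ContinuousLinearMap.snd ℝ _ _).comp ((ContinuousLinearMap.snd ℝ _ _).comp (.snd ℝ _ _)),
      fun _ => rfl⟩
  obtain ⟨P, hP⟩ : ∃ P : E3 × E3 × E3 × E3 →L[ℝ] E3 × E3 × E3 × E3,
      ∀ y, P y = (y.2.1, 0, y.2.2.2, -y.2.2.1) :=
    ⟨p₁.prod (ContinuousLinearMap.prod 0 (p₃.prod (-p₂))), fun y => by simp [hp₁, hp₂, hp₃]⟩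
  obtain ⟨Q, hQ⟩ : ∃ Q : E3 × E3 × E3 × E3 →L[ℝ] E3 × E3 × E3 × E3,
      ∀ y, Q y = (0, -y.2.2.1, y.2.1, 0) :=
    ⟨ContinuousLinearMap.prod 0 ((-p₂).prod (p₁.prod 0)), fun y => by simp [hp₁, hp₂]⟩
  obtain ⟨C, hC⟩ : ∃ C : E3 × E3 × E3 × E3 →L[ℝ] E3 × E3 × E3 × E3,
      ∀ y, C y = (y.2.1, 0, -y.2.2.2, y.2.2.1) :=
    ⟨p₁.prod (ContinuousLinearMap.prod 0 ((-p₃).prod p₂)), fun y => by simp [hp₁, hp₂, hp₃]⟩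
  obtain ⟨S, hS⟩ : ∃ S : E3 × E3 × E3 × E3 →L[ℝ] E3 × E3 × E3 × E3,
      ∀ y, S y = (y.2.2.1, y.2.2.2, 0, -y.2.1) :=
    ⟨p₂.prod (p₃.prod (ContinuousLinearMap.prod 0 (-p₁))), fun y => by simp [hp₁, hp₂, hp₃]⟩
  obtain ⟨y, hy, hy0, hyu, hyv⟩ := exists_solution_gaussWeingarten (P := P) (Q := Q) (C := C)
    (S := S) (fun y => by simp [hP, hC]) (fun y => by simp [hP, hQ, hS])
    (fun y => by simp [hQ, hC, hS]) (fun y => by simp [hQ, hC, hS]) hf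
    (0, !₂[1, 0, 0], !₂[0, 1, 0], !₂[0, 0, 1])
  set r : ℝ × ℝ → E3 := fun p => p₀ (y p) with hr
  set e₁ : ℝ × ℝ → E3 := fun p => p₁ (y p) with he₁
  set e₂ : ℝ × ℝ → E3 := fun p => p₂ (y p) with he₂
  set N : ℝ × ℝ → E3 := fun p => p₃ (y p) with hN
  have ru : ∀ u v, HasDerivAt (fun u => r (u, v)) (e₁ (u, v)) u := fun u v =>
    (p₀.hasFDerivAt.comp_hasDerivAt u (hyu u v)).congr_deriv (by simp [hp₀, hp₁, hP, hQ, he₁])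
  have rv : ∀ u v, HasDerivAt (fun v => r (u, v))
      (Real.cos (f (u * v)) • e₁ (u, v) + Real.sin (f (u * v)) • e₂ (u, v)) v := fun u v =>
    (p₀.hasFDerivAt.comp_hasDerivAt v (hyv u v)).congr_deriv
      (by simp [hp₀, hp₁, hp₂, hC, hS, he₁, he₂])
  have e₁u : ∀ u v, HasDerivAt (fun u => e₁ (u, v)) (-(v * deriv f (u * v)) • e₂ (u, v)) u :=
    fun u v => (p₁.hasFDerivAt.comp_hasDerivAt u (hyu u v)).congr_deriv
      (by simp [hp₁, hp₂, hP, hQ, he₂])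
  have e₂u : ∀ u v, HasDerivAt (fun u => e₂ (u, v))
      ((v * deriv f (u * v)) • e₁ (u, v) + N (u, v)) u :=
    fun u v => (p₂.hasFDerivAt.comp_hasDerivAt u (hyu u v)).congr_deriv
      (by simp [hp₁, hp₂, hp₃, hP, hQ, he₁, hN, add_comm])
  have Nu : ∀ u v, HasDerivAt (fun u => N (u, v)) (-e₂ (u, v)) u :=
    fun u v => (p₃.hasFDerivAt.comp_hasDerivAt u (hyu u v)).congr_deriv
      (by simp [hp₂, hp₃, hP, hQ, he₂])
  have e₁v : ∀ u v, HasDerivAt (fun v => e₁ (u, v)) (Real.sin (f (u * v)) • N (u, v)) v :=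
    fun u v => (p₁.hasFDerivAt.comp_hasDerivAt v (hyv u v)).congr_deriv
      (by simp [hp₁, hp₃, hC, hS, hN])
  have e₂v : ∀ u v, HasDerivAt (fun v => e₂ (u, v)) (-Real.cos (f (u * v)) • N (u, v)) v :=
    fun u v => (p₂.hasFDerivAt.comp_hasDerivAt v (hyv u v)).congr_deriv
      (by simp [hp₂, hp₃, hC, hS, hN])
  have Nv : ∀ u v, HasDerivAt (fun v => N (u, v))
      (Real.cos (f (u * v)) • e₂ (u, v) - Real.sin (f (u * v)) • e₁ (u, v)) v :=
    fun u v => (p₃.hasFDerivAt.comp_hasDerivAt v (hyv u v)).congr_deriv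
      (by simp [hp₁, hp₂, hp₃, hC, hS, he₁, he₂, sub_eq_add_neg])
  have i₁ : e₁ (0, 0) = !₂[1, 0, 0] := by simp [he₁, hp₁, hy0]
  have i₂ : e₂ (0, 0) = !₂[0, 1, 0] := by simp [he₂, hp₂, hy0]
  have i₃ : N (0, 0) = !₂[0, 0, 1] := by simp [hN, hp₃, hy0]
  have i₀ : r (0, 0) = 0 := by simp [hr, hp₀, hy0]
  have hrow : ∀ p j k, rowProduct 1 j k (e₁ p) (e₂ p) (N p) = Matrix.diagonal ![1, 1, 1] j k := by
    intro p j k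
    rw [eq_zero_zero_of_hasDerivAt_zero (g := fun p => rowProduct 1 j k (e₁ p) (e₂ p) (N p))
      (fun u v => (hasDerivAt_rowProduct 1 j k (e₁u u v) (e₂u u v) (Nu u v)).congr_deriv
        (by simp; ring))
      (fun u v => (hasDerivAt_rowProduct 1 j k (e₁v u v) (e₂v u v) (Nv u v)).congr_deriv
        (by simp; ring)) p, i₁, i₂, i₃]
    fin_cases j <;> fin_cases k <;> simp [rowProduct]
  have hdet : ∀ p, tripleProduct (e₁ p) (e₂ p) (N p) = 1 := by
    intro p
    rw [eq_zero_zero_of_hasDerivAt_zero (g := fun p => tripleProduct (e₁ p) (e₂ p) (N p))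
      (fun u v => (hasDerivAt_tripleProduct (e₁u u v) (e₂u u v) (Nu u v)).congr_deriv
        (by simp [tripleProduct]; ring))
      (fun u v => (hasDerivAt_tripleProduct (e₁v u v) (e₂v u v) (Nv u v)).congr_deriv
        (by simp [tripleProduct]; ring)) p, i₁, i₂, i₃]
    simp [tripleProduct]
  have hT := fun p => transpose_form_of_rowProduct (one_mul 1) (hrow p) (hdet p)
  have hI := fun p => (hT p).1
  have hA := fun p => (hT p).2
  have axis_u : ∀ u, r (u, 0) = u • !₂[1, 0, 0] := by
    intro u
    have h1 : ∀ u, e₁ (u, 0) = !₂[1, 0, 0] := fun u => by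
      have hd : ∀ u, HasDerivAt (fun u => e₁ (u, 0)) 0 u := fun u =>
        (e₁u u 0).congr_deriv (by simp)
      rw [← i₁]
      exact is_const_of_deriv_eq_zero (fun u => (hd u).differentiableAt) (fun u => (hd u).deriv) u 0
    have hd : ∀ u, HasDerivAt (fun u => r (u, 0) - u • (!₂[1, 0, 0] : E3)) 0 u := fun u =>
      ((ru u 0).sub ((hasDerivAt_id u).smul_const _)).congr_deriv (by simp [h1])
    have := is_const_of_deriv_eq_zero (fun u => (hd u).differentiableAt) (fun u => (hd u).deriv) u 0
    simpa [i₀, sub_eq_zero] using this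
  have axis_v : ∀ v, r (0, v) = v • !₂[Real.cos c, Real.sin c, 0] := by
    intro v
    have h1 : ∀ v, Real.cos c • e₁ (0, v) + Real.sin c • e₂ (0, v) =
        !₂[Real.cos c, Real.sin c, 0] := fun v => by
      have hd : ∀ v, HasDerivAt (fun v => Real.cos c • e₁ (0, v) + Real.sin c • e₂ (0, v)) 0 v :=
        fun v => (((e₁v 0 v).const_smul (Real.cos c)).add
          ((e₂v 0 v).const_smul (Real.sin c))).congr_deriv (by rw [zero_mul, hf.init]; module)
      have := is_const_of_deriv_eq_zero (fun v => (hd v).differentiableAt)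
        (fun v => (hd v).deriv) v 0
      rw [this, i₁, i₂]
      ext i
      fin_cases i <;> simp
    have hd : ∀ v, HasDerivAt (fun v => r (0, v) - v • (!₂[Real.cos c, Real.sin c, 0] : E3)) 0 v :=
      fun v => ((rv 0 v).sub ((hasDerivAt_id v).smul_const _)).congr_deriv (by
        rw [zero_mul, hf.init, h1]; simp)
    have := is_const_of_deriv_eq_zero (fun v => (hd v).differentiableAt) (fun v => (hd v).deriv) v 0
    simpa [i₀, sub_eq_zero] using this
  refine ⟨r, e₁, e₂, N, p₀.contDiff.comp hy, p₁.contDiff.comp hy, p₂.contDiff.comp hy, ru, rv,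
    e₁u, e₂u, e₁v, e₂v, fun p => ?_, fun p => ?_, fun p => ?_, fun p => ?_, fun p => ?_,
    fun p => ?_, fun p => ?_, axis_u, axis_v⟩
  · rw [inner_E3]; simpa [columnMatrix] using hI p 0 0
  · rw [inner_E3]; simpa [columnMatrix] using hI p 1 1
  · rw [inner_E3]; simpa [columnMatrix] using hI p 2 2
  · rw [inner_E3]; simpa [columnMatrix] using hI p 0 1
  · rw [inner_E3]; simpa [columnMatrix] using hI p 0 2
  · rw [inner_E3]; simpa [columnMatrix] using hI p 1 2
  · have h0 := hA p 2 0
    have h1 := hA p 2 1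
    have h2 := hA p 2 2
    simp [columnMatrix, Matrix.adjugate_fin_three] at h0 h1 h2
    ext i
    fin_cases i
    · simp [cross_apply]; linarith
    · simp [cross_apply]; linarith
    · simp [cross_apply]; linarith

/-- Solutions of `g' = k`, `k' = g`. -/
theorem eq_cosh_smul_add_sinh_smul {E : Type*} [NormedAddCommGroup E] [NormedSpace ℝ E]
    {g k : ℝ → E} (hg : ∀ t, HasDerivAt g (k t) t) (hk : ∀ t, HasDerivAt k (g t) t) (t : ℝ) :
    g t = Real.cosh t • g 0 + Real.sinh t • k 0 := by
  have h1 : ∀ t, HasDerivAt (fun t => Real.cosh t • g t - Real.sinh t • k t) 0 t := fun t =>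
    (((Real.hasDerivAt_cosh t).smul (hg t)).sub
      ((Real.hasDerivAt_sinh t).smul (hk t))).congr_deriv (by module)
  have h2 : ∀ t, HasDerivAt (fun t => Real.cosh t • k t - Real.sinh t • g t) 0 t := fun t =>
    (((Real.hasDerivAt_cosh t).smul (hk t)).sub
      ((Real.hasDerivAt_sinh t).smul (hg t))).congr_deriv (by module)
  have c1 := is_const_of_deriv_eq_zero (fun t => (h1 t).differentiableAt)
    (fun t => (h1 t).deriv) t 0
  have c2 := is_const_of_deriv_eq_zero (fun t => (h2 t).differentiableAt)
    (fun t => (h2 t).deriv) t 0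
  simp only [Real.cosh_zero, Real.sinh_zero, one_smul, zero_smul, sub_zero] at c1 c2
  rw [← c1, ← c2]
  calc g t = (Real.cosh t ^ 2 - Real.sinh t ^ 2) • g t := by rw [Real.cosh_sq]; simp
    _ = _ := by module

/-- `X` is the developing map into the hyperboloid `X₀² - X₁² - X₂² = 1` of Minkowski space of the
plane with the metric `du² + 2 cos φ du dv + dv²`, `φ = f(u v)`, with the orthonormal frame
`e₁ = ∂X/∂u`, `e₂` of the hyperbolic plane along it. The timelike coordinate comes first; the
fields `inner_X` to `inner_e₁_e₂` say that the matrix with columns `X`, `e₁`, `e₂` is a Lorentz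
matrix, the fields `cross_X_e₁` and `cross_X_e₂` equate some of its minors with its entries. -/
structure IsDevelopingFrame (c : ℝ) (f : ℝ → ℝ) (X e₁ e₂ : ℝ × ℝ → E3) : Prop where
  smooth_X : ContDiff ℝ ∞ X
  smooth_e₁ : ContDiff ℝ ∞ e₁
  smooth_e₂ : ContDiff ℝ ∞ e₂
  X_u : ∀ u v, HasDerivAt (fun u => X (u, v)) (e₁ (u, v)) u
  X_v : ∀ u v, HasDerivAt (fun v => X (u, v))
    (Real.cos (f (u * v)) • e₁ (u, v) + Real.sin (f (u * v)) • e₂ (u, v)) v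
  e₁_u : ∀ u v, HasDerivAt (fun u => e₁ (u, v)) (X (u, v) - (v * deriv f (u * v)) • e₂ (u, v)) u
  e₂_u : ∀ u v, HasDerivAt (fun u => e₂ (u, v)) ((v * deriv f (u * v)) • e₁ (u, v)) u
  e₁_v : ∀ u v, HasDerivAt (fun v => e₁ (u, v)) (Real.cos (f (u * v)) • X (u, v)) v
  e₂_v : ∀ u v, HasDerivAt (fun v => e₂ (u, v)) (Real.sin (f (u * v)) • X (u, v)) v
  inner_X : ∀ p, X p 0 ^ 2 = 1 + X p 1 ^ 2 + X p 2 ^ 2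
  inner_e₁ : ∀ p, e₁ p 1 ^ 2 + e₁ p 2 ^ 2 = 1 + e₁ p 0 ^ 2
  inner_e₂ : ∀ p, e₂ p 1 ^ 2 + e₂ p 2 ^ 2 = 1 + e₂ p 0 ^ 2
  inner_X_e₁ : ∀ p, X p 1 * e₁ p 1 + X p 2 * e₁ p 2 = X p 0 * e₁ p 0
  inner_X_e₂ : ∀ p, X p 1 * e₂ p 1 + X p 2 * e₂ p 2 = X p 0 * e₂ p 0
  inner_e₁_e₂ : ∀ p, e₁ p 1 * e₂ p 1 + e₁ p 2 * e₂ p 2 = e₁ p 0 * e₂ p 0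
  cross_X_e₁ : ∀ p, X p 1 * e₁ p 2 - X p 2 * e₁ p 1 = -e₂ p 0
  cross_X_e₂ : ∀ p, X p 1 * e₂ p 2 - X p 2 * e₂ p 1 = e₁ p 0
  one_le_X : ∀ p, 1 ≤ X p 0
  uAxis : ∀ u, X (u, 0) = !₂[Real.cosh u, Real.sinh u, 0] ∧
    e₁ (u, 0) = !₂[Real.sinh u, Real.cosh u, 0] ∧ e₂ (u, 0) = !₂[0, 0, 1]
  vAxis : ∀ v, X (0, v) = !₂[Real.cosh v, Real.sinh v * Real.cos c, Real.sinh v * Real.sin c] ∧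
    Real.cos c • e₁ (0, v) + Real.sin c • e₂ (0, v) =
      !₂[Real.sinh v, Real.cosh v * Real.cos c, Real.cosh v * Real.sin c] ∧
    Real.sin c * e₁ (0, v) 0 - Real.cos c * e₂ (0, v) 0 = 0

/-- The frame exists by integrability of the structure equations; it stays a Lorentz frame, as
`G diag(-1, 1, 1) Gᵀ` is constant along both coordinate lines. -/
theorem exists_isDevelopingFrame {c : ℝ} {f : ℝ → ℝ} (hf : IsAmslerProfile c f) :
    ∃ X e₁ e₂ : ℝ × ℝ → E3, IsDevelopingFrame c f X e₁ e₂ := by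
  obtain ⟨p₀, hp₀⟩ : ∃ p : E3 × E3 × E3 →L[ℝ] E3, ∀ y, p y = y.1 :=
    ⟨.fst ℝ _ _, fun _ => rfl⟩
  obtain ⟨p₁, hp₁⟩ : ∃ p : E3 × E3 × E3 →L[ℝ] E3, ∀ y, p y = y.2.1 :=
    ⟨(ContinuousLinearMap.fst ℝ _ _).comp (.snd ℝ _ _), fun _ => rfl⟩
  obtain ⟨p₂, hp₂⟩ : ∃ p : E3 × E3 × E3 →L[ℝ] E3, ∀ y, p y = y.2.2 :=
    ⟨(ContinuousLinearMap.snd ℝ _ _).comp (.snd ℝ _ _), fun _ => rfl⟩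
  obtain ⟨P, hP⟩ : ∃ P : E3 × E3 × E3 →L[ℝ] E3 × E3 × E3, ∀ y, P y = (y.2.1, y.1, 0) :=
    ⟨p₁.prod (p₀.prod 0), fun y => by simp [hp₁, hp₀]⟩
  obtain ⟨Q, hQ⟩ : ∃ Q : E3 × E3 × E3 →L[ℝ] E3 × E3 × E3, ∀ y, Q y = (0, -y.2.2, y.2.1) :=
    ⟨ContinuousLinearMap.prod 0 ((-p₂).prod p₁), fun y => by simp [hp₁, hp₂]⟩
  obtain ⟨S, hS⟩ : ∃ S : E3 × E3 × E3 →L[ℝ] E3 × E3 × E3, ∀ y, S y = (y.2.2, 0, y.1) :=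
    ⟨p₂.prod (ContinuousLinearMap.prod 0 p₀), fun y => by simp [hp₀, hp₂]⟩
  obtain ⟨y, hy, hy0, hyu, hyv⟩ := exists_solution_gaussWeingarten (P := P) (Q := Q) (C := P)
    (S := S) (fun y => rfl) (fun y => by simp [hP, hQ, hS])
    (fun y => by simp [hQ, hP, hS]) (fun y => by simp [hQ, hP, hS]) hf
    (!₂[1, 0, 0], !₂[0, 1, 0], !₂[0, 0, 1])
  set X : ℝ × ℝ → E3 := fun p => p₀ (y p) with hX
  set e₁ : ℝ × ℝ → E3 := fun p => p₁ (y p) with he₁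
  set e₂ : ℝ × ℝ → E3 := fun p => p₂ (y p) with he₂
  have Xu : ∀ u v, HasDerivAt (fun u => X (u, v)) (e₁ (u, v)) u := fun u v =>
    (p₀.hasFDerivAt.comp_hasDerivAt u (hyu u v)).congr_deriv (by simp [hp₀, hp₁, hP, hQ, he₁])
  have Xv : ∀ u v, HasDerivAt (fun v => X (u, v))
      (Real.cos (f (u * v)) • e₁ (u, v) + Real.sin (f (u * v)) • e₂ (u, v)) v := fun u v =>
    (p₀.hasFDerivAt.comp_hasDerivAt v (hyv u v)).congr_deriv
      (by simp [hp₀, hp₁, hp₂, hP, hS, he₁, he₂])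
  have e₁u : ∀ u v, HasDerivAt (fun u => e₁ (u, v))
      (X (u, v) - (v * deriv f (u * v)) • e₂ (u, v)) u :=
    fun u v => (p₁.hasFDerivAt.comp_hasDerivAt u (hyu u v)).congr_deriv
      (by simp [hp₀, hp₁, hp₂, hP, hQ, he₂, hX, sub_eq_add_neg])
  have e₂u : ∀ u v, HasDerivAt (fun u => e₂ (u, v)) ((v * deriv f (u * v)) • e₁ (u, v)) u :=
    fun u v => (p₂.hasFDerivAt.comp_hasDerivAt u (hyu u v)).congr_deriv
      (by simp [hp₁, hp₂, hP, hQ, he₁])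
  have e₁v : ∀ u v, HasDerivAt (fun v => e₁ (u, v)) (Real.cos (f (u * v)) • X (u, v)) v :=
    fun u v => (p₁.hasFDerivAt.comp_hasDerivAt v (hyv u v)).congr_deriv
      (by simp [hp₀, hp₁, hP, hS, hX])
  have e₂v : ∀ u v, HasDerivAt (fun v => e₂ (u, v)) (Real.sin (f (u * v)) • X (u, v)) v :=
    fun u v => (p₂.hasFDerivAt.comp_hasDerivAt v (hyv u v)).congr_deriv
      (by simp [hp₀, hp₂, hP, hS, hX])
  have i₀ : X (0, 0) = !₂[1, 0, 0] := by simp [hX, hp₀, hy0]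
  have i₁ : e₁ (0, 0) = !₂[0, 1, 0] := by simp [he₁, hp₁, hy0]
  have i₂ : e₂ (0, 0) = !₂[0, 0, 1] := by simp [he₂, hp₂, hy0]
  have hsX : ContDiff ℝ ∞ X := p₀.contDiff.comp hy
  have hrow' : ∀ p j k, rowProduct (-1) j k (X p) (e₁ p) (e₂ p) =
      rowProduct (-1) j k !₂[1, 0, 0] !₂[0, 1, 0] !₂[0, 0, 1] := by
    intro p j k
    rw [eq_zero_zero_of_hasDerivAt_zero (g := fun p => rowProduct (-1) j k (X p) (e₁ p) (e₂ p))
      (fun u v => (hasDerivAt_rowProduct (-1) j k (Xu u v) (e₁u u v) (e₂u u v)).congr_deriv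
        (by simp; ring))
      (fun u v => (hasDerivAt_rowProduct (-1) j k (Xv u v) (e₁v u v) (e₂v u v)).congr_deriv
        (by simp; ring)) p, i₀, i₁, i₂]
  have hdet : ∀ p, tripleProduct (X p) (e₁ p) (e₂ p) = 1 := by
    intro p
    rw [eq_zero_zero_of_hasDerivAt_zero (g := fun p => tripleProduct (X p) (e₁ p) (e₂ p))
      (fun u v => (hasDerivAt_tripleProduct (Xu u v) (e₁u u v) (e₂u u v)).congr_deriv
        (by simp [tripleProduct]; ring))
      (fun u v => (hasDerivAt_tripleProduct (Xv u v) (e₁v u v) (e₂v u v)).congr_deriv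
        (by simp [tripleProduct]; ring)) p, i₀, i₁, i₂]
    simp [tripleProduct]
  have hrow : ∀ p j k, rowProduct (-1) j k (X p) (e₁ p) (e₂ p) =
      Matrix.diagonal ![-1, 1, 1] j k := by
    intro p j k
    rw [hrow']
    fin_cases j <;> fin_cases k <;> simp [rowProduct]
  have hT := fun p => transpose_form_of_rowProduct (by norm_num) (hrow p) (hdet p)
  have hI := fun p => (hT p).1
  have hA := fun p => (hT p).2
  simp only [columnMatrix] at hI hA
  have row_zero : ∀ p, X p 0 ^ 2 = 1 + e₁ p 0 ^ 2 + e₂ p 0 ^ 2 := by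
    intro p
    have := hrow p 0 0
    simp [rowProduct] at this
    linarith
  have one_le_X : ∀ p, 1 ≤ X p 0 := by
    -- `X₀² ≥ 1` and `X₀ = 1` at the origin; the plane is connected
    have hsq : ∀ p, 1 ≤ X p 0 ^ 2 := fun p => by
      rw [row_zero p]; nlinarith [sq_nonneg (e₁ p 0), sq_nonneg (e₂ p 0)]
    have hc : Continuous fun p => X p 0 :=
      (EuclideanSpace.proj (𝕜 := ℝ) (0 : Fin 3)).continuous.comp hsX.continuous
    intro p
    by_contra! hlt
    have hneg : X p 0 ≤ 0 := by
      by_contra! h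
      nlinarith [hsq p]
    obtain ⟨q, hq⟩ := mem_range_of_exists_le_of_exists_ge hc ⟨p, hneg⟩
      ⟨(0, 0), by simp [i₀]⟩
    have := hsq q
    simp only at hq
    rw [hq] at this
    norm_num at this
  refine ⟨X, e₁, e₂, hsX, p₁.contDiff.comp hy, p₂.contDiff.comp hy, Xu, Xv, e₁u, e₂u, e₁v, e₂v,
    fun p => ?_, fun p => ?_, fun p => ?_, fun p => ?_, fun p => ?_, fun p => ?_,
    fun p => ?_, fun p => ?_, one_le_X, fun u => ?_, fun v => ?_⟩
  · have := hI p 0 0; simp at this; linarith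
  · have := hI p 1 1; simp at this; linarith
  · have := hI p 2 2; simp at this; linarith
  · have := hI p 0 1; simp at this; linarith
  · have := hI p 0 2; simp at this; linarith
  · have := hI p 1 2; simp at this; linarith
  · have := hA p 2 0; simp [Matrix.adjugate_fin_three] at this; linarith
  · have := hA p 1 0; simp [Matrix.adjugate_fin_three] at this; linarith
  · have h2 : ∀ u, e₂ (u, 0) = !₂[0, 0, 1] := fun u => by
      have hd : ∀ u, HasDerivAt (fun u => e₂ (u, 0)) 0 u := fun u =>
        (e₂u u 0).congr_deriv (by simp)
      rw [← i₂]
      exact is_const_of_deriv_eq_zero (fun u => (hd u).differentiableAt) (fun u => (hd u).deriv) u 0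
    have hd : ∀ u, HasDerivAt (fun u => e₁ (u, 0)) (X (u, 0)) u := fun u =>
      (e₁u u 0).congr_deriv (by simp)
    refine ⟨?_, ?_, h2 u⟩
    · rw [eq_cosh_smul_add_sinh_smul (fun u => Xu u 0) hd u, i₀, i₁]
      ext i; fin_cases i <;> simp
    · rw [eq_cosh_smul_add_sinh_smul hd (fun u => Xu u 0) u, i₀, i₁]
      ext i; fin_cases i <;> simp
  · have hd1 : ∀ v, HasDerivAt (fun v => X (0, v))
        (Real.cos c • e₁ (0, v) + Real.sin c • e₂ (0, v)) v := fun v =>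
      (Xv 0 v).congr_deriv (by rw [zero_mul, hf.init])
    have hd2 : ∀ v, HasDerivAt (fun v => Real.cos c • e₁ (0, v) + Real.sin c • e₂ (0, v))
        (X (0, v)) v := fun v =>
      (((e₁v 0 v).const_smul (Real.cos c)).add ((e₂v 0 v).const_smul (Real.sin c))).congr_deriv (by
        rw [zero_mul, hf.init, smul_smul, smul_smul, ← add_smul, ← sq, ← sq, Real.cos_sq_add_sin_sq,
          one_smul])
    have hd3 : ∀ v, HasDerivAt (fun v => Real.sin c * e₁ (0, v) 0 - Real.cos c * e₂ (0, v) 0)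
        0 v := fun v =>
      ((((e₁v 0 v).euclidean_apply 0).const_mul (Real.sin c)).sub
        (((e₂v 0 v).euclidean_apply 0).const_mul (Real.cos c))).congr_deriv (by
          rw [zero_mul, hf.init]; simp; ring)
    refine ⟨?_, ?_, ?_⟩
    · rw [eq_cosh_smul_add_sinh_smul hd1 hd2 v, i₀, i₁, i₂]
      ext i; fin_cases i <;> simp
    · rw [eq_cosh_smul_add_sinh_smul hd2 hd1 v, i₀, i₁, i₂]
      ext i; fin_cases i <;> simp
    · have := is_const_of_deriv_eq_zero (fun v => (hd3 v).differentiableAt)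
        (fun v => (hd3 v).deriv) v 0
      rw [this, i₁, i₂]
      simp

/-! ### The developing map is a bijection from a box onto a hyperbolic sector -/

theorem le_of_hasDerivAt_nonneg {g g' : ℝ → ℝ} {a b : ℝ} (hab : a ≤ b)
    (hg : ∀ t ∈ Icc a b, HasDerivAt g (g' t) t) (h : ∀ t ∈ Ioo a b, 0 ≤ g' t) : g a ≤ g b := by
  have hm : MonotoneOn g (Icc a b) := by
    refine monotoneOn_of_deriv_nonneg (convex_Icc a b)
      (fun t ht => (hg t ht).continuousAt.continuousWithinAt) ?_ ?_
    · intro t ht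
      rw [interior_Icc] at ht
      exact (hg t ⟨ht.1.le, ht.2.le⟩).differentiableAt.differentiableWithinAt
    · intro t ht
      rw [interior_Icc] at ht
      rw [(hg t ⟨ht.1.le, ht.2.le⟩).deriv]
      exact h t ht
  exact hm (left_mem_Icc.2 hab) (right_mem_Icc.2 hab) hab

theorem lt_of_hasDerivAt_pos {g g' : ℝ → ℝ} {a b : ℝ} (hab : a < b)
    (hg : ∀ t ∈ Icc a b, HasDerivAt g (g' t) t) (h : ∀ t ∈ Ioo a b, 0 < g' t) : g a < g b := by
  have hm : StrictMonoOn g (Icc a b) := by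
    refine strictMonoOn_of_deriv_pos (convex_Icc a b)
      (fun t ht => (hg t ht).continuousAt.continuousWithinAt) ?_
    intro t ht
    rw [interior_Icc] at ht
    rw [(hg t ⟨ht.1.le, ht.2.le⟩).deriv]
    exact h t ht
  exact hm (left_mem_Icc.2 hab.le) (right_mem_Icc.2 hab.le) hab

/-- Continuous induction for strict positivity. -/
theorem pos_of_pos_before {g : ℝ → ℝ} {M : ℝ} (hc : Continuous g) (h0 : 0 < g 0)
    (h : ∀ v, 0 < v → v ≤ M → (∀ s, 0 ≤ s → s < v → 0 < g s) → 0 < g v) :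
    ∀ v, 0 ≤ v → v ≤ M → 0 < g v := by
  by_contra! hcon
  obtain ⟨v, hv0, hvM, hv⟩ := hcon
  set A := {s : ℝ | 0 ≤ s ∧ g s ≤ 0} with hA
  have hAc : IsClosed A :=
    (isClosed_le continuous_const continuous_id).inter (isClosed_le hc continuous_const)
  have hAb : BddBelow A := ⟨0, fun s hs => hs.1⟩
  have hw := hAc.csInf_mem ⟨v, hv0, hv⟩ hAb
  have hwv : sInf A ≤ v := csInf_le hAb ⟨hv0, hv⟩
  have hw0 : 0 < sInf A := by
    refine lt_of_le_of_ne hw.1 fun he => ?_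
    have := hw.2
    rw [← he] at this
    linarith
  refine absurd hw.2 (not_le.2 (h _ hw0 (hwv.trans hvM) fun s hs0 hs => ?_))
  by_contra! hs'
  exact absurd (csInf_le hAb ⟨hs0, hs'⟩) (not_le.2 hs)

/-- As long as the profile stays below `π`, it is bounded below by its initial value. -/
theorem IsAmslerProfile.pos {c : ℝ} {f : ℝ → ℝ} (hf : IsAmslerProfile c f) (hc : 0 < c) {T : ℝ}
    (hT : ∀ s, 0 ≤ s → s ≤ T → f s < Real.pi) : ∀ s, 0 ≤ s → s ≤ T → 0 < f s := by
  have hfd : ∀ t, HasDerivAt f (deriv f t) t := fun t =>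
    (hf.smooth.differentiable (by simp) t).hasDerivAt
  have hf1 : ContDiff ℝ ∞ (deriv f) := (contDiff_infty_iff_deriv.1 hf.smooth).2
  have hg : ∀ t, HasDerivAt (fun t => t * deriv f t) (Real.sin (f t)) t := fun t => by
    have := (hasDerivAt_id t).mul (hf1.differentiable (by simp) t).hasDerivAt
    refine this.congr_deriv ?_
    rw [← hf.ode]
    simp
  refine pos_of_pos_before hf.smooth.continuous (by rw [hf.init]; exact hc) fun v hv hvT hpos => ?_
  have h1 : ∀ s, 0 < s → s < v → 0 ≤ deriv f s := by
    intro s hs hsv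
    have := le_of_hasDerivAt_nonneg hs.le (fun t _ => hg t) fun t ht =>
      (Real.sin_pos_of_pos_of_lt_pi (hpos t ht.1.le (ht.2.trans hsv))
        (hT t ht.1.le ((ht.2.trans hsv).le.trans hvT))).le
    rw [zero_mul] at this
    exact nonneg_of_mul_nonneg_right this hs
  have h2 := le_of_hasDerivAt_nonneg hv.le (fun t _ => hfd t) fun t ht => h1 t ht.1 ht.2
  rw [hf.init] at h2
  linarith

/-- On the box `[0, M]²` the generating angle `f(u v)` lies between `0` and `π / 3`, so that its
sine is positive and its cosine at least `1 / 2`. -/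
def SmallAngle (f : ℝ → ℝ) (M : ℝ) : Prop := ∀ t, 0 ≤ t → t ≤ M ^ 2 → 0 < f t ∧ f t ≤ Real.pi / 3

theorem SmallAngle.sin_pos {f : ℝ → ℝ} {M : ℝ} (hM : SmallAngle f M) {u v : ℝ} (hu : u ∈ Icc 0 M)
    (hv : v ∈ Icc 0 M) : 0 < Real.sin (f (u * v)) := by
  obtain ⟨h1, h2⟩ := hM (u * v) (mul_nonneg hu.1 hv.1) (by nlinarith [hu.1, hu.2, hv.1, hv.2])
  exact Real.sin_pos_of_pos_of_lt_pi h1 (by linarith [Real.pi_pos])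

theorem SmallAngle.half_le_cos {f : ℝ → ℝ} {M : ℝ} (hM : SmallAngle f M) {u v : ℝ}
    (hu : u ∈ Icc 0 M) (hv : v ∈ Icc 0 M) : 1 / 2 ≤ Real.cos (f (u * v)) := by
  obtain ⟨h1, h2⟩ := hM (u * v) (mul_nonneg hu.1 hv.1) (by nlinarith [hu.1, hu.2, hv.1, hv.2])
  rw [← Real.cos_pi_div_three]
  exact Real.cos_le_cos_of_nonneg_of_le_pi h1.le (by linarith [Real.pi_pos]) h2

namespace IsDevelopingFrame

variable {c : ℝ} {f : ℝ → ℝ} {X e₁ e₂ : ℝ × ℝ → E3} (h : IsDevelopingFrame c f X e₁ e₂)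
  (hf : IsAmslerProfile c f) {M : ℝ}

include h in
theorem e₂_zero_pos (hM : SmallAngle f M) {u v : ℝ} (hu : u ∈ Icc 0 M) (hv : v ∈ Icc 0 M)
    (hv0 : 0 < v) : 0 < e₂ (u, v) 0 := by
  have := lt_of_hasDerivAt_pos hv0 (fun t _ => (h.e₂_v u t).euclidean_apply 0) fun t ht => by
    have := hM.sin_pos hu ⟨ht.1.le, ht.2.le.trans hv.2⟩
    have := h.one_le_X (u, t)
    simp
    positivity
  simpa [(h.uAxis u).2.2] using this

include h in
theorem e₂_zero_nonneg (hM : SmallAngle f M) {u v : ℝ} (hu : u ∈ Icc 0 M) (hv : v ∈ Icc 0 M) :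
    0 ≤ e₂ (u, v) 0 := by
  rcases hv.1.eq_or_lt with rfl | hv0
  · simp [(h.uAxis u).2.2]
  · exact (h.e₂_zero_pos hM hu hv hv0).le

include h in
theorem e₁_zero_ge (hM : SmallAngle f M) {u v : ℝ} (hu : u ∈ Icc 0 M) (hv : v ∈ Icc 0 M) :
    Real.sinh u + v / 2 ≤ e₁ (u, v) 0 := by
  have := le_of_hasDerivAt_nonneg hv.1 (fun t _ => ((h.e₁_v u t).euclidean_apply 0).sub
    ((hasDerivAt_id t).div_const 2)) fun t ht => by
    have := hM.half_le_cos hu ⟨ht.1.le, ht.2.le.trans hv.2⟩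
    have := h.one_le_X (u, t)
    simp
    nlinarith
  simp [(h.uAxis u).2.1] at this
  linarith

include h in
/-- The derivative of `X₀` along the `v`-lines. -/
theorem X_v_zero_ge (hM : SmallAngle f M) {u v : ℝ} (hu : u ∈ Icc 0 M) (hv : v ∈ Icc 0 M) :
    v / 4 ≤ Real.cos (f (u * v)) * e₁ (u, v) 0 + Real.sin (f (u * v)) * e₂ (u, v) 0 := by
  have h1 := hM.half_le_cos hu hv
  have h2 := hM.sin_pos hu hv
  have h3 := h.e₁_zero_ge hM hu hv
  have h4 := h.e₂_zero_nonneg hM hu hv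
  have h5 := Real.sinh_nonneg_iff.2 hu.1
  have h6 : 0 ≤ e₁ (u, v) 0 := by linarith [hv.1]
  nlinarith [mul_nonneg h2.le h4]

include h in
theorem X_zero_strictMono_left (hM : SmallAngle f M) {u u' v : ℝ} (hu : 0 ≤ u) (huu : u < u')
    (hu' : u' ≤ M) (hv : v ∈ Icc 0 M) : X (u, v) 0 < X (u', v) 0 :=
  lt_of_hasDerivAt_pos huu (fun t _ => (h.X_u t v).euclidean_apply 0) fun t ht => by
    have h1 := h.e₁_zero_ge hM (u := t) ⟨hu.trans ht.1.le, ht.2.le.trans hu'⟩ hv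
    have h2 := Real.sinh_pos_iff.2 (hu.trans_lt ht.1)
    linarith [hv.1]

include h in
theorem X_zero_strictMono_right (hM : SmallAngle f M) {u v v' : ℝ} (hv : 0 ≤ v) (hvv : v < v')
    (hv' : v' ≤ M) (hu : u ∈ Icc 0 M) : X (u, v) 0 < X (u, v') 0 :=
  lt_of_hasDerivAt_pos hvv (fun t _ => (h.X_v u t).euclidean_apply 0) fun t ht => by
    have h1 := h.X_v_zero_ge hM hu (v := t) ⟨hv.trans ht.1.le, ht.2.le.trans hv'⟩
    have h2 := hv.trans_lt ht.1
    simp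
    linarith

include h in
theorem X_zero_ge (hM : SmallAngle f M) {u v : ℝ} (hu : u ∈ Icc 0 M) (hv : v ∈ Icc 0 M) :
    Real.cosh u + v ^ 2 / 8 ≤ X (u, v) 0 := by
  have := le_of_hasDerivAt_nonneg hv.1 (fun t _ => ((h.X_v u t).euclidean_apply 0).sub
    (((hasDerivAt_id t).pow 2).div_const 8)) fun t ht => by
    have := h.X_v_zero_ge hM hu (v := t) ⟨ht.1.le, ht.2.le.trans hv.2⟩
    simp
    linarith
  simp [(h.uAxis u).1] at this
  linarith

include h hf in
/-- `sin φ ⟨e₁, ∂ρ⟩ - cos φ ⟨e₂, ∂ρ⟩ > 0`: the radial direction lies strictly on the `e₁`-side of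
the `v`-lines. -/
theorem radial_cross_pos (hM : SmallAngle f M) {u v : ℝ} (hu : u ∈ Icc 0 M) (hv : v ∈ Icc 0 M)
    (hu0 : 0 < u) :
    0 < Real.sin (f (u * v)) * e₁ (u, v) 0 - Real.cos (f (u * v)) * e₂ (u, v) 0 := by
  have hfu : ∀ t, HasDerivAt (fun u => f (u * v)) (v * deriv f (t * v)) t := fun t => by
    have hfd : HasDerivAt f (deriv f (t * v)) (t * v) :=
      (hf.smooth.differentiable (by simp) _).hasDerivAt
    exact (hfd.comp t ((hasDerivAt_id t).mul_const v)).congr_deriv (by ring)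
  have := lt_of_hasDerivAt_pos hu0 (g' := fun t => Real.sin (f (t * v)) * X (t, v) 0)
    (fun t _ => (((hfu t).sin.mul ((h.e₁_u t v).euclidean_apply 0)).sub
      ((hfu t).cos.mul ((h.e₂_u t v).euclidean_apply 0))).congr_deriv (by simp; ring))
    fun t ht => by
    have := hM.sin_pos (u := t) ⟨ht.1.le, ht.2.le.trans hu.2⟩ hv
    have := h.one_le_X (t, v)
    positivity
  simpa [hf.init, (h.vAxis v).2.2] using this

include h hf in
theorem X_one_pos (hM : SmallAngle f M) {u v : ℝ} (hu : u ∈ Icc 0 M) (hv : v ∈ Icc 0 M)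
    (h0 : 0 < u ∨ 0 < v) : 0 < X (u, v) 1 := by
  rcases hu.1.eq_or_lt with rfl | hu0
  · have hv0 : 0 < v := by simpa using h0
    have hc := hM.half_le_cos hu hv
    rw [zero_mul, hf.init] at hc
    have := Real.sinh_pos_iff.2 hv0
    simp [(h.vAxis v).1]
    positivity
  · have hX : Continuous fun v => X (u, v) 1 := continuous_iff_continuousAt.2 fun v =>
      ((h.X_v u v).euclidean_apply 1).continuousAt
    refine pos_of_pos_before (M := M) hX (by simpa [(h.uAxis u).1] using hu0)
      (fun w hw hwM hpos => ?_) v hv.1 hv.2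
    -- `X₁`, `(e₁)₁` and `(e₂)₁` are nondecreasing as long as they are nonnegative
    have a1 : ∀ s, 0 ≤ s → s < w → 0 ≤ e₁ (u, s) 1 := fun s hs hsw => by
      have := le_of_hasDerivAt_nonneg hs (fun t _ => (h.e₁_v u t).euclidean_apply 1) fun t ht => by
        have := hM.half_le_cos hu (v := t) ⟨ht.1.le, (ht.2.trans hsw).le.trans hwM⟩
        have := hpos t ht.1.le (ht.2.trans hsw)
        simp
        positivity
      refine le_trans ?_ this
      simp [(h.uAxis u).2.1, (Real.cosh_pos u).le]
    have a2 : ∀ s, 0 ≤ s → s < w → 0 ≤ e₂ (u, s) 1 := fun s hs hsw => by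
      have := le_of_hasDerivAt_nonneg hs (fun t _ => (h.e₂_v u t).euclidean_apply 1) fun t ht => by
        have := hM.sin_pos hu (v := t) ⟨ht.1.le, (ht.2.trans hsw).le.trans hwM⟩
        have := hpos t ht.1.le (ht.2.trans hsw)
        simp
        positivity
      refine le_trans ?_ this
      simp [(h.uAxis u).2.2]
    have := le_of_hasDerivAt_nonneg hw.le (fun t _ => (h.X_v u t).euclidean_apply 1) fun t ht => by
      have := hM.half_le_cos hu (v := t) ⟨ht.1.le, ht.2.le.trans hwM⟩
      have := hM.sin_pos hu (v := t) ⟨ht.1.le, ht.2.le.trans hwM⟩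
      have := a1 t ht.1.le ht.2
      have := a2 t ht.1.le ht.2
      simp
      positivity
    refine lt_of_lt_of_le ?_ this
    simpa [(h.uAxis u).1] using hu0

include h hf in
/-- The polar angle of the developing map decreases strictly along the `u`-lines. -/
theorem slope_strictAnti_left (hM : SmallAngle f M) {u u' v : ℝ} (hu : 0 ≤ u) (huu : u < u')
    (hu' : u' ≤ M) (hv : v ∈ Icc 0 M) (hv0 : 0 < v) :
    X (u', v) 2 / X (u', v) 1 < X (u, v) 2 / X (u, v) 1 := by
  have hI : ∀ t ∈ Icc u u', t ∈ Icc 0 M := fun t ht => ⟨hu.trans ht.1, ht.2.trans hu'⟩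
  have hp : ∀ t ∈ Icc u u', 0 < X (t, v) 1 := fun t ht =>
    h.X_one_pos hf hM (hI t ht) hv (.inr hv0)
  have := lt_of_hasDerivAt_pos huu (fun t ht => (((h.X_u t v).euclidean_apply 2).div
    ((h.X_u t v).euclidean_apply 1) (hp t ht).ne').neg) fun t ht => by
    have h1 := h.cross_X_e₁ (t, v)
    have h2 := h.e₂_zero_pos hM (hI t ⟨ht.1.le, ht.2.le⟩) hv hv0
    rw [neg_pos]
    refine div_neg_of_neg_of_pos ?_ (pow_pos (hp t ⟨ht.1.le, ht.2.le⟩) 2)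
    linarith
  simpa using this

include h hf in
/-- The polar angle of the developing map increases strictly along the `v`-lines. -/
theorem slope_strictMono_right (hM : SmallAngle f M) {u v v' : ℝ} (hv : 0 ≤ v) (hvv : v < v')
    (hv' : v' ≤ M) (hu : u ∈ Icc 0 M) (hu0 : 0 < u) :
    X (u, v) 2 / X (u, v) 1 < X (u, v') 2 / X (u, v') 1 := by
  have hI : ∀ t ∈ Icc v v', t ∈ Icc 0 M := fun t ht => ⟨hv.trans ht.1, ht.2.trans hv'⟩
  have hp : ∀ t ∈ Icc v v', 0 < X (u, t) 1 := fun t ht =>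
    h.X_one_pos hf hM hu (hI t ht) (.inl hu0)
  refine lt_of_hasDerivAt_pos hvv (fun t ht => ((h.X_v u t).euclidean_apply 2).div
    ((h.X_v u t).euclidean_apply 1) (hp t ht).ne') fun t ht => ?_
  have h1 := h.cross_X_e₁ (u, t)
  have h2 := h.cross_X_e₂ (u, t)
  have h3 := h.radial_cross_pos hf hM hu (hI t ⟨ht.1.le, ht.2.le⟩) hu0
  refine div_pos ?_ (pow_pos (hp t ⟨ht.1.le, ht.2.le⟩) 2)
  simp
  rw [← h2, eq_neg_of_add_eq_zero_left (a := e₂ (u, t) 0) (by linarith [h1] :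
    e₂ (u, t) 0 + (X (u, t) 1 * e₁ (u, t) 2 - X (u, t) 2 * e₁ (u, t) 1) = 0)] at h3
  linarith

include h hf in
/-- Two points with the same `X₀` are ordered oppositely in `u` and `v`, and going around the
rectangle they span changes the polar angle monotonically. -/
theorem injOn_X (hM : SmallAngle f M) : InjOn X (Icc 0 M ×ˢ Icc 0 M) := by
  have key : ∀ u v u' v', u ∈ Icc 0 M → v ∈ Icc 0 M → u' ∈ Icc 0 M → v' ∈ Icc 0 M →
      X (u, v) = X (u', v') → ¬ u < u' := by
    intro u v u' v' hu hv hu' hv' he huu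
    have hvv : v' < v := by
      by_contra! hle
      have h1 := h.X_zero_strictMono_left hM hu.1 huu hu'.2 hv
      rcases hle.eq_or_lt with rfl | hlt
      · rw [he] at h1; exact lt_irrefl _ h1
      · have h2 := h.X_zero_strictMono_right hM hv.1 hlt hv'.2 hu'
        rw [he] at h1; exact lt_irrefl _ (h1.trans h2)
    have h1 := h.slope_strictAnti_left hf hM hu.1 huu hu'.2 hv (hv'.1.trans_lt hvv)
    have h2 := h.slope_strictMono_right hf hM hv'.1 hvv hv.2 hu' (hu.1.trans_lt huu)
    rw [he] at h1
    exact lt_irrefl _ (h1.trans h2)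
  rintro ⟨u, v⟩ ⟨hu, hv⟩ ⟨u', v'⟩ ⟨hu', hv'⟩ he
  have huu : u = u' := le_antisymm (not_lt.1 (key u' v' u v hu' hv' hu hv he.symm))
    (not_lt.1 (key u v u' v' hu hv hu' hv' he))
  subst huu
  rcases lt_trichotomy v v' with hlt | rfl | hlt
  · exact absurd (congrArg (fun x : E3 => x 0) he)
      (h.X_zero_strictMono_right hM hv.1 hlt hv'.2 hu).ne
  · rfl
  · exact absurd (congrArg (fun x : E3 => x 0) he)
      (h.X_zero_strictMono_right hM hv'.1 hlt hv.2 hu).ne'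

include h hf in
/-- On the level set `X₀ = C` the closed conditions "polar angle `≥ θ`" and "polar angle `≤ θ`"
project onto closed subsets of the `u`-interval `[0, u₀]`, `cosh u₀ = C`, that cover it, so they
meet. -/
theorem exists_X_eq (hM : SmallAngle f M) {C s θ : ℝ} (hs : 0 ≤ s) (hC0 : 0 ≤ C)
    (hCs : C ^ 2 = 1 + s ^ 2) (hCM : 8 * C ≤ M) (hθ0 : 0 ≤ θ) (hθc : θ ≤ c) :
    ∃ u ∈ Icc 0 M, ∃ v ∈ Icc 0 M, X (u, v) = !₂[C, s * Real.cos θ, s * Real.sin θ] := by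
  have hC1 : 1 ≤ C := by nlinarith
  have hM0 : 0 ≤ M := by linarith
  set u₀ := Real.arsinh s with hu₀
  have hsinh : Real.sinh u₀ = s := Real.sinh_arsinh s
  have hu₀0 : 0 ≤ u₀ := Real.arsinh_nonneg_iff.2 hs
  have hcosh : Real.cosh u₀ = C := by
    have h1 := Real.cosh_sq u₀
    rw [hsinh] at h1
    have h2 := Real.cosh_pos u₀
    nlinarith
  have hu₀C : u₀ ≤ C := by
    have h1 := Real.self_le_sinh_iff.2 hu₀0
    nlinarith
  have hu₀M : u₀ ≤ M := by linarith
  have hI : ∀ u ∈ Icc 0 u₀, u ∈ Icc 0 M := fun u hu => ⟨hu.1, hu.2.trans hu₀M⟩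
  have hXc : Continuous X := h.smooth_X.continuous
  have hXi : ∀ i : Fin 3, Continuous fun p => X p i := fun i =>
    (EuclideanSpace.proj (𝕜 := ℝ) i).continuous.comp hXc
  rcases hs.eq_or_lt with rfl | hs0
  · refine ⟨0, ⟨le_rfl, hM0⟩, 0, ⟨le_rfl, hM0⟩, ?_⟩
    have : C = 1 := by nlinarith
    simp [(h.uAxis 0).1, this]
  -- `L` has the sign of the polar angle minus `θ`
  set L : ℝ × ℝ → ℝ := fun p => X p 2 * Real.cos θ - X p 1 * Real.sin θ with hL
  have hLc : Continuous L := ((hXi 2).mul_const _).sub ((hXi 1).mul_const _)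
  set K : Set (ℝ × ℝ) := (Icc 0 u₀ ×ˢ Icc 0 M) ∩ {p | X p 0 = C} with hK
  have hKc : IsCompact K :=
    (isCompact_Icc.prod isCompact_Icc).inter_right (isClosed_eq (hXi 0) continuous_const)
  have hKA : IsClosed (Prod.fst '' (K ∩ {p | 0 ≤ L p})) :=
    ((hKc.inter_right (isClosed_le continuous_const hLc)).image continuous_fst).isClosed
  have hKB : IsClosed (Prod.fst '' (K ∩ {p | L p ≤ 0})) :=
    ((hKc.inter_right (isClosed_le hLc continuous_const)).image continuous_fst).isClosed
  have hcover : Icc 0 u₀ ⊆ Prod.fst '' (K ∩ {p | 0 ≤ L p}) ∪ Prod.fst '' (K ∩ {p | L p ≤ 0}) := by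
    intro u hu
    have h1 : X (u, 0) 0 ≤ C := by
      rw [(h.uAxis u).1, ← hcosh]
      simpa using Real.cosh_le_cosh.2 (by rw [abs_of_nonneg hu.1, abs_of_nonneg hu₀0]; exact hu.2)
    -- `X₀ ≥ M² / 8 ≥ C` on the far side of the square, since `M ≥ 8 C` and `C ≥ 1`
    have h2 : C ≤ X (u, M) 0 := by
      have := h.X_zero_ge hM (hI u hu) (v := M) ⟨hM0, le_rfl⟩
      have := Real.cosh_pos u
      nlinarith
    have hcont : Continuous fun v => X (u, v) 0 := (hXi 0).comp (by fun_prop)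
    obtain ⟨v, hv, hv'⟩ := intermediate_value_Icc hM0 hcont.continuousOn ⟨h1, h2⟩
    have hmem : (u, v) ∈ K := ⟨⟨hu, hv⟩, hv'⟩
    rcases le_total 0 (L (u, v)) with hle | hle
    · exact .inl ⟨(u, v), ⟨hmem, hle⟩, rfl⟩
    · exact .inr ⟨(u, v), ⟨hmem, hle⟩, rfl⟩
  have hA : (Icc 0 u₀ ∩ Prod.fst '' (K ∩ {p | 0 ≤ L p})).Nonempty := by
    refine ⟨0, ⟨le_rfl, hu₀0⟩, (0, u₀), ⟨⟨⟨⟨le_rfl, hu₀0⟩, hu₀0, hu₀M⟩, ?_⟩, ?_⟩, rfl⟩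
    · simp [(h.vAxis u₀).1, hcosh]
    · have : L (0, u₀) = s * Real.sin (c - θ) := by
        simp only [hL, (h.vAxis u₀).1, hsinh, Real.sin_sub]
        simp
        ring
      change 0 ≤ L (0, u₀)
      rw [this]
      have hcπ := (hM 0 le_rfl (by positivity)).2
      rw [hf.init] at hcπ
      exact mul_nonneg hs (Real.sin_nonneg_of_nonneg_of_le_pi (by linarith)
        (by linarith [Real.pi_pos]))
  have hB : (Icc 0 u₀ ∩ Prod.fst '' (K ∩ {p | L p ≤ 0})).Nonempty := by
    refine ⟨u₀, ⟨hu₀0, le_rfl⟩, (u₀, 0), ⟨⟨⟨⟨hu₀0, le_rfl⟩, le_rfl, hM0⟩, ?_⟩, ?_⟩, rfl⟩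
    · simp [(h.uAxis u₀).1, hcosh]
    · have hcπ := (hM 0 le_rfl (by positivity)).2
      rw [hf.init] at hcπ
      have := Real.sin_nonneg_of_nonneg_of_le_pi hθ0 (by linarith [Real.pi_pos])
      simp [hL, (h.uAxis u₀).1, hsinh]
      positivity
  obtain ⟨u, hu, ⟨⟨ua, va⟩, ⟨⟨⟨-, hva⟩, hCa⟩, hLa⟩, rfl⟩,
      ⟨⟨ub, vb⟩, ⟨⟨⟨-, hvb⟩, hCb⟩, hLb⟩, hab⟩⟩ :=
    (isPreconnected_closed_iff.1 isPreconnected_Icc) _ _ hKA hKB hcover hA hB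
  simp only at hab hu
  subst hab
  simp only [mem_ofPred_eq] at hCa hCb hLa hLb
  have hvab : va = vb := by
    rcases lt_trichotomy va vb with hlt | he | hlt
    · exact absurd (hCa.trans hCb.symm)
        (h.X_zero_strictMono_right hM hva.1 hlt hvb.2 (hI _ hu)).ne
    · exact he
    · exact absurd (hCb.trans hCa.symm)
        (h.X_zero_strictMono_right hM hvb.1 hlt hva.2 (hI _ hu)).ne
  subst hvab
  have hL0 : X (ub, va) 2 * Real.cos θ - X (ub, va) 1 * Real.sin θ = 0 := le_antisymm hLb hLa
  refine ⟨ub, hI _ hu, va, hva, ?_⟩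
  have hX0 := h.inner_X (ub, va)
  rw [hCa, hCs] at hX0
  have hX1 : 0 < X (ub, va) 1 := by
    refine h.X_one_pos hf hM (hI _ hu) hva ?_
    by_contra! hcon
    have h1 : ub = 0 := le_antisymm hcon.1 hu.1
    have h2 : va = 0 := le_antisymm hcon.2 hva.1
    rw [h1, h2, (h.uAxis 0).1] at hCa
    simp at hCa
    nlinarith
  have hcosθ : 0 < Real.cos θ := by
    have hcπ := (hM 0 le_rfl (by positivity)).2
    rw [hf.init] at hcπ
    exact Real.cos_pos_of_mem_Ioo ⟨by linarith [Real.pi_pos], by linarith [Real.pi_pos]⟩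
  -- the point has polar angle `θ`, and `X₀ = C` determines its radius
  set l := X (ub, va) 1 * Real.cos θ + X (ub, va) 2 * Real.sin θ with hl
  have hsc := Real.sin_sq_add_cos_sq θ
  have e1 : X (ub, va) 1 = l * Real.cos θ := by
    rw [hl]; linear_combination (-Real.sin θ) * hL0 - X (ub, va) 1 * hsc
  have e2 : X (ub, va) 2 = l * Real.sin θ := by
    rw [hl]; linear_combination Real.cos θ * hL0 - X (ub, va) 2 * hsc
  have hl0 : 0 < l := by
    rw [e1] at hX1
    exact (pos_iff_pos_of_mul_pos hX1).2 hcosθ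
  have hls : l = s := by
    have : l ^ 2 = s ^ 2 := by
      rw [e1, e2] at hX0
      linear_combination -hX0 - l ^ 2 * hsc
    nlinarith
  ext i
  fin_cases i
  · simpa using hCa
  · simpa [hls] using e1
  · simpa [hls] using e2

end IsDevelopingFrame

/-! ### The Poincaré disk chart -/

/-- The projection of the hyperboloid `x₀² - x₁² - x₂² = 1` onto the Poincaré disk. -/
noncomputable def poincareProj (x : E3) : E2 := !₂[x 1 / (1 + x 0), x 2 / (1 + x 0)]

theorem inner_E2 (x y : E2) : inner ℝ x y = x 0 * y 0 + x 1 * y 1 := by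
  simp [PiLp.inner_apply, Fin.sum_univ_two, mul_comm]

theorem norm_sq_E2 (x : E2) : ‖x‖ ^ 2 = x 0 ^ 2 + x 1 ^ 2 := by
  rw [← real_inner_self_eq_norm_sq, inner_E2]; ring

theorem norm_polar (s θ : ℝ) : ‖(!₂[s * Real.cos θ, s * Real.sin θ] : E2)‖ = |s| := by
  have h1 : ‖(!₂[s * Real.cos θ, s * Real.sin θ] : E2)‖ ^ 2 = s ^ 2 := by
    rw [norm_sq_E2]
    simp
    linear_combination s ^ 2 * Real.sin_sq_add_cos_sq θ
  rw [← abs_of_nonneg (norm_nonneg (!₂[s * Real.cos θ, s * Real.sin θ] : E2))]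
  exact (sq_eq_sq_iff_abs_eq_abs _ _).1 h1

theorem HasDerivAt.line {E : Type*} [NormedAddCommGroup E] [NormedSpace ℝ E] {F : ℝ × ℝ → E}
    (hF : Differentiable ℝ F) (p h : ℝ × ℝ) :
    HasDerivAt (fun t : ℝ => F (p + t • h)) (fderiv ℝ F p h) 0 := by
  have h1 : HasDerivAt (fun t : ℝ => p + t • h) h 0 := by
    simpa using ((hasDerivAt_id (0 : ℝ)).smul_const h).const_add p
  have h2 : HasFDerivAt F (fderiv ℝ F p) (p + (0 : ℝ) • h) := by
    simpa using (hF p).hasFDerivAt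
  exact h2.comp_hasDerivAt 0 h1

theorem fderiv_apply_of_partial {E : Type*} [NormedAddCommGroup E] [NormedSpace ℝ E]
    {F : ℝ × ℝ → E} (hF : Differentiable ℝ F) {p : ℝ × ℝ} {a b : E}
    (hu : HasDerivAt (fun u => F (u, p.2)) a p.1) (hv : HasDerivAt (fun v => F (p.1, v)) b p.2)
    (h : ℝ × ℝ) : fderiv ℝ F p h = h.1 • a + h.2 • b := by
  have h1 : fderiv ℝ F p (1, 0) = a := by
    have e : HasDerivAt (fun u : ℝ => (u, p.2)) ((1 : ℝ), (0 : ℝ)) p.1 :=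
      (hasDerivAt_id p.1).prodMk (hasDerivAt_const _ _)
    exact ((hF (p.1, p.2)).hasFDerivAt.comp_hasDerivAt p.1 e).unique hu
  have h2 : fderiv ℝ F p (0, 1) = b := by
    have e : HasDerivAt (fun v : ℝ => (p.1, v)) ((0 : ℝ), (1 : ℝ)) p.2 :=
      (hasDerivAt_const _ _).prodMk (hasDerivAt_id p.2)
    exact ((hF (p.1, p.2)).hasFDerivAt.comp_hasDerivAt p.2 e).unique hv
  rw [← h1, ← h2, ← map_smul, ← map_smul, ← map_add]
  simp

/-- The first fundamental form `du² + 2 cos φ du dv + dv²` of a Chebyshev net. -/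
noncomputable def chebyshevForm (φ : ℝ) (h k : ℝ × ℝ) : ℝ :=
  h.1 * k.1 + Real.cos φ * (h.1 * k.2 + h.2 * k.1) + h.2 * k.2

/-- The form is nondegenerate: `(h₁ + cos φ h₂)² + (sin φ h₂)² = 0` only for `h = 0`. -/
theorem eq_zero_of_chebyshevForm_self {φ : ℝ} (hφ : Real.sin φ ≠ 0) {h : ℝ × ℝ}
    (hh : chebyshevForm φ h h = 0) : h = 0 := by
  have h1 : (h.1 + Real.cos φ * h.2) ^ 2 + (Real.sin φ * h.2) ^ 2 = 0 := by
    rw [← hh, chebyshevForm]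
    linear_combination h.2 ^ 2 * Real.sin_sq_add_cos_sq φ
  have h2 : Real.sin φ * h.2 = 0 := by nlinarith [sq_nonneg (h.1 + Real.cos φ * h.2)]
  have h3 : h.2 = 0 := by simpa [hφ] using h2
  rw [h3] at h1
  have h4 : h.1 = 0 := by nlinarith
  exact Prod.ext h4 h3

theorem IsAmslerFrame.inner_fderiv {c : ℝ} {f : ℝ → ℝ} {r e₁ e₂ N : ℝ × ℝ → E3}
    (h : IsAmslerFrame c f r e₁ e₂ N) (p a b : ℝ × ℝ) :
    inner ℝ (fderiv ℝ r p a) (fderiv ℝ r p b) = chebyshevForm (f (p.1 * p.2)) a b := by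
  have hd := h.smooth_r.differentiable (by simp)
  rw [fderiv_apply_of_partial hd (h.r_u p.1 p.2) (h.r_v p.1 p.2),
    fderiv_apply_of_partial hd (h.r_u p.1 p.2) (h.r_v p.1 p.2)]
  simp only [inner_add_left, inner_add_right, real_inner_smul_left, real_inner_smul_right,
    real_inner_comm (e₁ (p.1, p.2)) (e₂ (p.1, p.2)), h.inner_e₁, h.inner_e₂, h.inner_e₁_e₂,
    chebyshevForm]
  linear_combination a.2 * b.2 * Real.sin_sq_add_cos_sq (f (p.1 * p.2))

namespace IsDevelopingFrame

variable {c : ℝ} {f : ℝ → ℝ} {X e₁ e₂ : ℝ × ℝ → E3} (h : IsDevelopingFrame c f X e₁ e₂)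
  (hf : IsAmslerProfile c f) {M : ℝ}

include h in
theorem smooth_poincareProj : ContDiff ℝ ∞ fun p => poincareProj (X p) := by
  have hX : ∀ i, ContDiff ℝ ∞ fun p => X p i := contDiff_euclidean.1 h.smooth_X
  have h0 : ∀ p, 1 + X p 0 ≠ 0 := fun p => by linarith [h.one_le_X p]
  refine contDiff_euclidean.2 fun i => ?_
  fin_cases i
  · exact (hX 1).div (contDiff_const.add (hX 0)) h0
  · exact (hX 2).div (contDiff_const.add (hX 0)) h0

include h in
theorem norm_sq_poincareProj (p : ℝ × ℝ) : 1 - ‖poincareProj (X p)‖ ^ 2 = 2 / (1 + X p 0) := by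
  have h0 : 1 + X p 0 ≠ 0 := by linarith [h.one_le_X p]
  have h1 := h.inner_X p
  rw [norm_sq_E2]
  simp only [poincareProj]
  simp
  field_simp
  linear_combination h1

include h in
theorem fderiv_poincareProj (p k : ℝ × ℝ) (i : Fin 2) :
    fderiv ℝ (fun p => poincareProj (X p)) p k i =
      (fderiv ℝ X p k i.succ * (1 + X p 0) - X p i.succ * fderiv ℝ X p k 0) / (1 + X p 0) ^ 2 := by
  have h0 : 1 + X p 0 ≠ 0 := by linarith [h.one_le_X p]
  have hX := HasDerivAt.line (h.smooth_X.differentiable (by simp)) p k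
  have hP := (HasDerivAt.line (h.smooth_poincareProj.differentiable (by simp)) p
    k).euclidean_apply i
  have hQ := (hX.euclidean_apply i.succ).div ((hX.euclidean_apply 0).const_add 1)
    (by simpa using h0)
  simp only [zero_smul, add_zero] at hQ
  refine hP.unique (hQ.congr_of_eventuallyEq (.of_forall fun t => ?_))
  fin_cases i <;> simp [poincareProj]

include h in
/-- The developing map pulls the Poincaré metric back to the Chebyshev metric. -/
theorem hypMetric_fderiv (p a b : ℝ × ℝ) :
    hypMetric (poincareProj (X p)) (fderiv ℝ (fun p => poincareProj (X p)) p a)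
      (fderiv ℝ (fun p => poincareProj (X p)) p b) = chebyshevForm (f (p.1 * p.2)) a b := by
  have h0 : 1 + X p 0 ≠ 0 := by linarith [h.one_le_X p]
  have hd := h.smooth_X.differentiable (by simp)
  have h1 := h.inner_X p
  have h2 := h.inner_X_e₁ p
  have h3 := h.inner_X_e₂ p
  have h4 := h.inner_e₁ p
  have h5 := h.inner_e₂ p
  have h6 := h.inner_e₁_e₂ p
  have h7 := Real.sin_sq_add_cos_sq (f (p.1 * p.2))
  have hval : ∀ (k : ℝ × ℝ) (i : Fin 3), fderiv ℝ X p k i = (k.1 + Real.cos (f (p.1 * p.2)) * k.2) *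
      e₁ p i + (Real.sin (f (p.1 * p.2)) * k.2) * e₂ p i := fun k i => by
    rw [fderiv_apply_of_partial hd (h.X_u p.1 p.2) (h.X_v p.1 p.2)]
    simp
    ring
  set C := Real.cos (f (p.1 * p.2))
  set S := Real.sin (f (p.1 * p.2))
  have hXx : ∀ k, X p 1 * fderiv ℝ X p k 1 + X p 2 * fderiv ℝ X p k 2 =
      X p 0 * fderiv ℝ X p k 0 := fun k => by
    rw [hval, hval, hval]
    linear_combination (k.1 + C * k.2) * h2 + (S * k.2) * h3
  have hxy : fderiv ℝ X p a 1 * fderiv ℝ X p b 1 + fderiv ℝ X p a 2 * fderiv ℝ X p b 2 -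
      fderiv ℝ X p a 0 * fderiv ℝ X p b 0 = chebyshevForm (f (p.1 * p.2)) a b := by
    simp only [hval, chebyshevForm]
    linear_combination (a.1 + C * a.2) * (b.1 + C * b.2) * h4 + (S * a.2) * (S * b.2) * h5 +
      ((a.1 + C * a.2) * (S * b.2) + (S * a.2) * (b.1 + C * b.2)) * h6 + a.2 * b.2 * h7
  rw [← hxy, hypMetric, h.norm_sq_poincareProj, inner_E2]
  simp only [h.fderiv_poincareProj]
  simp only [Fin.isValue, Fin.succ_zero_eq_one, Fin.succ_one_eq_two]
  have ha := hXx a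
  have hb := hXx b
  generalize fderiv ℝ X p a = x at *
  generalize fderiv ℝ X p b = y at *
  field_simp
  linear_combination (-4 * (1 + X p 0) * y.ofLp 0) * ha - (4 * (1 + X p 0) * x.ofLp 0) * hb -
    4 * x.ofLp 0 * y.ofLp 0 * h1

include h in
theorem fderiv_poincareProj_injective {p : ℝ × ℝ} (hs : Real.sin (f (p.1 * p.2)) ≠ 0) :
    Function.Injective (fderiv ℝ (fun p => poincareProj (X p)) p) := by
  rw [injective_iff_map_eq_zero]
  intro k hk
  refine eq_zero_of_chebyshevForm_self hs ?_
  rw [← h.hypMetric_fderiv, hk]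
  simp [hypMetric]

include h in
theorem eq_of_poincareProj_eq {p q : ℝ × ℝ} (hpq : poincareProj (X p) = poincareProj (X q)) :
    X p = X q := by
  have hp := h.norm_sq_poincareProj p
  have hq := h.norm_sq_poincareProj q
  have hp0 := h.one_le_X p
  have hq0 := h.one_le_X q
  rw [hpq, hq] at hp
  have h0 : X p 0 = X q 0 := by
    field_simp at hp
    linarith
  have h1 := congrArg (fun x : E2 => x 0) hpq
  have h2 := congrArg (fun x : E2 => x 1) hpq
  have hne : 1 + X q 0 ≠ 0 := by linarith
  simp only [poincareProj, h0] at h1 h2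
  simp at h1 h2
  rw [div_left_inj' hne] at h1 h2
  ext i
  fin_cases i
  · exact h0
  · exact h1
  · exact h2

end IsDevelopingFrame

open Filter Topology in
/-- A right inverse with values in a compact set on which the map is injective is continuous. -/
theorem continuousOn_of_rightInverse {A B : Type*} [TopologicalSpace A] [TopologicalSpace B]
    [T2Space B] {F : A → B} {Y : B → A} {K : Set A} {W : Set B} (hK : IsCompact K)
    (hF : Continuous F) (hinj : InjOn F K) (hY : ∀ p ∈ W, Y p ∈ K) (hFY : ∀ p ∈ W, F (Y p) = p) :
    ContinuousOn Y W := by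
  intro p hp
  refine hK.tendsto_nhds_of_unique_mapClusterPt
    (eventually_mem_nhdsWithin.mono fun q hq => hY q hq) fun y hy hcl => ?_
  refine hinj hy (hY p hp) ?_
  rw [hFY p hp]
  have h1 : MapClusterPt (F y) (𝓝[W] p) (F ∘ Y) := hcl.tendsto_comp hF.continuousAt
  have h2 : Tendsto (F ∘ Y) (𝓝[W] p) (𝓝 p) :=
    (tendsto_id.mono_left nhdsWithin_le_nhds).congr'
      (eventually_mem_nhdsWithin.mono fun q hq => (hFY q hq).symm)
  have h3 : ClusterPt (F y) (𝓝 p) := ClusterPt.mono h1 h2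
  exact eq_of_nhds_neBot h3

theorem arsinh_mem_Icc {C s M : ℝ} (hs : 0 ≤ s) (hC0 : 0 ≤ C) (hCs : C ^ 2 = 1 + s ^ 2)
    (hCM : 8 * C ≤ M) : Real.arsinh s ∈ Icc 0 M := by
  have h0 := Real.arsinh_nonneg_iff.2 hs
  have h1 := Real.self_le_sinh_iff.2 h0
  rw [Real.sinh_arsinh] at h1
  exact ⟨h0, by nlinarith⟩

/-- The points of the sector `0 ≤ θ ≤ c` at Euclidean distance less than `ρ` from the center. -/
def sectorDisk (c ρ : ℝ) : Set E2 :=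
  {p | ‖p‖ < ρ ∧ ∃ s θ : ℝ, 0 ≤ s ∧ 0 ≤ θ ∧ θ ≤ c ∧ p = !₂[s * Real.cos θ, s * Real.sin θ]}

namespace IsDevelopingFrame

variable {c : ℝ} {f : ℝ → ℝ} {X e₁ e₂ : ℝ × ℝ → E3} (h : IsDevelopingFrame c f X e₁ e₂)
  (hf : IsAmslerProfile c f) {M : ℝ}

include h hf in
theorem exists_poincareProj_eq (hM : SmallAngle f M) {ρ : ℝ} (hρ1 : ρ < 1)
    (hρM : 8 * ((1 + ρ ^ 2) / (1 - ρ ^ 2)) ≤ M) {s θ : ℝ} (hs : 0 ≤ s) (hsρ : s ≤ ρ) (hθ0 : 0 ≤ θ)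
    (hθc : θ ≤ c) :
    ∃ q ∈ Icc 0 M ×ˢ Icc 0 M, poincareProj (X q) = !₂[s * Real.cos θ, s * Real.sin θ] ∧
      (θ = 0 → q.2 = 0) ∧ (θ = c → q.1 = 0) := by
  have hs1 : 0 < 1 - s ^ 2 := by nlinarith
  have hr1 : 0 < 1 - ρ ^ 2 := by nlinarith
  -- `C = cosh d` and `S = sinh d`, where `d` is the hyperbolic distance from the center
  set C := (1 + s ^ 2) / (1 - s ^ 2) with hC
  set S := 2 * s / (1 - s ^ 2) with hS
  have hS0 : 0 ≤ S := by positivity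
  have hC0 : 0 ≤ C := by positivity
  have hCS : C ^ 2 = 1 + S ^ 2 := by
    rw [hC, hS]; field_simp; ring
  have hCM : 8 * C ≤ M := by
    refine le_trans ?_ hρM
    have : C ≤ (1 + ρ ^ 2) / (1 - ρ ^ 2) := by
      rw [hC]
      gcongr
    linarith
  obtain ⟨u, hu, v, hv, he⟩ := h.exists_X_eq hf hM hS0 hC0 hCS hCM hθ0 hθc
  have har := arsinh_mem_Icc hS0 hC0 hCS hCM
  have hsinh : Real.sinh (Real.arsinh S) = S := Real.sinh_arsinh S
  have hcosh : Real.cosh (Real.arsinh S) = C := by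
    have h1 := Real.cosh_sq (Real.arsinh S)
    rw [hsinh] at h1
    have h2 := Real.cosh_pos (Real.arsinh S)
    nlinarith
  have hM0 : 0 ≤ M := by linarith
  refine ⟨(u, v), ⟨hu, hv⟩, ?_, fun h0 => ?_, fun hc => ?_⟩
  · rw [he]
    have h1 : 1 + C ≠ 0 := by positivity
    have h2 : S / (1 + C) = s := by
      rw [hC, hS]; field_simp; ring
    ext i
    fin_cases i
    · simp [poincareProj, mul_div_right_comm, h2]
    · simp [poincareProj, mul_div_right_comm, h2]
  · have hx : X (u, v) = X (Real.arsinh S, 0) := by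
      rw [he, (h.uAxis _).1, hsinh, hcosh, h0]; simp
    exact congrArg Prod.snd (h.injOn_X hf hM ⟨hu, hv⟩ ⟨har, le_rfl, hM0⟩ hx)
  · have hx : X (u, v) = X (0, Real.arsinh S) := by
      rw [he, (h.vAxis _).1, hsinh, hcosh, hc]
    exact congrArg Prod.fst (h.injOn_X hf hM ⟨hu, hv⟩ ⟨⟨le_rfl, hM0⟩, har⟩ hx)

include h hf in
open Filter Topology in
/-- The inverse of the developing map on a hyperbolic sector, smooth up to the bounding rays,
which it maps to the coordinate axes. -/
theorem exists_sector_chart (hM : SmallAngle f M) {ρ : ℝ} (hρ1 : ρ < 1)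
    (hρM : 8 * ((1 + ρ ^ 2) / (1 - ρ ^ 2)) ≤ M) (hWu : UniqueDiffOn ℝ (sectorDisk c ρ)) :
    ∃ Y : E2 → ℝ × ℝ, ContDiffOn ℝ ∞ Y (sectorDisk c ρ) ∧ ∀ p ∈ sectorDisk c ρ,
      Y p ∈ Icc 0 M ×ˢ Icc 0 M ∧ poincareProj (X (Y p)) = p ∧
      (∀ k, fderivWithin ℝ Y (sectorDisk c ρ) p
        (fderiv ℝ (fun q => poincareProj (X q)) (Y p) k) = k) ∧
      (∀ s : ℝ, 0 ≤ s → p = !₂[s * Real.cos 0, s * Real.sin 0] → (Y p).2 = 0) ∧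
      (∀ s : ℝ, 0 ≤ s → p = !₂[s * Real.cos c, s * Real.sin c] → (Y p).1 = 0) := by
  have hc0 : 0 ≤ c := by
    rw [← hf.init]; exact (hM 0 le_rfl (by positivity)).1.le
  have hex : ∀ p ∈ sectorDisk c ρ, ∃ q ∈ Icc 0 M ×ˢ Icc 0 M, poincareProj (X q) = p := by
    rintro p ⟨hp, s, θ, hs, hθ0, hθc, rfl⟩
    have hsρ : s ≤ ρ := by
      rw [norm_polar, abs_of_nonneg hs] at hp
      exact hp.le
    obtain ⟨q, hq, hq', -⟩ := h.exists_poincareProj_eq hf hM hρ1 hρM hs hsρ hθ0 hθc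
    exact ⟨q, hq, hq'⟩
  choose! Y hYK hY using hex
  have hinj : InjOn (fun q => poincareProj (X q)) (Icc 0 M ×ˢ Icc 0 M) := fun a ha b hb hab =>
    h.injOn_X hf hM ha hb (h.eq_of_poincareProj_eq hab)
  have hYc : ContinuousOn Y (sectorDisk c ρ) := continuousOn_of_rightInverse
    (isCompact_Icc.prod isCompact_Icc) h.smooth_poincareProj.continuous hinj hYK hY
  have hsin : ∀ p ∈ sectorDisk c ρ, Real.sin (f ((Y p).1 * (Y p).2)) ≠ 0 := fun p hp =>
    (hM.sin_pos (hYK p hp).1 (hYK p hp).2).ne'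
  -- near each point `Y` agrees with the local inverse of the developing map, which is defined on a
  -- full neighborhood
  have hYs : ContDiffOn ℝ ∞ Y (sectorDisk c ρ) := by
    intro p hp
    set D := fderiv ℝ (fun q => poincareProj (X q)) (Y p) with hD
    have hDi := h.fderiv_poincareProj_injective (hsin p hp)
    let e : (ℝ × ℝ) ≃L[ℝ] E2 := (LinearEquiv.ofInjectiveOfFinrankEq (D : ℝ × ℝ →ₗ[ℝ] E2) hDi
      (by simp)).toContinuousLinearEquiv
    have he : (e : ℝ × ℝ →L[ℝ] E2) = D := by
      ext x
      · rfl
      · rfl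
    have hD' : HasFDerivAt (fun q => poincareProj (X q)) (e : ℝ × ℝ →L[ℝ] E2) (Y p) := by
      rw [he]
      exact (h.smooth_poincareProj.differentiable (by simp) _).hasFDerivAt
    have hc := h.smooth_poincareProj.contDiffAt (x := Y p)
    have hli := hc.to_localInverse hD' (by simp)
    have hl := (hc.hasStrictFDerivAt' hD' (by simp)).eventually_left_inverse
    rw [hY p hp] at hli
    refine hli.contDiffWithinAt.congr_of_eventuallyEq ?_ ?_
    · filter_upwards [(hYc p hp).eventually hl, eventually_mem_nhdsWithin] with q hq hqW
      rw [hY q hqW] at hq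
      exact hq.symm
    · have := hl.self_of_nhds
      rw [hY p hp] at this
      exact this.symm
  refine ⟨Y, hYs, fun p hp =>
    ⟨hYK p hp, hY p hp, fun k => ?_, fun s hs he => ?_, fun s hs he => ?_⟩⟩
  · have hYd := (hYs.differentiableOn (by simp) p hp).hasFDerivWithinAt
    have hFd := (h.smooth_poincareProj.differentiable (by simp) (Y p)).hasFDerivAt
    have hcomp := hFd.comp_hasFDerivWithinAt p hYd
    have hid : HasFDerivWithinAt (fun q => poincareProj (X (Y q))) (ContinuousLinearMap.id ℝ E2)
        (sectorDisk c ρ) p :=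
      (hasFDerivWithinAt_id p _).congr (fun q hq => hY q hq) (hY p hp)
    have heq := (hWu p hp).eq hcomp hid
    refine h.fderiv_poincareProj_injective (hsin p hp) ?_
    exact congrArg (fun T : E2 →L[ℝ] E2 => T (fderiv ℝ (fun q => poincareProj (X q)) (Y p) k)) heq
  · have hsρ := hp.1
    rw [he, norm_polar, abs_of_nonneg hs] at hsρ
    obtain ⟨q, hq, hq', hq0, -⟩ := h.exists_poincareProj_eq hf hM hρ1 hρM hs hsρ.le le_rfl hc0
    rw [hinj (hYK p hp) hq ((hY p hp).trans (he.trans hq'.symm))]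
    exact hq0 rfl
  · have hsρ := hp.1
    rw [he, norm_polar, abs_of_nonneg hs] at hsρ
    obtain ⟨q, hq, hq', -, hq0⟩ := h.exists_poincareProj_eq hf hM hρ1 hρM hs hsρ.le hc0 le_rfl
    rw [hinj (hYK p hp) hq ((hY p hp).trans (he.trans hq'.symm))]
    exact hq0 rfl

end IsDevelopingFrame

/-! ### The periodic Amsler surface -/

/-- The Painlevé III transcendent `φ(z) = f(z² / 4)` with profile `f`. It is even, hence smooth with
vanishing derivative at `0`. -/
noncomputable def painleveOfProfile (f : ℝ → ℝ) (z : ℝ) : ℝ := f (z ^ 2 / 4)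

theorem IsAmslerProfile.isPainleveSolution {n : ℕ} {f : ℝ → ℝ}
    (hf : IsAmslerProfile (Real.pi / n) f) : IsPainleveSolution n (painleveOfProfile f) := by
  have hfd : ∀ t, HasDerivAt f (deriv f t) t := fun t =>
    (hf.smooth.differentiable (by simp) t).hasDerivAt
  have hf1 : ContDiff ℝ ∞ (deriv f) := (contDiff_infty_iff_deriv.1 hf.smooth).2
  have hf2d : ∀ t, HasDerivAt (deriv f) (deriv (deriv f) t) t := fun t =>
    (hf1.differentiable (by simp) t).hasDerivAt
  have hsq : ∀ z : ℝ, HasDerivAt (fun z : ℝ => z ^ 2 / 4) (z / 2) z := fun z =>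
    (((hasDerivAt_id z).pow 2).div_const 4).congr_deriv (by simp; ring)
  have h1 : ∀ z, HasDerivAt (painleveOfProfile f) (deriv f (z ^ 2 / 4) * (z / 2)) z := fun z =>
    (hfd _).comp z (hsq z)
  have h1' : deriv (painleveOfProfile f) = fun z => deriv f (z ^ 2 / 4) * (z / 2) :=
    funext fun z => (h1 z).deriv
  have h2 : ∀ z, HasDerivAt (deriv (painleveOfProfile f))
      (deriv (deriv f) (z ^ 2 / 4) * (z / 2) * (z / 2) + deriv f (z ^ 2 / 4) * (1 / 2)) z := by
    intro z
    rw [h1']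
    exact ((hf2d _).comp z (hsq z)).mul ((hasDerivAt_id z).div_const 2)
  refine ⟨by simp [painleveOfProfile, hf.init], ?_, ?_, fun z hz => ?_⟩
  · simpa using (h1 0).hasDerivWithinAt
  · have : ContDiff ℝ 2 (painleveOfProfile f) :=
      (contDiff_infty.1 hf.smooth 2).comp (by fun_prop)
    exact this.contDiffOn
  · rw [(h2 z).deriv, (h1 z).deriv, painleveOfProfile, ← hf.ode]
    field_simp
    ring

theorem genAngle_painleveOfProfile {f : ℝ → ℝ} {p : ℝ × ℝ} (h1 : 0 ≤ p.1) (h2 : 0 ≤ p.2) :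
    genAngle (painleveOfProfile f) p = f (p.1 * p.2) := by
  rw [genAngle, painleveOfProfile, mul_pow, Real.sq_sqrt (mul_nonneg h1 h2)]
  congr 1
  ring

/-- In the variable `t = z² / 4` the interval `0 ≤ z ≤ 2 √(u v)` is `0 ≤ t ≤ u v`. -/
theorem mem_amslerDomain_iff {f : ℝ → ℝ} {p : ℝ × ℝ} :
    p ∈ amslerDomain (painleveOfProfile f) ↔
      p ∈ Ici (0 : ℝ) ×ˢ Ici (0 : ℝ) ∧ ∀ s ∈ Icc (0 : ℝ) 1, f (s * (p.1 * p.2)) < Real.pi := by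
  simp only [amslerDomain, mem_ofPred_eq, mem_prod, mem_Ici, and_assoc]
  refine and_congr_right fun h1 => and_congr_right fun h2 => ?_
  have h12 := mul_nonneg h1 h2
  have hsq := Real.sq_sqrt h12
  constructor
  · intro h s hs
    have := h (2 * √(s * (p.1 * p.2))) ⟨by positivity,
      mul_le_mul_of_nonneg_left (Real.sqrt_le_sqrt (mul_le_of_le_one_left h12 hs.2)) two_pos.le⟩
    rw [painleveOfProfile, mul_pow, Real.sq_sqrt (mul_nonneg hs.1 h12)] at this
    convert this using 2
    ring
  · intro h z hz
    rw [painleveOfProfile]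
    have hz2 : z ^ 2 / 4 ≤ p.1 * p.2 := by
      have : z ^ 2 ≤ (2 * √(p.1 * p.2)) ^ 2 := by gcongr; exacts [hz.1, hz.2]
      rw [mul_pow, hsq] at this
      linarith
    rcases h12.eq_or_lt with h0 | h0
    · rw [← h0] at hz2
      have : z ^ 2 / 4 = 0 * (p.1 * p.2) := by rw [zero_mul]; exact le_antisymm hz2 (by positivity)
      rw [this]
      exact h 0 ⟨le_rfl, zero_le_one⟩
    · have := h (z ^ 2 / 4 / (p.1 * p.2)) ⟨by positivity, (div_le_one h0).2 hz2⟩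
      rwa [div_mul_cancel₀ _ h0.ne'] at this

open Filter Topology in
theorem uniqueDiffOn_amslerDomain {f : ℝ → ℝ} (hf : Continuous f) :
    UniqueDiffOn ℝ (amslerDomain (painleveOfProfile f)) := by
  have he : amslerDomain (painleveOfProfile f) = (Ici (0 : ℝ) ×ˢ Ici (0 : ℝ)) ∩
      {p | ∀ s ∈ Icc (0 : ℝ) 1, f (s * (p.1 * p.2)) < Real.pi} := by
    ext p
    exact mem_amslerDomain_iff
  rw [he]
  refine ((uniqueDiffOn_Ici 0).prod (uniqueDiffOn_Ici 0)).inter ?_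
  refine isOpen_iff_eventually.2 fun p hp => ?_
  refine isCompact_Icc.eventually_forall_of_forall_eventually fun s hs => ?_
  have hc : Continuous fun x : (ℝ × ℝ) × ℝ => f (x.2 * (x.1.1 * x.1.2)) := by fun_prop
  exact hc.continuousAt.eventually (gt_mem_nhds (hp s hs))

theorem IsAmslerFrame.isAmslerSector {n : ℕ} {f : ℝ → ℝ} {r e₁ e₂ N : ℝ × ℝ → E3}
    (h : IsAmslerFrame (Real.pi / n) f r e₁ e₂ N) (hf : IsAmslerProfile (Real.pi / n) f)
    (hn : 0 < n) : IsAmslerSector n (painleveOfProfile f) r := by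
  set Q := amslerDomain (painleveOfProfile f) with hQ
  have hQu : UniqueDiffOn ℝ Q := uniqueDiffOn_amslerDomain hf.smooth.continuous
  have hfd : ∀ t, HasDerivAt f (deriv f t) t := fun t =>
    (hf.smooth.differentiable (by simp) t).hasDerivAt
  have hang : ∀ p ∈ Q, genAngle (painleveOfProfile f) p = f (p.1 * p.2) := fun p hp =>
    genAngle_painleveOfProfile hp.1 hp.2.1
  have hsin : ∀ p ∈ Q, 0 < Real.sin (f (p.1 * p.2)) := by
    intro p hp
    obtain ⟨hp0, hp1⟩ := mem_amslerDomain_iff.1 hp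
    have h12 : 0 ≤ p.1 * p.2 := mul_nonneg hp0.1 hp0.2
    have hlt : ∀ s, 0 ≤ s → s ≤ p.1 * p.2 → f s < Real.pi := by
      intro s hs hsp
      rcases h12.eq_or_lt with h0 | h0
      · have := hp1 0 ⟨le_rfl, zero_le_one⟩
        rwa [zero_mul, ← le_antisymm (hsp.trans h0.symm.le) hs] at this
      · have := hp1 (s / (p.1 * p.2)) ⟨by positivity, (div_le_one h0).2 hsp⟩
        rwa [div_mul_cancel₀ _ h0.ne'] at this
    have hc : 0 < Real.pi / n := div_pos Real.pi_pos (by exact_mod_cast hn)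
    exact Real.sin_pos_of_pos_of_lt_pi (hf.pos hc hlt _ h12 le_rfl) (hlt _ h12 le_rfl)
  set rv : ℝ × ℝ → E3 := fun p =>
    Real.cos (f (p.1 * p.2)) • e₁ p + Real.sin (f (p.1 * p.2)) • e₂ p with hrv
  have hd := h.smooth_r.differentiable (by simp)
  have hd1 := h.smooth_e₁.differentiable (by simp)
  have hdv : Differentiable ℝ rv := by
    have h1 := h.smooth_e₁
    have h2 := h.smooth_e₂
    have h3 := hf.smooth
    have : ContDiff ℝ ∞ rv := by fun_prop
    exact this.differentiable (by simp)
  have pU : ∀ p ∈ Q, partialU Q r p = e₁ p := fun p hp => by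
    rw [partialU, (hd p).fderivWithin (hQu p hp),
      fderiv_apply_of_partial hd (h.r_u p.1 p.2) (h.r_v p.1 p.2)]
    simp
  have pV : ∀ p ∈ Q, partialV Q r p = rv p := fun p hp => by
    rw [partialV, (hd p).fderivWithin (hQu p hp),
      fderiv_apply_of_partial hd (h.r_u p.1 p.2) (h.r_v p.1 p.2)]
    simp [hrv]
  have hfu : ∀ u v, HasDerivAt (fun u => f (u * v)) (v * deriv f (u * v)) u := fun u v =>
    ((hfd (u * v)).comp u ((hasDerivAt_id u).mul_const v)).congr_deriv (by ring)
  have hfv : ∀ u v, HasDerivAt (fun v => f (u * v)) (u * deriv f (u * v)) v := fun u v =>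
    ((hfd (u * v)).comp v ((hasDerivAt_id v).const_mul u)).congr_deriv (by simp; ring)
  have dvu := fun u v => ((hfu u v).cos.smul (h.e₁_u u v)).add ((hfu u v).sin.smul (h.e₂_u u v))
  have dvv := fun u v => ((hfv u v).cos.smul (h.e₁_v u v)).add ((hfv u v).sin.smul (h.e₂_v u v))
  have hN : ∀ p ∈ Q, unitNormal Q r p = N p := by
    intro p hp
    have hs := hsin p hp
    have hcr : (WithLp.toLp 2 (crossProduct (e₁ p).ofLp (rv p).ofLp) : E3) =
        Real.sin (f (p.1 * p.2)) • N p := by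
      rw [← h.cross p, hrv]
      ext i
      fin_cases i <;> simp [cross_apply] <;> ring
    have hn1 : ‖N p‖ = 1 := by
      have := h.inner_N p
      rw [real_inner_self_eq_norm_sq] at this
      exact (sq_eq_sq₀ (norm_nonneg _) zero_le_one).1 (by rw [this, one_pow])
    simp only [unitNormal, pU p hp, pV p hp, hcr, norm_smul, hn1, mul_one, Real.norm_eq_abs,
      abs_of_pos hs, smul_smul, inv_mul_cancel₀ hs.ne', one_smul]
  refine ⟨h.smooth_r.contDiffOn, fun u _ => h.r_uAxis u, fun v _ => h.r_vAxis v,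
    fun p hp => ?_, fun p hp => ?_, fun p hp => ?_, fun p hp => ?_, fun p hp => ?_, fun p hp => ?_⟩
  · rw [pU p hp, h.inner_e₁]
  · rw [pU p hp, pV p hp, hang p hp, hrv]
    simp only [inner_add_right, real_inner_smul_right, h.inner_e₁, h.inner_e₁_e₂]
    ring
  · rw [pV p hp, hrv]
    simp only [inner_add_left, inner_add_right, real_inner_smul_left, real_inner_smul_right,
      real_inner_comm (e₁ p) (e₂ p), h.inner_e₁, h.inner_e₂, h.inner_e₁_e₂]
    linear_combination Real.sin_sq_add_cos_sq (f (p.1 * p.2))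
  · rw [hN p hp, partialU, fderivWithin_congr pU (pU p hp), (hd1 p).fderivWithin (hQu p hp),
      fderiv_apply_of_partial hd1 (h.e₁_u p.1 p.2) (h.e₁_v p.1 p.2)]
    simp [real_inner_smul_left, h.inner_e₂_N]
  · rw [hN p hp, hang p hp, partialU, fderivWithin_congr pV (pV p hp),
      (hdv p).fderivWithin (hQu p hp), fderiv_apply_of_partial hdv (dvu p.1 p.2) (dvv p.1 p.2)]
    simp only [inner_add_left, real_inner_smul_left, h.inner_e₂_N, h.inner_e₁_N, h.inner_N]
    ring
  · rw [hN p hp, partialV, fderivWithin_congr pV (pV p hp),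
      (hdv p).fderivWithin (hQu p hp), fderiv_apply_of_partial hdv (dvu p.1 p.2) (dvv p.1 p.2)]
    simp only [inner_add_left, real_inner_smul_left, h.inner_e₂_N, h.inner_e₁_N, h.inner_N]
    ring

/-! ### The isometric immersion of a sector -/

/-- The unit vector of polar angle `θ`. -/
noncomputable def planeDir (θ : ℝ) : E2 := !₂[Real.cos θ, Real.sin θ]

/-- The horizontal unit vector of polar angle `θ`. -/
noncomputable def spaceDir (θ : ℝ) : E3 := !₂[Real.cos θ, Real.sin θ, 0]

theorem polar_eq_smul_planeDir (s θ : ℝ) :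
    (!₂[s * Real.cos θ, s * Real.sin θ] : E2) = s • planeDir θ := by
  ext i; fin_cases i <;> simp [planeDir]

theorem norm_smul_planeDir (s θ : ℝ) : ‖s • planeDir θ‖ = |s| := by
  rw [← polar_eq_smul_planeDir, norm_polar]

theorem exists_polar (p : E2) : p = ‖p‖ • planeDir (Complex.arg ⟨p 0, p 1⟩) := by
  have h : ‖(⟨p 0, p 1⟩ : ℂ)‖ = ‖p‖ := by
    rw [← sq_eq_sq₀ (norm_nonneg _) (norm_nonneg _), norm_sq_E2, Complex.sq_norm,
      Complex.normSq_mk]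
    ring
  have h1 := Complex.norm_mul_cos_arg ⟨p 0, p 1⟩
  have h2 := Complex.norm_mul_sin_arg ⟨p 0, p 1⟩
  rw [h] at h1 h2
  ext i
  fin_cases i
  · simpa [planeDir] using h1.symm
  · simpa [planeDir] using h2.symm

/-- The closed sector `0 ≤ θ ≤ c` of the plane. -/
def sectorCone (c : ℝ) : Set E2 := {p | ∃ s θ : ℝ, 0 ≤ s ∧ 0 ≤ θ ∧ θ ≤ c ∧ p = s • planeDir θ}

theorem sectorDisk_eq_inter (c ρ : ℝ) : sectorDisk c ρ = Metric.ball 0 ρ ∩ sectorCone c := by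
  ext p
  simp only [sectorDisk, sectorCone, mem_ofPred_eq, polar_eq_smul_planeDir, mem_inter_iff,
    mem_ball_zero_iff]

theorem smul_planeDir_mem_sectorDisk {c ρ s θ : ℝ} (hs : 0 ≤ s) (hsρ : s < ρ) (h0 : 0 ≤ θ)
    (hc : θ ≤ c) : s • planeDir θ ∈ sectorDisk c ρ := by
  rw [sectorDisk_eq_inter]
  refine ⟨?_, s, θ, hs, h0, hc, rfl⟩
  rwa [mem_ball_zero_iff, norm_smul_planeDir, abs_of_nonneg hs]

/-- A sector of opening angle less than `π` is an intersection of two half-planes. -/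
theorem sectorCone_eq {c : ℝ} (hc0 : 0 < c) (hcπ : c < Real.pi) :
    sectorCone c = {p | 0 ≤ p 1 ∧ 0 ≤ Real.sin c * p 0 - Real.cos c * p 1} := by
  have e : ∀ s θ, Real.sin c * (s * Real.cos θ) - Real.cos c * (s * Real.sin θ) =
      s * Real.sin (c - θ) := fun s θ => by rw [Real.sin_sub]; ring
  ext p
  refine ⟨?_, fun ⟨h1, h2⟩ => ?_⟩
  · rintro ⟨s, θ, hs, h0, hc, rfl⟩
    simp only [planeDir, mem_ofPred_eq, PiLp.smul_apply, smul_eq_mul]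
    refine ⟨mul_nonneg hs (Real.sin_nonneg_of_nonneg_of_le_pi h0 (hc.trans hcπ.le)), ?_⟩
    refine (e s θ).symm ▸ mul_nonneg hs (Real.sin_nonneg_of_nonneg_of_le_pi ?_ ?_) <;> linarith
  · rcases eq_or_ne p 0 with rfl | hp
    · exact ⟨0, 0, le_rfl, le_rfl, hc0.le, by simp⟩
    have hn : 0 < ‖p‖ := norm_pos_iff.2 hp
    have hpol := exists_polar p
    have hπ := Complex.arg_le_pi ⟨p 0, p 1⟩
    set θ := Complex.arg ⟨p 0, p 1⟩ with hθ
    refine ⟨‖p‖, θ, hn.le, Complex.arg_nonneg_iff.2 h1, ?_, hpol⟩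
    by_contra! hlt
    have e0 : p 0 = ‖p‖ * Real.cos θ := by
      conv_lhs => rw [hpol]
      simp [planeDir]
    have e1 : p 1 = ‖p‖ * Real.sin θ := by
      conv_lhs => rw [hpol]
      simp [planeDir]
    have hs : Real.sin (c - θ) < 0 :=
      Real.sin_neg_of_neg_of_neg_pi_lt (by linarith) (by linarith)
    rw [e0, e1, e] at h2
    nlinarith

theorem convex_sectorCone {c : ℝ} (hc0 : 0 < c) (hcπ : c < Real.pi) : Convex ℝ (sectorCone c) := by
  rw [sectorCone_eq hc0 hcπ]
  intro p hp q hq a b ha hb _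
  have h1 : 0 ≤ a * p 1 + b * q 1 := add_nonneg (mul_nonneg ha hp.1) (mul_nonneg hb hq.1)
  have h2 : 0 ≤ a * (Real.sin c * p 0 - Real.cos c * p 1) +
      b * (Real.sin c * q 0 - Real.cos c * q 1) :=
    add_nonneg (mul_nonneg ha hp.2) (mul_nonneg hb hq.2)
  refine ⟨by simpa using h1, ?_⟩
  simp only [PiLp.add_apply, PiLp.smul_apply, smul_eq_mul]
  linarith

theorem isClosed_sectorCone {c : ℝ} (hc0 : 0 < c) (hcπ : c < Real.pi) :
    IsClosed (sectorCone c) := by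
  rw [sectorCone_eq hc0 hcπ]
  exact (isClosed_le (f := fun _ : E2 => (0 : ℝ)) (g := fun p => p 1)
    (by fun_prop) (by fun_prop)).inter (isClosed_le (f := fun _ : E2 => (0 : ℝ))
    (g := fun p => Real.sin c * p 0 - Real.cos c * p 1) (by fun_prop) (by fun_prop))

theorem convex_sectorDisk {c ρ : ℝ} (hc0 : 0 < c) (hcπ : c < Real.pi) :
    Convex ℝ (sectorDisk c ρ) := by
  rw [sectorDisk_eq_inter]
  exact (convex_ball _ _).inter (convex_sectorCone hc0 hcπ)

theorem uniqueDiffOn_sectorDisk {c ρ : ℝ} (hc0 : 0 < c) (hcπ : c < Real.pi) (hρ : 0 < ρ) :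
    UniqueDiffOn ℝ (sectorDisk c ρ) := by
  refine uniqueDiffOn_convex (convex_sectorDisk hc0 hcπ) ?_
  have hsub : Metric.ball 0 ρ ∩ {p : E2 | 0 < p 1 ∧ 0 < Real.sin c * p 0 - Real.cos c * p 1} ⊆
      sectorDisk c ρ := by
    rw [sectorDisk_eq_inter, sectorCone_eq hc0 hcπ]
    exact inter_subset_inter_right _ fun p hp => ⟨hp.1.le, hp.2.le⟩
  have ho : IsOpen (Metric.ball 0 ρ ∩
      {p : E2 | 0 < p 1 ∧ 0 < Real.sin c * p 0 - Real.cos c * p 1}) :=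
    Metric.isOpen_ball.inter ((isOpen_lt (f := fun _ : E2 => (0 : ℝ)) (g := fun p => p 1)
      (by fun_prop) (by fun_prop)).inter (isOpen_lt (f := fun _ : E2 => (0 : ℝ))
      (g := fun p => Real.sin c * p 0 - Real.cos c * p 1) (by fun_prop) (by fun_prop)))
  refine ⟨(ρ / 2) • planeDir (c / 2), interior_maximal hsub ho ⟨?_, ?_, ?_⟩⟩
  · rw [mem_ball_zero_iff, norm_smul_planeDir, abs_of_pos (by positivity)]
    linarith
  · have := Real.sin_pos_of_pos_of_lt_pi (x := c / 2) (by linarith) (by linarith)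
    simp only [planeDir, PiLp.smul_apply, smul_eq_mul]
    exact mul_pos (by positivity) this
  · have e : Real.sin c * (ρ / 2 * Real.cos (c / 2)) - Real.cos c * (ρ / 2 * Real.sin (c / 2)) =
        ρ / 2 * Real.sin (c - c / 2) := by rw [Real.sin_sub]; ring
    have := Real.sin_pos_of_pos_of_lt_pi (x := c - c / 2) (by linarith) (by linarith)
    simp only [planeDir, PiLp.smul_apply, smul_eq_mul]
    exact e.symm ▸ mul_pos (by positivity) this

/-- `x` is an isometric immersion of the sector `0 ≤ θ ≤ c` of the Poincaré disk of Euclidean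
radius `ρ` into `P`, smooth up to the bounding rays, with differential `T`. It maps the bounding
rays to the horizontal rays of the same polar angle, and there its differential respects the
splitting into the direction of the ray and the orthogonal directions. -/
structure IsSectorImmersion (c ρ : ℝ) (P : Set E3) (x : E2 → E3) (T : E2 → E2 →L[ℝ] E3) :
    Prop where
  smooth : ContDiffOn ℝ ∞ x (sectorDisk c ρ)
  smooth_differential : ContDiffOn ℝ ∞ T (sectorDisk c ρ)
  hasFDerivWithinAt : ∀ p ∈ sectorDisk c ρ, HasFDerivWithinAt x (T p) (sectorDisk c ρ) p
  isometric : ∀ p ∈ sectorDisk c ρ, ∀ a b, inner ℝ (T p a) (T p b) = hypMetric p a b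
  mapsTo : MapsTo x (sectorDisk c ρ) P
  map_zero : x 0 = 0
  ray : ∀ ψ, ψ = 0 ∨ ψ = c → ∀ s, 0 ≤ s → s < ρ → ∃ l μ α γ : ℝ,
    x (s • planeDir ψ) = l • spaceDir ψ ∧ T (s • planeDir ψ) (planeDir ψ) = μ • spaceDir ψ ∧
    T (s • planeDir ψ) (planeDir (ψ + Real.pi / 2)) =
      α • spaceDir (ψ + Real.pi / 2) + γ • !₂[0, 0, 1]

theorem inner_planeDir_orthogonal (ψ : ℝ) :
    inner ℝ (planeDir ψ) (planeDir (ψ + Real.pi / 2)) = 0 := by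
  rw [inner_E2]
  simp [planeDir, Real.cos_add_pi_div_two, Real.sin_add_pi_div_two]
  ring

theorem exists_eq_of_inner_spaceDir {ψ : ℝ} {w : E3} (hw : inner ℝ (spaceDir ψ) w = 0) :
    ∃ α γ : ℝ, w = α • spaceDir (ψ + Real.pi / 2) + γ • !₂[0, 0, 1] := by
  rw [inner_E3] at hw
  simp [spaceDir] at hw
  have h1 := Real.sin_sq_add_cos_sq ψ
  refine ⟨Real.cos ψ * w 1 - Real.sin ψ * w 0, w 2, ?_⟩
  ext i
  fin_cases i
  · simp [spaceDir, Real.cos_add_pi_div_two]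
    linear_combination (-w 0) * h1 + Real.cos ψ * hw
  · simp [spaceDir, Real.sin_add_pi_div_two]
    linear_combination (-w 1) * h1 + Real.sin ψ * hw
  · simp [spaceDir]

namespace IsDevelopingFrame

variable {c : ℝ} {f : ℝ → ℝ} {X e₁ e₂ : ℝ × ℝ → E3} (h : IsDevelopingFrame c f X e₁ e₂)

include h in
theorem fderiv_poincareProj_uAxis (u : ℝ) :
    fderiv ℝ (fun q => poincareProj (X q)) (u, 0) (1, 0) = (1 + Real.cosh u)⁻¹ • planeDir 0 := by
  have h0 : 1 + Real.cosh u ≠ 0 := by linarith [Real.one_le_cosh u]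
  have hX : fderiv ℝ X (u, 0) (1, 0) = e₁ (u, 0) := by
    rw [fderiv_apply_of_partial (h.smooth_X.differentiable (by simp)) (h.X_u u 0) (h.X_v u 0)]
    simp
  ext i
  rw [h.fderiv_poincareProj, hX, (h.uAxis u).1, (h.uAxis u).2.1]
  have := Real.cosh_sq u
  fin_cases i
  · simp [planeDir]
    field_simp
    linear_combination this
  · simp [planeDir]

include h in
theorem fderiv_poincareProj_vAxis (hf : f 0 = c) (v : ℝ) :
    fderiv ℝ (fun q => poincareProj (X q)) (0, v) (0, 1) = (1 + Real.cosh v)⁻¹ • planeDir c := by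
  have h0 : 1 + Real.cosh v ≠ 0 := by linarith [Real.one_le_cosh v]
  have hX : fderiv ℝ X (0, v) (0, 1) =
      !₂[Real.sinh v, Real.cosh v * Real.cos c, Real.cosh v * Real.sin c] := by
    rw [fderiv_apply_of_partial (h.smooth_X.differentiable (by simp)) (h.X_u 0 v) (h.X_v 0 v),
      ← (h.vAxis v).2.1]
    simp [hf]
  ext i
  rw [h.fderiv_poincareProj, hX, (h.vAxis v).1]
  have := Real.cosh_sq v
  fin_cases i
  · simp [planeDir]
    field_simp
    linear_combination Real.cos c * this
  · simp [planeDir]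
    field_simp
    linear_combination Real.sin c * this

end IsDevelopingFrame

/-- The immersion is `r ∘ Y`, where `Y` is the inverse of the developing map. -/
theorem exists_isSectorImmersion {c : ℝ} {f : ℝ → ℝ} {r e₁ e₂ N : ℝ × ℝ → E3}
    (hr : IsAmslerFrame c f r e₁ e₂ N) (hf : IsAmslerProfile c f) (hc0 : 0 < c) (hcπ : c < Real.pi)
    {M : ℝ} (hM : SmallAngle f M) {ρ : ℝ} (hρ0 : 0 < ρ) (hρ1 : ρ < 1)
    (hρM : 8 * ((1 + ρ ^ 2) / (1 - ρ ^ 2)) ≤ M) :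
    ∃ x T, IsSectorImmersion c ρ (r '' (Icc 0 M ×ˢ Icc 0 M)) x T := by
  obtain ⟨X, E₁, E₂, h⟩ := exists_isDevelopingFrame hf
  have hWu := uniqueDiffOn_sectorDisk hc0 hcπ hρ0
  obtain ⟨Y, hY, hYp⟩ := h.exists_sector_chart hf hM hρ1 hρM hWu
  set W := sectorDisk c ρ with hW
  have hrd := hr.smooth_r.differentiable (by simp)
  have hx : ContDiffOn ℝ ∞ (fun p => r (Y p)) W := hr.smooth_r.comp_contDiffOn hY
  have hxT : ∀ p ∈ W, ∀ a, fderivWithin ℝ (fun p => r (Y p)) W p a =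
      fderiv ℝ r (Y p) (fderivWithin ℝ Y W p a) := fun p hp a => by
    have := (hrd (Y p)).hasFDerivAt.comp_hasFDerivWithinAt p
      (hY.differentiableOn (by simp) p hp).hasFDerivWithinAt
    rw [show (fun p => r (Y p)) = r ∘ Y from rfl, this.fderivWithin (hWu p hp)]
    rfl
  have hsurj : ∀ p ∈ W, ∀ a, fderiv ℝ (fun q => poincareProj (X q)) (Y p)
      (fderivWithin ℝ Y W p a) = a := fun p hp a => by
    have hinj : Function.Injective (fderiv ℝ (fun q => poincareProj (X q)) (Y p)) :=
      fun k l hkl => by rw [← (hYp p hp).2.2.1 k, ← (hYp p hp).2.2.1 l, hkl]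
    obtain ⟨k, rfl⟩ := (LinearMap.injective_iff_surjective_of_finrank_eq_finrank
      (f := (fderiv ℝ (fun q => poincareProj (X q)) (Y p) : ℝ × ℝ →ₗ[ℝ] E2)) (by simp)).1 hinj a
    exact congrArg _ ((hYp p hp).2.2.1 k)
  have hiso : ∀ p ∈ W, ∀ a b, inner ℝ (fderivWithin ℝ (fun p => r (Y p)) W p a)
      (fderivWithin ℝ (fun p => r (Y p)) W p b) = hypMetric p a b := fun p hp a b => by
    rw [hxT p hp, hxT p hp, hr.inner_fderiv, ← h.hypMetric_fderiv, hsurj p hp, hsurj p hp,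
      (hYp p hp).2.1]
  -- along a bounding ray, isometry and the image of the ray determine the form of the differential
  have hray : ∀ ψ, ∀ p ∈ W, ∀ l μ : ℝ, μ ≠ 0 → r (Y p) = l • spaceDir ψ →
      fderivWithin ℝ (fun p => r (Y p)) W p (planeDir ψ) = μ • spaceDir ψ → ∃ l μ α γ : ℝ,
      r (Y p) = l • spaceDir ψ ∧
      fderivWithin ℝ (fun p => r (Y p)) W p (planeDir ψ) = μ • spaceDir ψ ∧
      fderivWithin ℝ (fun p => r (Y p)) W p (planeDir (ψ + Real.pi / 2)) =
        α • spaceDir (ψ + Real.pi / 2) + γ • !₂[0, 0, 1] := by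
    intro ψ p hp l μ hμ h1 h2
    have h3 := hiso p hp (planeDir ψ) (planeDir (ψ + Real.pi / 2))
    rw [h2, hypMetric, inner_planeDir_orthogonal, mul_zero, real_inner_smul_left] at h3
    obtain ⟨α, γ, h4⟩ := exists_eq_of_inner_spaceDir ((mul_eq_zero.1 h3).resolve_left hμ)
    exact ⟨l, μ, α, γ, h1, h2, h4⟩
  refine ⟨fun p => r (Y p), fderivWithin ℝ (fun p => r (Y p)) W, hx,
    hx.fderivWithin hWu (by simp), fun p hp =>
      (hx.differentiableOn (by simp) p hp).hasFDerivWithinAt, hiso, fun p hp =>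
      ⟨Y p, (hYp p hp).1, rfl⟩, ?_, ?_⟩
  · have h0 : (0 : E2) ∈ W := by
      simpa using smul_planeDir_mem_sectorDisk le_rfl hρ0 le_rfl hc0.le
    have hz : ∀ θ : ℝ, (0 : E2) = !₂[0 * Real.cos θ, 0 * Real.sin θ] := fun θ => by
      rw [polar_eq_smul_planeDir, zero_smul]
    have : Y 0 = ((Y 0).1, 0) :=
      Prod.ext rfl ((hYp 0 h0).2.2.2.1 0 le_rfl (hz 0))
    rw [this, (hYp 0 h0).2.2.2.2 0 le_rfl (hz c), hr.r_uAxis, zero_smul]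
  · rintro ψ (rfl | rfl) s hs hsρ
    · have hp := smul_planeDir_mem_sectorDisk hs hsρ le_rfl hc0.le
      have hv := (hYp _ hp).2.2.2.1 s hs (polar_eq_smul_planeDir _ _).symm
      obtain ⟨u, hu⟩ : ∃ u, Y (s • planeDir 0) = (u, 0) := ⟨_, Prod.ext rfl hv⟩
      have h0 : 1 + Real.cosh u ≠ 0 := by linarith [Real.one_le_cosh u]
      refine hray 0 _ hp u (1 + Real.cosh u) h0 ?_ ?_
      · rw [hu, hr.r_uAxis]
        simp [spaceDir]
      · have hk := (hYp _ hp).2.2.1 (1, 0)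
        rw [hu, h.fderiv_poincareProj_uAxis, map_smul, inv_smul_eq_iff₀ h0] at hk
        rw [hxT _ hp, hk, map_smul, hu]
        congr 1
        have hd : HasDerivAt (fun u => r (u, 0)) (spaceDir 0) u := by
          have := (hasDerivAt_id u).smul_const (spaceDir 0)
          rw [one_smul] at this
          refine this.congr_of_eventuallyEq (.of_forall fun t => ?_)
          simp [hr.r_uAxis, spaceDir]
        rw [fderiv_apply_of_partial hrd (hr.r_u u 0) (hr.r_v u 0), ← hd.unique (hr.r_u u 0)]
        simp
    · have hp := smul_planeDir_mem_sectorDisk hs hsρ hc0.le le_rfl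
      have hv := (hYp _ hp).2.2.2.2 s hs (polar_eq_smul_planeDir _ _).symm
      obtain ⟨v, hv⟩ : ∃ v, Y (s • planeDir ψ) = (0, v) := ⟨_, Prod.ext hv rfl⟩
      have h0 : 1 + Real.cosh v ≠ 0 := by linarith [Real.one_le_cosh v]
      refine hray ψ _ hp v (1 + Real.cosh v) h0 ?_ ?_
      · rw [hv, hr.r_vAxis]
        rfl
      · have hk := (hYp _ hp).2.2.1 (0, 1)
        rw [hv, h.fderiv_poincareProj_vAxis hf.init, map_smul, inv_smul_eq_iff₀ h0] at hk
        rw [hxT _ hp, hk, map_smul, hv]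
        congr 1
        have hd : HasDerivAt (fun v => r (0, v)) (spaceDir ψ) v := by
          have := (hasDerivAt_id v).smul_const (spaceDir ψ)
          rw [one_smul] at this
          refine this.congr_of_eventuallyEq (.of_forall fun t => ?_)
          simp [hr.r_vAxis, spaceDir]
        rw [fderiv_apply_of_partial hrd (hr.r_u 0 v) (hr.r_v 0 v), ← hd.unique (hr.r_v 0 v)]
        simp

/-! ### Rigid motions of the pieces -/

/-- The orthogonal map of the plane taking the direction of polar angle `θ` to `a + ε θ`:
a rotation for `ε = 1`, a reflection for `ε = -1`. -/
noncomputable def planeMotion (a ε : ℝ) : E2 →L[ℝ] E2 := LinearMap.toContinuousLinearMap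
  { toFun := fun p => !₂[Real.cos a * p 0 - ε * Real.sin a * p 1,
      Real.sin a * p 0 + ε * Real.cos a * p 1]
    map_add' := fun p q => by ext i; fin_cases i <;> simp <;> ring
    map_smul' := fun t p => by ext i; fin_cases i <;> simp <;> ring }

/-- The orientation-preserving motion of space that extends `planeMotion a ε`. -/
noncomputable def spaceMotion (a ε : ℝ) : E3 →L[ℝ] E3 := LinearMap.toContinuousLinearMap
  { toFun := fun p => !₂[Real.cos a * p 0 - ε * Real.sin a * p 1,
      Real.sin a * p 0 + ε * Real.cos a * p 1, ε * p 2]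
    map_add' := fun p q => by ext i; fin_cases i <;> simp <;> ring
    map_smul' := fun t p => by ext i; fin_cases i <;> simp <;> ring }

theorem planeMotion_apply (a ε : ℝ) (p : E2) : planeMotion a ε p =
    !₂[Real.cos a * p 0 - ε * Real.sin a * p 1, Real.sin a * p 0 + ε * Real.cos a * p 1] := rfl

theorem spaceMotion_apply (a ε : ℝ) (p : E3) : spaceMotion a ε p =
    !₂[Real.cos a * p 0 - ε * Real.sin a * p 1, Real.sin a * p 0 + ε * Real.cos a * p 1,
      ε * p 2] := rfl

theorem spaceMotion_one (a : ℝ) (p : E3) : spaceMotion a 1 p = rotZ a p := by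
  simp [spaceMotion_apply, rotZ]

theorem spaceMotion_neg_one (a : ℝ) (p : E3) : spaceMotion a (-1) p = rotZ a (halfTurnX p) := by
  simp [spaceMotion_apply, rotZ, halfTurnX]

theorem spaceMotion_add_two_pi (a ε : ℝ) : spaceMotion (a + 2 * Real.pi) ε = spaceMotion a ε := by
  ext p i; simp [spaceMotion_apply]

theorem spaceMotion_vertical (a ε : ℝ) : spaceMotion a ε !₂[0, 0, 1] = ε • !₂[0, 0, 1] := by
  ext i
  fin_cases i <;> simp [spaceMotion_apply]

section

variable {ε : ℝ} (hε : ε = 1 ∨ ε = -1)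
include hε

theorem planeMotion_planeDir (a θ : ℝ) : planeMotion a ε (planeDir θ) = planeDir (a + ε * θ) := by
  ext i
  rcases hε with rfl | rfl <;> fin_cases i <;>
    simp [planeMotion_apply, planeDir, Real.cos_add, Real.sin_add]

theorem planeMotion_planeDir_orthogonal (a ψ : ℝ) :
    planeMotion a ε (planeDir (ψ + Real.pi / 2)) = ε • planeDir (a + ε * ψ + Real.pi / 2) := by
  ext i
  rcases hε with rfl | rfl <;> fin_cases i <;>
    simp [planeMotion_apply, planeDir, Real.cos_add, Real.sin_add] <;> ring

theorem spaceMotion_spaceDir (a θ : ℝ) : spaceMotion a ε (spaceDir θ) = spaceDir (a + ε * θ) := by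
  ext i
  rcases hε with rfl | rfl <;> fin_cases i <;>
    simp [spaceMotion_apply, spaceDir, Real.cos_add, Real.sin_add]

theorem spaceMotion_spaceDir_orthogonal (a ψ : ℝ) :
    spaceMotion a ε (spaceDir (ψ + Real.pi / 2)) = ε • spaceDir (a + ε * ψ + Real.pi / 2) := by
  ext i
  rcases hε with rfl | rfl <;> fin_cases i <;>
    simp [spaceMotion_apply, spaceDir, Real.cos_add, Real.sin_add] <;> ring

theorem inner_planeMotion (a : ℝ) (p q : E2) :
    inner ℝ (planeMotion a ε p) (planeMotion a ε q) = inner ℝ p q := by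
  have h := Real.sin_sq_add_cos_sq a
  rw [inner_E2, inner_E2]
  rcases hε with rfl | rfl <;> simp [planeMotion_apply] <;>
    linear_combination (p 0 * q 0 + p 1 * q 1) * h

theorem norm_planeMotion (a : ℝ) (p : E2) : ‖planeMotion a ε p‖ = ‖p‖ := by
  rw [← sq_eq_sq₀ (norm_nonneg _) (norm_nonneg _), ← real_inner_self_eq_norm_sq,
    inner_planeMotion hε, real_inner_self_eq_norm_sq]

theorem inner_spaceMotion (a : ℝ) (p q : E3) :
    inner ℝ (spaceMotion a ε p) (spaceMotion a ε q) = inner ℝ p q := by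
  have h := Real.sin_sq_add_cos_sq a
  rw [inner_E3, inner_E3]
  rcases hε with rfl | rfl <;> simp [spaceMotion_apply] <;>
    linear_combination (p 0 * q 0 + p 1 * q 1) * h

theorem planeMotion_neg_planeDir (a ψ : ℝ) :
    planeMotion (-(ε * a)) ε (planeDir (a + ε * ψ)) = planeDir ψ := by
  rw [planeMotion_planeDir hε]
  congr 1
  rcases hε with rfl | rfl <;> ring

theorem planeMotion_planeMotion_neg (a : ℝ) (p : E2) :
    planeMotion a ε (planeMotion (-(ε * a)) ε p) = p := by
  have h := Real.sin_sq_add_cos_sq a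
  ext i
  rcases hε with rfl | rfl <;> fin_cases i <;> simp [planeMotion_apply]
  · linear_combination p 0 * h
  · linear_combination p 1 * h
  · linear_combination p 0 * h
  · linear_combination p 1 * h

end

/-- A linear map on the plane is determined by its values on an orthonormal frame. -/
theorem ext_planeDir {A B : E2 →L[ℝ] E3} (β : ℝ) (h1 : A (planeDir β) = B (planeDir β))
    (h2 : A (planeDir (β + Real.pi / 2)) = B (planeDir (β + Real.pi / 2))) : A = B := by
  ext1 p
  have hp : p = (p 0 * Real.cos β + p 1 * Real.sin β) • planeDir β +
      (p 1 * Real.cos β - p 0 * Real.sin β) • planeDir (β + Real.pi / 2) := by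
    have h := Real.sin_sq_add_cos_sq β
    ext i
    fin_cases i <;> simp [planeDir, Real.cos_add_pi_div_two, Real.sin_add_pi_div_two]
    · linear_combination (-p 0) * h
    · linear_combination (-p 1) * h
  rw [hp, map_add, map_add, map_smul, map_smul, map_smul, map_smul, h1, h2]

/-- The image of the map `x` under a motion of the plane and the corresponding one of space. -/
noncomputable def movedMap (a ε : ℝ) (x : E2 → E3) (p : E2) : E3 :=
  spaceMotion a ε (x (planeMotion (-(ε * a)) ε p))

/-- The differential of `movedMap a ε x`, where `T` is that of `x`. -/
noncomputable def movedDifferential (a ε : ℝ) (T : E2 → E2 →L[ℝ] E3) (p : E2) : E2 →L[ℝ] E3 :=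
  (spaceMotion a ε).comp ((T (planeMotion (-(ε * a)) ε p)).comp (planeMotion (-(ε * a)) ε))

namespace IsSectorImmersion

variable {c ρ : ℝ} {P : Set E3} {x : E2 → E3} {T : E2 → E2 →L[ℝ] E3}
  (h : IsSectorImmersion c ρ P x T)
include h

/-- Two images of the sector agree to first order along a common image of a bounding ray, also
when one is a reflected image and the other is not. -/
theorem moved_eq {ψ : ℝ} (hψ : ψ = 0 ∨ ψ = c) {s : ℝ} (hs : 0 ≤ s) (hsρ : s < ρ) {a ε a' ε' β : ℝ}
    (hε : ε = 1 ∨ ε = -1) (hε' : ε' = 1 ∨ ε' = -1) (hβ : a + ε * ψ = β) (hβ' : a' + ε' * ψ = β) :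
    movedMap a ε x (s • planeDir β) = movedMap a' ε' x (s • planeDir β) ∧
      movedDifferential a ε T (s • planeDir β) = movedDifferential a' ε' T (s • planeDir β) := by
  obtain ⟨l, μ, α, γ, hl, hμ, hα⟩ := h.ray ψ hψ s hs hsρ
  -- the values on the ray do not depend on the sign: a reflection changes the signs of both the
  -- orthogonal direction and its image
  have key : ∀ a ε : ℝ, (ε = 1 ∨ ε = -1) → a + ε * ψ = β →
      movedMap a ε x (s • planeDir β) = l • spaceDir β ∧
      movedDifferential a ε T (s • planeDir β) (planeDir β) = μ • spaceDir β ∧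
      movedDifferential a ε T (s • planeDir β) (planeDir (β + Real.pi / 2)) =
        α • spaceDir (β + Real.pi / 2) + γ • !₂[0, 0, 1] := by
    intro a ε hε hβ
    have hεε : ε * ε = 1 := by rcases hε with rfl | rfl <;> ring
    have e1 : planeMotion (-(ε * a)) ε (planeDir β) = planeDir ψ := by
      rw [← hβ, planeMotion_neg_planeDir hε]
    have e2 : planeMotion (-(ε * a)) ε (planeDir (β + Real.pi / 2)) =
        ε • planeDir (ψ + Real.pi / 2) := by
      rw [planeMotion_planeDir_orthogonal hε, ← hβ]
      congr 3
      linear_combination ψ * hεε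
    simp only [movedMap, movedDifferential, ContinuousLinearMap.comp_apply, map_smul, e1, e2, hl,
      hμ, hα, map_add]
    rw [spaceMotion_spaceDir hε, spaceMotion_spaceDir_orthogonal hε, spaceMotion_vertical, hβ]
    refine ⟨rfl, rfl, ?_⟩
    rw [smul_add, smul_comm α ε, smul_smul ε ε, smul_comm γ ε, smul_smul ε ε, hεε, one_smul,
      one_smul]
  obtain ⟨k1, k2, k3⟩ := key a ε hε hβ
  obtain ⟨k1', k2', k3'⟩ := key a' ε' hε' hβ'
  exact ⟨k1.trans k1'.symm, ext_planeDir β (k2.trans k2'.symm) (k3.trans k3'.symm)⟩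

section

variable {a ε : ℝ} {A : Set E2} (hA : MapsTo (planeMotion (-(ε * a)) ε) A (sectorDisk c ρ))
include hA

theorem contDiffOn_movedMap : ContDiffOn ℝ ∞ (movedMap a ε x) A :=
  (spaceMotion a ε).contDiff.comp_contDiffOn
    (h.smooth.comp (planeMotion (-(ε * a)) ε).contDiff.contDiffOn hA)

theorem contDiffOn_movedDifferential : ContDiffOn ℝ ∞ (movedDifferential a ε T) A :=
  contDiffOn_const.clm_comp ((h.smooth_differential.comp
    (planeMotion (-(ε * a)) ε).contDiff.contDiffOn hA).clm_comp contDiffOn_const)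

theorem hasFDerivWithinAt_movedMap {p : E2} (hp : p ∈ A) :
    HasFDerivWithinAt (movedMap a ε x) (movedDifferential a ε T p) A p :=
  (spaceMotion a ε).hasFDerivAt.comp_hasFDerivWithinAt p
    ((h.hasFDerivWithinAt _ (hA hp)).comp p
      (planeMotion (-(ε * a)) ε).hasFDerivAt.hasFDerivWithinAt hA)

theorem inner_movedDifferential (hε : ε = 1 ∨ ε = -1) {p : E2} (hp : p ∈ A) (v w : E2) :
    inner ℝ (movedDifferential a ε T p v) (movedDifferential a ε T p w) = hypMetric p v w := by
  simp only [movedDifferential, ContinuousLinearMap.comp_apply, inner_spaceMotion hε,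
    h.isometric _ (hA hp), hypMetric, inner_planeMotion hε, norm_planeMotion hε]

end

end IsSectorImmersion

/-! ### Gluing -/

open Filter Topology in
/-- Maps on the members of a finite closed cover that agree to first order where these meet have
a common extension, which is differentiable. -/
theorem exists_glue {ι E F : Type*} [Finite ι] [Nonempty ι] [NormedAddCommGroup E] [NormedSpace ℝ E]
    [NormedAddCommGroup F] [NormedSpace ℝ F] {U : Set E} (hU : IsOpen U) {C : ι → Set E}
    (hC : ∀ i, IsClosed (C i)) (hUC : U ⊆ ⋃ i, C i) {x : ι → E → F} {T : ι → E → E →L[ℝ] F}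
    (hx : ∀ i, ∀ p ∈ U ∩ C i, HasFDerivWithinAt (x i) (T i p) (U ∩ C i) p)
    (hT : ∀ i, ContinuousOn (T i) (U ∩ C i))
    (hij : ∀ i j, ∀ p ∈ U, p ∈ C i → p ∈ C j → x i p = x j p ∧ T i p = T j p) :
    ∃ y S, (∀ i, EqOn y (x i) (U ∩ C i)) ∧ (∀ i, EqOn S (T i) (U ∩ C i)) ∧
      (∀ p ∈ U, HasFDerivAt y (S p) p) ∧ ContinuousOn S U := by
  have hch : ∀ p, ∃ i, p ∈ U → p ∈ C i := by
    intro p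
    by_cases hp : p ∈ U
    · obtain ⟨i, hi⟩ := mem_iUnion.1 (hUC hp)
      exact ⟨i, fun _ => hi⟩
    · exact ⟨Classical.arbitrary ι, fun h => absurd h hp⟩
  choose i hi using hch
  have hy : ∀ j, EqOn (fun p => x (i p) p) (x j) (U ∩ C j) := fun j p hp =>
    (hij _ _ p hp.1 (hi p hp.1) hp.2).1
  have hS : ∀ j, EqOn (fun p => T (i p) p) (T j) (U ∩ C j) := fun j p hp =>
    (hij _ _ p hp.1 (hi p hp.1) hp.2).2
  have hfin : ∀ p ∈ U, 𝓝 p = ⨆ j, 𝓝[U ∩ C j] p := fun p hp => by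
    rw [← nhdsWithin_iUnion, ← inter_iUnion, inter_eq_left.2 hUC, hU.nhdsWithin_eq hp]
  refine ⟨fun p => x (i p) p, fun p => T (i p) p, hy, hS, fun p hp => ?_, fun p hp => ?_⟩
  · have hj : ∀ j, HasFDerivWithinAt (fun p => x (i p) p) (T (i p) p) (U ∩ C j) p := by
      intro j
      by_cases hpj : p ∈ C j
      · rw [show T (i p) p = T j p from hS j ⟨hp, hpj⟩]
        exact (hx j p ⟨hp, hpj⟩).congr (hy j) (hy j ⟨hp, hpj⟩)
      · refine HasFDerivWithinAt.of_notMem_closure fun h => hpj ?_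
        exact (hC j).closure_subset (closure_mono inter_subset_right h)
    rw [hasFDerivAt_iff_tendsto, hfin p hp, tendsto_iSup]
    exact fun j => hasFDerivWithinAt_iff_tendsto.1 (hj j)
  · refine ContinuousAt.continuousWithinAt ?_
    rw [ContinuousAt, hfin p hp, tendsto_iSup]
    intro j
    by_cases hpj : p ∈ C j
    · exact (hT j p ⟨hp, hpj⟩).congr (hS j) (hS j ⟨hp, hpj⟩)
    · have : 𝓝[U ∩ C j] p = ⊥ := by
        rw [← notMem_closure_iff_nhdsWithin_eq_bot]
        exact fun h => hpj ((hC j).closure_subset (closure_mono inter_subset_right h))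
      rw [this]
      exact tendsto_bot

/-- The sign `(-1)ᵏ`: the `k`-th sector is a rotated image of the first one for even `k` and a
reflected image for odd `k`. -/
noncomputable def sectorSign (k : ℕ) : ℝ := if Even k then 1 else -1

/-- The angle of the motion that takes the first sector to the `k`-th one. -/
noncomputable def sectorAngle (c : ℝ) (k : ℕ) : ℝ := if Even k then k * c else (k + 1) * c

theorem sectorSign_eq (k : ℕ) : sectorSign k = 1 ∨ sectorSign k = -1 := by
  unfold sectorSign; split_ifs <;> simp

theorem planeSector_eq_preimage (n k : ℕ) : planeSector n k =
    planeMotion (-(sectorSign k * sectorAngle (Real.pi / n) k)) (sectorSign k) ⁻¹'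
      sectorCone (Real.pi / n) := by
  set c := Real.pi / n with hc
  have e1 : (k : ℝ) * Real.pi / n = k * c := mul_div_assoc _ _ _
  have e2 : ((k : ℝ) + 1) * Real.pi / n = (k + 1) * c := mul_div_assoc _ _ _
  have hε := sectorSign_eq k
  ext p
  simp only [planeSector, e1, e2, mem_ofPred_eq, mem_preimage, polar_eq_smul_planeDir]
  constructor
  · rintro ⟨s, θ, hs, h1, h2, rfl⟩
    rw [map_smul, planeMotion_planeDir hε]
    refine ⟨s, _, hs, ?_, ?_, rfl⟩ <;> unfold sectorSign sectorAngle <;> split_ifs <;> linarith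
  · rintro ⟨s, θ, hs, h1, h2, hp⟩
    rw [← planeMotion_planeMotion_neg hε (sectorAngle c k) p, hp, map_smul,
      planeMotion_planeDir hε]
    refine ⟨s, _, hs, ?_, ?_, rfl⟩ <;> unfold sectorSign sectorAngle <;> split_ifs <;> linarith

theorem planeDir_add_two_pi (θ : ℝ) : planeDir (θ + 2 * Real.pi) = planeDir θ := by
  ext i; fin_cases i <;> simp [planeDir]

theorem exists_mem_planeSector {n : ℕ} (hn : 0 < n) (p : E2) :
    ∃ k < 2 * n, p ∈ planeSector n k := by
  obtain ⟨θ, h0, h1, hp⟩ : ∃ θ, 0 ≤ θ ∧ θ < 2 * Real.pi ∧ p = ‖p‖ • planeDir θ := by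
    have hp := exists_polar p
    set θ := Complex.arg ⟨p 0, p 1⟩ with hθ
    have h1 : -Real.pi < θ := Complex.neg_pi_lt_arg _
    have h2 : θ ≤ Real.pi := Complex.arg_le_pi _
    rcases le_or_gt 0 θ with h | h
    · exact ⟨θ, h, by linarith [Real.pi_pos], hp⟩
    · exact ⟨θ + 2 * Real.pi, by linarith, by linarith, by rwa [planeDir_add_two_pi]⟩
  have hn' : (0 : ℝ) < n := by exact_mod_cast hn
  have hc : 0 < Real.pi / n := div_pos Real.pi_pos hn'
  have hk := Nat.floor_le (div_nonneg h0 hc.le)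
  have hk' := (Nat.lt_floor_add_one (θ / (Real.pi / n))).le
  rw [le_div_iff₀ hc] at hk
  rw [div_le_iff₀ hc] at hk'
  refine ⟨⌊θ / (Real.pi / n)⌋₊, ?_, ‖p‖, θ, norm_nonneg _, ?_, ?_, ?_⟩
  · rw [Nat.floor_lt (div_nonneg h0 hc.le), div_lt_iff₀ hc]
    push_cast
    refine h1.trans_le (le_of_eq ?_)
    field_simp
  · rwa [mul_div_assoc]
  · rwa [mul_div_assoc]
  · rwa [polar_eq_smul_planeDir]

theorem exists_eq_add_of_planeDir_eq {θ θ' : ℝ} (h : planeDir θ = planeDir θ') :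
    ∃ m : ℤ, θ' = θ + m * (2 * Real.pi) := by
  have h0 := congrArg (fun p : E2 => p 0) h
  have h1 := congrArg (fun p : E2 => p 1) h
  simp [planeDir] at h0 h1
  obtain ⟨m, hm⟩ := Real.Angle.angle_eq_iff_two_pi_dvd_sub.1 (Real.Angle.cos_sin_inj h0 h1)
  exact ⟨-m, by push_cast; linarith⟩

theorem movedMap_two_pi (x : E2 → E3) : movedMap (2 * Real.pi) 1 x = movedMap 0 1 x := by
  ext p i; simp [movedMap, planeMotion_apply, spaceMotion_apply]

theorem movedDifferential_two_pi (T : E2 → E2 →L[ℝ] E3) :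
    movedDifferential (2 * Real.pi) 1 T = movedDifferential 0 1 T := by
  ext p v i; simp [movedDifferential, planeMotion_apply, spaceMotion_apply]

theorem mapsTo_planeMotion (n k : ℕ) (ρ : ℝ) :
    MapsTo (planeMotion (-(sectorSign k * sectorAngle (Real.pi / n) k)) (sectorSign k))
      (Metric.ball 0 ρ ∩ planeSector n k) (sectorDisk (Real.pi / n) ρ) := by
  rintro p ⟨hp, hpk⟩
  rw [planeSector_eq_preimage] at hpk
  rw [sectorDisk_eq_inter]
  refine ⟨?_, hpk⟩
  rw [mem_ball_zero_iff] at hp ⊢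
  rwa [norm_planeMotion (sectorSign_eq k)]

namespace IsSectorImmersion

variable {n : ℕ} {ρ : ℝ} {P : Set E3} {x : E2 → E3} {T : E2 → E2 →L[ℝ] E3}
  (h : IsSectorImmersion (Real.pi / n) ρ P x T)
include h

/-- Consecutive pieces agree to first order on their common ray. -/
theorem moved_succ_eq {s : ℝ} (hs : 0 ≤ s) (hsρ : s < ρ) (k : ℕ) {β : ℝ}
    (hβ : β = (k + 1) * (Real.pi / n)) :
    movedMap (sectorAngle (Real.pi / n) k) (sectorSign k) x (s • planeDir β) =
        movedMap (sectorAngle (Real.pi / n) (k + 1)) (sectorSign (k + 1)) x (s • planeDir β) ∧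
      movedDifferential (sectorAngle (Real.pi / n) k) (sectorSign k) T (s • planeDir β) =
        movedDifferential (sectorAngle (Real.pi / n) (k + 1)) (sectorSign (k + 1)) T
          (s • planeDir β) := by
  rcases Nat.even_or_odd k with hk | hk
  · have hk1 : ¬ Even (k + 1) := by simpa [Nat.even_add_one] using hk
    refine h.moved_eq (Or.inr rfl) hs hsρ (sectorSign_eq _) (sectorSign_eq _) ?_ ?_
    · rw [sectorAngle, sectorSign, if_pos hk, if_pos hk, hβ]; ring
    · rw [sectorAngle, sectorSign, if_neg hk1, if_neg hk1, hβ]; push_cast; ring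
  · have hk0 : ¬ Even k := Nat.not_even_iff_odd.2 hk
    have hk1 : Even (k + 1) := hk.add_one
    refine h.moved_eq (Or.inl rfl) hs hsρ (sectorSign_eq _) (sectorSign_eq _) ?_ ?_
    · rw [sectorAngle, sectorSign, if_neg hk0, if_neg hk0, hβ]; ring
    · rw [sectorAngle, sectorSign, if_pos hk1, if_pos hk1, hβ]; push_cast; ring

/-- Apart from the center, two of the `2n` sectors meet only if they are consecutive or the first
and the last one; the common ray is then one on which consecutive pieces agree. -/
theorem moved_eq_of_lt (hn : 0 < n) {k j : ℕ} (hkj : k < j) (hj : j < 2 * n) {p : E2}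
    (hp : ‖p‖ < ρ) (hpk : p ∈ planeSector n k) (hpj : p ∈ planeSector n j) :
    movedMap (sectorAngle (Real.pi / n) k) (sectorSign k) x p =
        movedMap (sectorAngle (Real.pi / n) j) (sectorSign j) x p ∧
      movedDifferential (sectorAngle (Real.pi / n) k) (sectorSign k) T p =
        movedDifferential (sectorAngle (Real.pi / n) j) (sectorSign j) T p := by
  have hn' : (0 : ℝ) < n := by exact_mod_cast hn
  have hc0 : 0 < Real.pi / n := div_pos Real.pi_pos hn'
  have h2π : 2 * Real.pi = 2 * n * (Real.pi / n) := by field_simp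
  obtain ⟨s, θ, hs, h1, h2, rfl⟩ := hpk
  obtain ⟨s', θ', hs', h1', h2', he⟩ := hpj
  rw [polar_eq_smul_planeDir] at he hp ⊢
  rw [polar_eq_smul_planeDir] at he
  rw [mul_div_assoc] at h1 h2 h1' h2'
  obtain rfl : s = s' := by
    have := congrArg norm he
    rwa [norm_smul_planeDir, norm_smul_planeDir, abs_of_nonneg hs, abs_of_nonneg hs'] at this
  rw [norm_smul_planeDir, abs_of_nonneg hs] at hp
  rcases hs.eq_or_lt with rfl | hs0
  · -- all pieces agree at the center, since consecutive ones do
    rw [zero_smul]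
    have hz : ∀ k : ℕ, movedMap (sectorAngle (Real.pi / n) k) (sectorSign k) x 0 =
        movedMap (sectorAngle (Real.pi / n) 0) (sectorSign 0) x 0 ∧
      movedDifferential (sectorAngle (Real.pi / n) k) (sectorSign k) T 0 =
        movedDifferential (sectorAngle (Real.pi / n) 0) (sectorSign 0) T 0 := by
      intro k
      induction k with
      | zero => exact ⟨rfl, rfl⟩
      | succ k ih =>
        have := h.moved_succ_eq le_rfl hp k rfl
        rw [zero_smul] at this
        exact ⟨this.1.symm.trans ih.1, this.2.symm.trans ih.2⟩
    exact ⟨(hz k).1.trans (hz j).1.symm, (hz k).2.trans (hz j).2.symm⟩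
  obtain ⟨m, hm⟩ := exists_eq_add_of_planeDir_eq (smul_right_injective E2 hs0.ne' he)
  rw [h2π] at hm
  set c := Real.pi / n
  have hkj' : (k : ℝ) + 1 ≤ j := by exact_mod_cast hkj
  have hj' : (j : ℝ) + 1 ≤ 2 * n := by exact_mod_cast hj
  have hk0 : (0 : ℝ) ≤ k := k.cast_nonneg
  have hm0 : 0 ≤ m := by
    by_contra! hlt
    have : (m : ℝ) + 1 ≤ 0 := by exact_mod_cast hlt
    nlinarith [mul_pos hn' hc0]
  have hm1 : m ≤ 1 := by
    by_contra! hlt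
    have : (2 : ℝ) ≤ m := by exact_mod_cast hlt
    nlinarith [mul_pos hn' hc0]
  -- `m = 0`: the sectors are consecutive; `m = 1`: they are the first and the last one
  interval_cases m
  · have hjk : (j : ℝ) ≤ k + 1 := by
      refine le_of_mul_le_mul_right ?_ hc0
      push_cast at hm
      linarith
    obtain rfl : j = k + 1 := le_antisymm (by exact_mod_cast hjk) hkj
    push_cast at h1' hm
    exact h.moved_succ_eq hs hp k (by linarith)
  · have h3 : 2 * (n : ℝ) + k ≤ j + 1 := by
      refine le_of_mul_le_mul_right ?_ hc0
      push_cast at hm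
      linarith
    obtain rfl : k = 0 := by
      have : 2 * n + k ≤ j + 1 := by exact_mod_cast h3
      omega
    obtain rfl : j = 2 * n - 1 := by
      have : 2 * n + 0 ≤ j + 1 := by exact_mod_cast h3
      omega
    have h4 : 2 * n - 1 + 1 = 2 * n := by omega
    have h5 : ((2 * n - 1 : ℕ) : ℝ) + 1 = 2 * n := by exact_mod_cast h4
    have h6 := h.moved_succ_eq hs hp (2 * n - 1) (β := θ') (by
      rw [h5] at h2' ⊢
      push_cast at hm h1
      linarith)
    have h7 : sectorAngle c (2 * n) = 2 * Real.pi := by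
      rw [sectorAngle, if_pos (even_two_mul n), h2π]; push_cast; ring
    have h8 : sectorSign (2 * n) = 1 := if_pos (even_two_mul n)
    have h9 : sectorAngle c 0 = 0 := by simp [sectorAngle]
    have h10 : sectorSign 0 = 1 := by simp [sectorSign]
    rw [h4, h7, h8, movedMap_two_pi, movedDifferential_two_pi, ← he] at h6
    rw [h9, h10]
    exact ⟨h6.1.symm, h6.2.symm⟩

theorem movedMap_mem (hn : 0 < n) {k : ℕ} (hk : k < 2 * n) {p : E2}
    (hp : p ∈ Metric.ball 0 ρ ∩ planeSector n k) :
    movedMap (sectorAngle (Real.pi / n) k) (sectorSign k) x p ∈ oddPeriodicExtension n P := by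
  have hq := h.mapsTo (mapsTo_planeMotion n k ρ hp)
  have hn' : (n : ℝ) ≠ 0 := by exact_mod_cast hn.ne'
  simp only [oddPeriodicExtension, mem_iUnion]
  rcases Nat.even_or_odd' k with ⟨j, rfl | rfl⟩
  · refine ⟨⟨j, by omega⟩, _, Or.inl hq, ?_⟩
    rw [← spaceMotion_one, movedMap]
    simp only [sectorAngle, sectorSign, even_two_mul, if_true]
    congr 2
    push_cast
    field_simp
  · have ho : ¬ Even (2 * j + 1) := by simp
    simp only [movedMap, sectorAngle, sectorSign, if_neg ho] at hq ⊢
    rcases eq_or_ne (j + 1) n with hj | hj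
    · -- the last sector is obtained from the last half-turn, whose rotation by `2π` is trivial
      refine ⟨⟨0, hn⟩, _, Or.inr ⟨_, hq, rfl⟩, ?_⟩
      rw [← spaceMotion_neg_one, ← spaceMotion_add_two_pi]
      congr 2
      have hjr : (j : ℝ) + 1 = n := by exact_mod_cast hj
      push_cast
      field_simp
      linear_combination -2 * hjr
    · refine ⟨⟨j + 1, by omega⟩, _, Or.inr ⟨_, hq, rfl⟩, ?_⟩
      rw [← spaceMotion_neg_one]
      congr 2
      push_cast
      field_simp
      ring

/-- The images of a sector immersion fit together to an isometric immersion of the disk. -/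
theorem exists_isometricImmersion (hn : 2 ≤ n) (hρ : 0 < ρ) :
    ∃ (y : E2 → E3) (S : E2 → E2 →L[ℝ] E3),
      (∀ p ∈ Metric.ball 0 ρ, HasFDerivAt y (S p) p) ∧ ContinuousOn S (Metric.ball 0 ρ) ∧
      (∀ p ∈ Metric.ball 0 ρ, ∀ a b, inner ℝ (S p a) (S p b) = hypMetric p a b) ∧
      (∀ k < 2 * n, ContDiffOn ℝ ∞ y (Metric.ball 0 ρ ∩ planeSector n k)) ∧
      (∀ k < 2 * n, ContDiffOn ℝ ∞ S (Metric.ball 0 ρ ∩ planeSector n k)) ∧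
      y 0 = 0 ∧ MapsTo y (Metric.ball 0 ρ) (oddPeriodicExtension n P) := by
  have hn0 : 0 < n := by omega
  have hn2 : (2 : ℝ) ≤ n := by exact_mod_cast hn
  have hc0 : 0 < Real.pi / n := by positivity
  have hcπ : Real.pi / n < Real.pi := div_lt_self Real.pi_pos (by linarith)
  have : Nonempty (Fin (2 * n)) := ⟨⟨0, by omega⟩⟩
  have hmem : ∀ p, ∃ k : Fin (2 * n), p ∈ planeSector n k := fun p => by
    obtain ⟨k, hk, hp⟩ := exists_mem_planeSector hn0 p
    exact ⟨⟨k, hk⟩, hp⟩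
  have hmaps := fun k => mapsTo_planeMotion n k ρ
  obtain ⟨y, S, hy, hS, hd, hSc⟩ := exists_glue (U := Metric.ball (0 : E2) ρ) Metric.isOpen_ball
    (C := fun k : Fin (2 * n) => planeSector n k)
    (x := fun k => movedMap (sectorAngle (Real.pi / n) k) (sectorSign k) x)
    (T := fun k => movedDifferential (sectorAngle (Real.pi / n) k) (sectorSign k) T)
    (fun k => by
      rw [planeSector_eq_preimage]
      exact (isClosed_sectorCone hc0 hcπ).preimage (ContinuousLinearMap.continuous _))
    (fun p _ => mem_iUnion.2 (hmem p))
    (fun k p hp => h.hasFDerivWithinAt_movedMap (hmaps k) hp)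
    (fun k => (h.contDiffOn_movedDifferential (hmaps k)).continuousOn)
    (fun i j p hp hpi hpj => by
      rw [mem_ball_zero_iff] at hp
      rcases lt_trichotomy i j with hlt | rfl | hlt
      · exact h.moved_eq_of_lt hn0 hlt j.2 hp hpi hpj
      · exact ⟨rfl, rfl⟩
      · have := h.moved_eq_of_lt hn0 hlt i.2 hp hpj hpi
        exact ⟨this.1.symm, this.2.symm⟩)
  refine ⟨y, S, hd, hSc, fun p hp a b => ?_, fun k hk => ?_, fun k hk => ?_, ?_, fun p hp => ?_⟩
  · obtain ⟨k, hk⟩ := hmem p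
    rw [hS k ⟨hp, hk⟩]
    exact h.inner_movedDifferential (hmaps k) (sectorSign_eq k) ⟨hp, hk⟩ a b
  · exact (h.contDiffOn_movedMap (hmaps k)).congr (hy ⟨k, hk⟩)
  · exact (h.contDiffOn_movedDifferential (hmaps k)).congr (hS ⟨k, hk⟩)
  · obtain ⟨k, hk⟩ := hmem 0
    rw [hy k ⟨Metric.mem_ball_self hρ, hk⟩]
    simp [movedMap, h.map_zero]
  · obtain ⟨k, hk⟩ := hmem p
    rw [hy k ⟨hp, hk⟩]
    exact h.movedMap_mem hn0 k.2 ⟨hp, hk⟩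

end IsSectorImmersion

/-! ### Weak derivatives of Lipschitz maps -/

open Filter Topology in
/-- A continuous map on a convex set that is `L`-Lipschitz on each member of a finite closed cover
is `L`-Lipschitz. -/
theorem lipschitzOnWith_of_closed_cover {ι E F : Type*} [Finite ι] [NormedAddCommGroup E]
    [NormedSpace ℝ E] [NormedAddCommGroup F] {K : Set E} (hK : Convex ℝ K) {C : ι → Set E}
    (hC : ∀ i, IsClosed (C i)) (hKC : K ⊆ ⋃ i, C i) {g : E → F} (hg : ContinuousOn g K)
    {L : NNReal} (hL : ∀ i, LipschitzOnWith L g (K ∩ C i)) : LipschitzOnWith L g K := by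
  rw [lipschitzOnWith_iff_norm_sub_le]
  intro q hq p hp
  -- the estimate holds up to the end point of the segment, as it propagates to the right
  set γ : ℝ → E := fun t => p + t • (q - p) with hγ
  have hγc : Continuous γ := by fun_prop
  have hγK : ∀ t ∈ Icc (0 : ℝ) 1, γ t ∈ K := fun t ht => hK.add_smul_sub_mem hp hq ht
  have hγd : ∀ s t, s ≤ t → ‖γ t - γ s‖ = (t - s) * ‖q - p‖ := fun s t hst => by
    rw [hγ, show p + t • (q - p) - (p + s • (q - p)) = (t - s) • (q - p) by module, norm_smul,
      Real.norm_of_nonneg (sub_nonneg.2 hst)]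
  have hgγ : ContinuousOn (fun t => g (γ t)) (Icc 0 1) := hg.comp hγc.continuousOn hγK
  set A : Set ℝ := {t | ‖g (γ t) - g p‖ ≤ L * (t * ‖q - p‖)} with hA
  have hcl : IsClosed (A ∩ Icc 0 1) := by
    rw [inter_comm]
    have : ContinuousOn (fun t => ‖g (γ t) - g p‖ - L * (t * ‖q - p‖)) (Icc 0 1) :=
      (hgγ.sub continuousOn_const).norm.sub (by fun_prop)
    convert this.preimage_isClosed_of_isClosed isClosed_Icc isClosed_Iic (t := Iic 0) using 2
    ext t
    simp [hA]
  have h1 : (1 : ℝ) ∈ A := by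
    refine hcl.Icc_subset_of_forall_exists_gt ?_ (fun t ht y hy => ?_) ⟨zero_le_one, le_rfl⟩
    · simp [hA, hγ]
    · -- some member of the cover contains points of the segment arbitrarily close to the right of
      -- `t`, hence also the point at `t` itself
      have hb : min y 1 ∈ Ioi t := lt_min hy ht.2.2
      have hfr : ∃ᶠ s in 𝓝[>] t, ∃ i, γ s ∈ C i ∧ s ∈ Ioc t (min y 1) := by
        refine Eventually.frequently ?_
        filter_upwards [Ioc_mem_nhdsGT hb] with s hs
        obtain ⟨i, hi⟩ := mem_iUnion.1
          (hKC (hγK s ⟨ht.2.1.trans hs.1.le, hs.2.trans (min_le_right _ _)⟩))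
        exact ⟨i, hi, hs⟩
      rw [Filter.frequently_exists] at hfr
      obtain ⟨i, hi⟩ := hfr
      have hti : γ t ∈ C i := by
        have h2 : ∃ᶠ s in 𝓝 t, γ s ∈ C i :=
          (hi.mono fun s hs => hs.1).filter_mono nhdsWithin_le_nhds
        exact ((hC i).preimage hγc).mem_of_frequently_of_tendsto h2 tendsto_id
      obtain ⟨s, hsi, hs⟩ := hi.exists
      have hs1 : s ∈ Icc (0 : ℝ) 1 := ⟨ht.2.1.trans hs.1.le, hs.2.trans (min_le_right _ _)⟩
      refine ⟨s, ?_, hs.1, hs.2.trans (min_le_left _ _)⟩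
      have h3 := (hL i).norm_sub_le ⟨hγK s hs1, hsi⟩ ⟨hγK t ⟨ht.2.1, ht.2.2.le⟩, hti⟩
      rw [hγd t s hs.1.le] at h3
      have h4 : ‖g (γ t) - g p‖ ≤ L * (t * ‖q - p‖) := ht.1
      calc ‖g (γ s) - g p‖ ≤ ‖g (γ s) - g (γ t)‖ + ‖g (γ t) - g p‖ :=
            norm_sub_le_norm_sub_add_norm_sub _ _ _
        _ ≤ L * ((s - t) * ‖q - p‖) + L * (t * ‖q - p‖) := add_le_add h3 h4
        _ = L * (s * ‖q - p‖) := by ring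
  simpa [hA, hγ] using h1

/-- A Lipschitz map on a bounded open set has bounded weak derivatives, which are its derivatives
wherever these exist. -/
theorem exists_isWeakPartial {D : Set E2} (hD : IsOpen D) (hDb : Bornology.IsBounded D)
    {f : E2 → E3} {L : NNReal} (hf : LipschitzOnWith L f D) (e : E2) :
    MemLp f 2 (volume.restrict D) ∧ ∃ g : E2 → E3, MemLp g 2 (volume.restrict D) ∧
      IsWeakPartial D e f g ∧ ∀ p ∈ D, ∀ A : E2 →L[ℝ] E3, HasFDerivAt f A p → g p = A e := by
  -- the weak derivative is the derivative of a Lipschitz extension, which exists almost everywhere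
  obtain ⟨F, hF, hfF⟩ := hf.extend_finite_dimension
  have hfin : IsFiniteMeasure (volume.restrict D) :=
    isFiniteMeasure_restrict.2 hDb.measure_lt_top.ne
  set g : E2 → E3 := fun p => fderiv ℝ F p e with hg
  have hgm : Measurable g := measurable_fderiv_apply_const ℝ F e
  have hgb : ∀ p, ‖g p‖ ≤ _ := fun p => (fderiv ℝ F p).le_of_opNorm_le
    (norm_fderiv_le_of_lipschitz ℝ hF) e
  refine ⟨?_, g, MemLp.of_bound hgm.aestronglyMeasurable _ (.of_forall hgb), ?_, ?_⟩
  · obtain ⟨R, hR⟩ := (isBounded_iff_forall_norm_le.1 (hF.isBounded_image hDb))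
    refine MemLp.of_bound ((hf.continuousOn).aestronglyMeasurable hD.measurableSet) R ?_
    filter_upwards [ae_restrict_mem hD.measurableSet] with p hp
    rw [hfF hp]
    exact hR _ (mem_image_of_mem F hp)
  · intro ψ hψ hψc hψD
    have h0 : ∀ p ∉ D, ψ p = 0 := fun p hp => image_eq_zero_of_notMem_tsupport fun h => hp (hψD h)
    have h0' : ∀ p ∉ D, fderiv ℝ ψ p = 0 := fun p hp =>
      image_eq_zero_of_notMem_tsupport fun h => hp (hψD (tsupport_fderiv_subset ℝ h))
    have e1 : ∫ p in D, fderiv ℝ ψ p e • f p = ∫ p, fderiv ℝ ψ p e • F p :=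
      (setIntegral_congr_fun hD.measurableSet fun p hp => by simp only [hfF hp]).trans
        (setIntegral_eq_integral_of_forall_compl_eq_zero fun p hp => by simp [h0' p hp])
    have e2 : ∫ p in D, ψ p • g p = ∫ p, ψ p • g p :=
      setIntegral_eq_integral_of_forall_compl_eq_zero fun p hp => by simp [h0 p hp]
    rw [e1, e2]
    have i1 : Integrable fun p => fderiv ℝ ψ p e • F p := by
      refine Continuous.integrable_of_hasCompactSupport ?_ ?_
      · exact ((hψ.continuous_fderiv (by simp)).clm_apply continuous_const).smul hF.continuous
      · exact (hψc.fderiv_apply (𝕜 := ℝ) e).smul_right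
    have i2 : Integrable fun p => ψ p • g p :=
      (hψ.continuous.integrable_of_hasCompactSupport hψc).smul_of_top_left
        (memLp_top_of_bound hgm.aestronglyMeasurable _ (.of_forall hgb))
    obtain ⟨Cψ, hψL⟩ := ContDiff.lipschitzWith_of_hasCompactSupport hψc hψ (by simp)
    have hae := hF.ae_differentiableAt (μ := volume)
    ext i
    have c1 := (EuclideanSpace.proj (𝕜 := ℝ) i : E3 →L[ℝ] ℝ).integral_comp_comm i1
    have c2 := (EuclideanSpace.proj (𝕜 := ℝ) i : E3 →L[ℝ] ℝ).integral_comp_comm i2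
    simp only [PiLp.proj_apply, PiLp.smul_apply, smul_eq_mul] at c1 c2
    rw [PiLp.neg_apply, ← c1, ← c2]
    have hFi : LipschitzWith _ fun p => F p i :=
      (EuclideanSpace.proj (𝕜 := ℝ) i : E3 →L[ℝ] ℝ).lipschitz.comp hF
    have key := hFi.integral_lineDeriv_mul_eq (μ := volume) hψL hψc e
    have k1 : ∫ p, lineDeriv ℝ (fun p => F p i) p e * ψ p = ∫ p, ψ p * g p i := by
      refine integral_congr_ae ?_
      filter_upwards [hae] with p hp
      have := ((EuclideanSpace.proj (𝕜 := ℝ) i : E3 →L[ℝ] ℝ).hasFDerivAt.comp p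
        hp.hasFDerivAt).hasLineDerivAt e
      rw [mul_comm, show lineDeriv ℝ (fun p => F p i) p e = g p i from this.lineDeriv]
    have k2 : ∫ p, lineDeriv ℝ ψ p (-e) * F p i = - ∫ p, fderiv ℝ ψ p e * F p i := by
      rw [← integral_neg]
      refine integral_congr_ae (.of_forall fun p => ?_)
      simp only [(hψ.differentiable (by simp) p).lineDeriv_eq_fderiv, map_neg, neg_mul]
    rw [k1, k2] at key
    rw [key, neg_neg]
  · intro p hp A hA
    have : HasFDerivAt F A p :=
      hA.congr_of_eventuallyEq (Filter.eventuallyEq_of_mem (hD.mem_nhds hp) hfF.symm)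
    simp only [hg, this.fderiv]

/-- A map on a bounded open set is in `W^{2,2}` if it and its differential are Lipschitz. -/
theorem memW22_of_lipschitz {D : Set E2} (hD : IsOpen D) (hDb : Bornology.IsBounded D)
    {y : E2 → E3} {S : E2 → E2 →L[ℝ] E3} (hy : ∀ p ∈ D, HasFDerivAt y (S p) p) {L L' : NNReal}
    (hyL : LipschitzOnWith L y D) (hSL : LipschitzOnWith L' S D) : MemW22 D y := by
  have hg := fun i : Fin 2 => (exists_isWeakPartial hD hDb hyL (EuclideanSpace.single i 1)).2
  choose g hg1 hg2 hg3 using hg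
  have hgL : ∀ i, ∃ L'', LipschitzOnWith L'' (g i) D := fun i => by
    have := (ContinuousLinearMap.apply ℝ E3
      (EuclideanSpace.single i (1 : ℝ) : E2)).lipschitz.comp_lipschitzOnWith hSL
    refine ⟨‖ContinuousLinearMap.apply ℝ E3 (EuclideanSpace.single i (1 : ℝ) : E2)‖₊ * L',
      fun p hp q hq => ?_⟩
    rw [hg3 i p hp _ (hy p hp), hg3 i q hq _ (hy q hq)]
    exact this hp hq
  choose L'' hgL using hgL
  have hh := fun i j : Fin 2 =>
    (exists_isWeakPartial hD hDb (hgL i) (EuclideanSpace.single j 1)).2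
  choose h hh1 hh2 _ using hh
  exact ⟨(exists_isWeakPartial hD hDb hyL 0).1, g, h, fun i => ⟨hg1 i, hg2 i⟩,
    fun i j => ⟨hh1 i j, hh2 i j⟩⟩

/-! ### Existence of the immersion -/

/-- The Euclidean radius is `tanh (R / 2)`. -/
theorem exists_hypDisk_eq_ball {R : ℝ} (hR : 0 < R) :
    ∃ ρ, 0 < ρ ∧ ρ < 1 ∧ hypDisk R = Metric.ball 0 ρ := by
  set C := Real.cosh R with hC
  have hC1 : 1 < C := Real.one_lt_cosh.2 hR.ne'
  have hq0 : 0 < (C - 1) / (C + 1) := div_pos (by linarith) (by linarith)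
  have hq1 : (C - 1) / (C + 1) < 1 := by rw [div_lt_one (by linarith)]; linarith
  have hρ1 : √((C - 1) / (C + 1)) < 1 := by rwa [Real.sqrt_lt' one_pos, one_pow]
  refine ⟨√((C - 1) / (C + 1)), Real.sqrt_pos.2 hq0, hρ1, ?_⟩
  ext p
  have hn := norm_nonneg p
  rw [mem_ball_zero_iff, Real.lt_sqrt hn]
  have key : ‖p‖ < 1 → (hypDist 0 p < R ↔ ‖p‖ ^ 2 < (C - 1) / (C + 1)) := by
    intro hp
    have h1 : 0 < 1 - ‖p‖ ^ 2 := by nlinarith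
    have e : hypDist 0 p = Real.arcosh (1 + 2 * ‖p‖ ^ 2 / (1 - ‖p‖ ^ 2)) := by simp [hypDist]
    rw [e, ← Real.arcosh_cosh hR.le, Real.arcosh_lt_arcosh (by positivity) (Real.cosh_pos R), ← hC,
      lt_div_iff₀ (by linarith), ← lt_sub_iff_add_lt', div_lt_iff₀ h1]
    constructor <;> intro h <;> linarith
  constructor
  · rintro ⟨hp, hd⟩
    exact (key hp).1 hd
  · intro h
    have hp : ‖p‖ < 1 := by nlinarith
    exact ⟨hp, (key hp).2 h⟩

theorem convex_planeSector {n : ℕ} (hn : 2 ≤ n) (k : ℕ) : Convex ℝ (planeSector n k) := by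
  have hn2 : (2 : ℝ) ≤ n := by exact_mod_cast hn
  rw [planeSector_eq_preimage]
  exact (convex_sectorCone (by positivity)
    (div_lt_self Real.pi_pos (by linarith))).linear_preimage (ContinuousLinearMap.toLinearMap _)

theorem isClosed_planeSector {n : ℕ} (hn : 2 ≤ n) (k : ℕ) : IsClosed (planeSector n k) := by
  have hn2 : (2 : ℝ) ≤ n := by exact_mod_cast hn
  rw [planeSector_eq_preimage]
  exact (isClosed_sectorCone (by positivity)
    (div_lt_self Real.pi_pos (by linarith))).preimage (ContinuousLinearMap.continuous _)

theorem contDiffOn_one_of_hasFDerivAt {U : Set E2} (hU : IsOpen U) {y : E2 → E3}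
    {S : E2 → E2 →L[ℝ] E3} (hy : ∀ p ∈ U, HasFDerivAt y (S p) p) (hS : ContinuousOn S U) :
    ContDiffOn ℝ 1 y U := by
  rw [show (1 : WithTop ℕ∞) = 0 + 1 from (zero_add 1).symm, contDiffOn_succ_iff_fderiv_of_isOpen hU]
  refine ⟨fun p hp => (hy p hp).differentiableAt.differentiableWithinAt, by simp, ?_⟩
  rw [contDiffOn_zero]
  exact hS.congr fun p hp => (hy p hp).fderiv

/-- A continuously differentiable map whose differential is smooth on each closed sector is in
`W^{2,2}` of every smaller disk. -/
theorem memW22_of_piecewise_smooth {n : ℕ} (hn : 2 ≤ n) {ρ ρ' : ℝ} (hρ : ρ' < ρ) {y : E2 → E3}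
    {S : E2 → E2 →L[ℝ] E3} (hy : ∀ p ∈ Metric.ball 0 ρ, HasFDerivAt y (S p) p)
    (hS : ContinuousOn S (Metric.ball 0 ρ))
    (hSk : ∀ k < 2 * n, ContDiffOn ℝ ∞ S (Metric.ball 0 ρ ∩ planeSector n k)) :
    MemW22 (Metric.ball 0 ρ') y := by
  have hsub : Metric.closedBall (0 : E2) ρ' ⊆ Metric.ball 0 ρ := Metric.closedBall_subset_ball hρ
  obtain ⟨L, hL⟩ := ((contDiffOn_one_of_hasFDerivAt Metric.isOpen_ball hy hS).mono
    hsub).exists_lipschitzOnWith one_ne_zero (convex_closedBall 0 ρ') (isCompact_closedBall 0 ρ')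
  have hk : ∀ k : Fin (2 * n), ∃ L',
      LipschitzOnWith L' S (Metric.closedBall 0 ρ' ∩ planeSector n k) := fun k =>
    ((hSk k k.2).mono (inter_subset_inter_left _ hsub)).exists_lipschitzOnWith (by simp)
      ((convex_closedBall 0 ρ').inter (convex_planeSector hn k))
      ((isCompact_closedBall 0 ρ').inter_right (isClosed_planeSector hn k))
  choose L' hL' using hk
  have hSL : LipschitzOnWith (Finset.univ.sup L') S (Metric.closedBall 0 ρ') := by
    refine lipschitzOnWith_of_closed_cover (convex_closedBall 0 ρ')
      (C := fun k : Fin (2 * n) => planeSector n k) (fun k => isClosed_planeSector hn k)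
      (fun p _ => ?_) (hS.mono hsub) fun k =>
        (hL' k).weaken (Finset.le_sup (Finset.mem_univ k))
    obtain ⟨k, hk, hp⟩ := exists_mem_planeSector (by omega : 0 < n) p
    exact mem_iUnion.2 ⟨⟨k, hk⟩, hp⟩
  have hb := Metric.ball_subset_closedBall (x := (0 : E2)) (ε := ρ')
  exact memW22_of_lipschitz Metric.isOpen_ball Metric.isBounded_ball
    (fun p hp => hy p (hsub (hb hp))) (hL.mono hb) (hSL.mono hb)

/-- For a large number of waves the generating angle stays small on a given square. -/
theorem IsAmslerProfile.smallAngle {c : ℝ} {f : ℝ → ℝ} (hf : IsAmslerProfile c f) (hc : 0 < c)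
    (hb : ∀ t, |f t| ≤ 2 * c * Real.exp (2 * |t|)) {M : ℝ}
    (hM : 2 * c * Real.exp (2 * M ^ 2) ≤ Real.pi / 3) : SmallAngle f M := by
  have hle : ∀ t, 0 ≤ t → t ≤ M ^ 2 → f t ≤ Real.pi / 3 := by
    intro t h0 hM2
    refine (le_abs_self _).trans ((hb t).trans (le_trans ?_ hM))
    rw [abs_of_nonneg h0]
    gcongr
  intro t h0 hM2
  refine ⟨hf.pos hc (T := M ^ 2) (fun s hs hsM => ?_) t h0 hM2, hle t h0 hM2⟩
  have := hle s hs hsM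
  linarith [Real.pi_pos]

theorem SmallAngle.box_subset_amslerDomain {f : ℝ → ℝ} {M : ℝ} (hM : SmallAngle f M) :
    Icc 0 M ×ˢ Icc 0 M ⊆ amslerDomain (painleveOfProfile f) := by
  rintro p ⟨hu, hv⟩
  refine mem_amslerDomain_iff.2 ⟨⟨hu.1, hv.1⟩, fun s hs => ?_⟩
  have h0 := mul_nonneg hu.1 hv.1
  have h1 : p.1 * p.2 ≤ M ^ 2 := by rw [sq]; exact mul_le_mul hu.2 hv.2 hv.1 (hu.1.trans hu.2)
  have := (hM (s * (p.1 * p.2)) (mul_nonneg hs.1 h0)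
    ((mul_le_of_le_one_left h0 hs.2).trans h1)).2
  linarith [Real.pi_pos]

theorem mainTheorem2 (R : ℝ) (hR : 0 < R) :
    ∃ N : ℕ, ∀ n : ℕ, N ≤ n → ∃ (S : Set E3) (x : E2 → E3),
      IsPeriodicAmslerSurface n S ∧
      IsIsometricImmersionOn (hypDisk R) x ∧
      MemW22 (hypDisk R) x ∧
      (∀ k < 2 * n, ContDiffOn ℝ ∞ x (hypDisk R ∩ planeSector n k)) ∧
      x 0 = 0 ∧
      MapsTo x (hypDisk R) S := by
  obtain ⟨ρ', hρ0', hρ1', hD⟩ := exists_hypDisk_eq_ball hR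
  -- the immersion is constructed on a larger disk, since the second derivatives have to be bounded
  obtain ⟨ρ, hρρ, hρ1⟩ := exists_between hρ1'
  have hρ0 : 0 < ρ := hρ0'.trans hρρ
  set M := 8 * ((1 + ρ ^ 2) / (1 - ρ ^ 2)) with hMdef
  -- `n ≥ 6 exp(2 M²)` makes `f ≤ 2 (π / n) exp(2 M²) ≤ π / 3` on `[0, M²]`
  refine ⟨⌈6 * Real.exp (2 * M ^ 2)⌉₊ + 2, fun n hn => ?_⟩
  have hn2 : 2 ≤ n := by omega
  have hn0 : (0 : ℝ) < n := by exact_mod_cast (by omega : 0 < n)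
  have hc0 : 0 < Real.pi / n := div_pos Real.pi_pos hn0
  have hcπ : Real.pi / n < Real.pi :=
    div_lt_self Real.pi_pos (by exact_mod_cast (by omega : 1 < n))
  obtain ⟨f, hf, hb⟩ := exists_isAmslerProfile (Real.pi / n) hc0.le
  obtain ⟨r, e₁, e₂, N, hr⟩ := exists_isAmslerFrame hf
  have hM : SmallAngle f M := by
    refine hf.smallAngle hc0 hb ?_
    have h1 : 6 * Real.exp (2 * M ^ 2) ≤ n :=
      (Nat.le_ceil _).trans (by exact_mod_cast (by omega : ⌈6 * Real.exp (2 * M ^ 2)⌉₊ ≤ n))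
    calc 2 * (Real.pi / n) * Real.exp (2 * M ^ 2)
        = Real.pi / 3 * (6 * Real.exp (2 * M ^ 2) / n) := by ring
      _ ≤ Real.pi / 3 * 1 := by
        have := Real.pi_pos
        gcongr
        exact (div_le_one hn0).2 h1
      _ = Real.pi / 3 := mul_one _
  obtain ⟨x, T, hx⟩ := exists_isSectorImmersion hr hf hc0 hcπ hM hρ0 hρ1 le_rfl
  have hx' : IsSectorImmersion (Real.pi / n) ρ (r '' amslerDomain (painleveOfProfile f)) x T :=
    { hx with mapsTo := hx.mapsTo.mono_right (image_mono hM.box_subset_amslerDomain) }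
  obtain ⟨y, S, hy, hS, hiso, hyk, hSk, hy0, hmaps⟩ := hx'.exists_isometricImmersion hn2 hρ0
  have hsub : Metric.ball (0 : E2) ρ' ⊆ Metric.ball 0 ρ := Metric.ball_subset_ball hρρ.le
  refine ⟨_, y, ⟨hn2, painleveOfProfile f, r, hf.isPainleveSolution,
    hr.isAmslerSector hf (by omega), rfl⟩, ⟨?_, fun p hp a b => ?_⟩, ?_, fun k hk => ?_, hy0, ?_⟩
  · rw [hD]
    exact (contDiffOn_one_of_hasFDerivAt Metric.isOpen_ball hy hS).mono hsub
  · rw [hD] at hp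
    rw [(hy p (hsub hp)).fderiv]
    exact hiso p (hsub hp) a b
  · rw [hD]
    exact memW22_of_piecewise_smooth hn2 hρρ hy hS hSk
  · rw [hD]
    exact (hyk k hk).mono (inter_subset_inter_left _ hsub)
  · rw [hD]
    exact hmaps.mono_left hsub
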